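/- A \emph{reachability switching game} consists of a finite directed graph $(V,E)$, a partition of $V$ into reachability vertices $V_R$, safety vertices $V_S$ and switching vertices $V_{Swi}$, for each $v\in V_{Swi}$ a switching order $\mathrm{ord}(v)=\langle u_1,\dots,u_k\rangle$ listing each out-neighbour of $v$ exactly once, a source $s\in V$ and a target $t\in V$. A token starts at $s$, and the game ends when the token reaches $t$ or a vertex without outgoing edges. At a vertex of $V_R$ (of $V_S$) the reachability (safety) player moves the token along an outgoing edge of her choice; at $v\in V_{Swi}$ the token moves to the next vertex of $\mathrm{ord}(v)$ in cyclic order, starting with $u_1$ at the first visit. The reachability player wins the game if she has a (deterministic, history-dependent) strategy such that every play consistent with it is finite and ends at $t$. The game is \emph{one-player} if $V_S=\emptyset$. A \emph{controlled switching flow} is a function $F:E\to\mathbb N$ such that outflow minus inflow is $1$ at $s$, $-1$ at $t$ and $0$ at every other vertex, and such that for each $v\in V_{Swi}$ with $\mathrm{ord}(v)=\langle u_1,\dots,u_k\rangle$ there are $c\in\mathbb N$ and $i\in\{0,\dots,k\}$ with $F(v,u_j)=c+1$ for $j\le i$ and $F(v,u_j)=c$ for $j>i$. \textbf{Theorem.}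 (i) In every one-player reachability switching game with $s\ne t$, the reachability player wins if and only if the game has a controlled switching flow $F$ with $F(e)\le n^n$ for all $e\in E$, where $n=|V|$. (ii) Deciding the winner of a one-player reachability switching game is in NP. That is, the language of all descriptions (by adjacency lists, in switching order at switching vertices, over a finite alphabet) of one-player reachability switching games that the reachability player wins is in NP: there are a polynomial $p$ and a deterministic Turing machine, deciding a relation $R(x,y)$ between words $x$ and binary certificates $y$ in time polynomial in $|x|+|y|$, such that a word $x$ is in the language if and only if $R(x,y)$ holds for some $y$ with $|y|\le p(|x|)$. -/

import Mathlib

/-- Who moves the token at a vertex: the reachability player, the safety player,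
or the switching order of the vertex. -/
inductive Owner where
  | reachability
  | safety
  | switching
deriving DecidableEq

instance : Fintype Owner where
  elems := {Owner.reachability, Owner.safety, Owner.switching}
  complete := by intro o; cases o <;> simp

/-- A reachability switching game on the finite vertex set `V`. The partition of `V` into the three
classes of vertices is the fibre partition of `owner`. For every switching vertex `v`, the list
`ord v` is a permutation of the vertices that have an incoming edge from `v`. -/
structure SwitchingGame (V : Type*) where
  edges : Finset (V × V)
  owner : V → Owner
  ord : {v : V // owner v = Owner.switching} → List V
  ord_nodup : ∀ v, (ord v).Nodup
  mem_ord : ∀ v u, u ∈ ord v ↔ (v.1, u) ∈ edges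
  source : V
  target : V

namespace SwitchingGame

variable {V : Type*} (G : SwitchingGame V)

/-- One-player games: the safety player has no vertex. -/
def OnePlayer : Prop := ∀ v, G.owner v ≠ Owner.safety

/-- The switching vertices. -/
abbrev Switch : Type _ := {v : V // G.owner v = Owner.switching}

/-- A game state: the vertex that holds the token, and for each switching vertex the current
(0-based) position in its switching order. -/
abbrev State : Type _ := V × (G.Switch → ℕ)

/-- The token is at the source and all counts are zero. -/
def init : G.State := (G.source, fun _ => 0)

variable [DecidableEq V]

/-- The count at `v` advances by one, and wraps around at the end of the switching order. -/
def upd (C : G.Switch → ℕ) (v : G.Switch) : G.Switch → ℕ :=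
  fun u => if v = u then (C u + 1) % (G.ord u).length else C u

/-- The possible moves between states. The game is over as soon as the token is at the target.
In every state that is reachable from `init` the count at a switching vertex that has an outgoing
edge is smaller than the length of its switching order. -/
inductive Move : G.State → G.State → Prop
  | player {v u : V} {C : G.Switch → ℕ} (hv : v ≠ G.target)
      (ho : G.owner v ≠ Owner.switching) (he : (v, u) ∈ G.edges) : Move (v, C) (u, C)
  | switch {v : G.Switch} {u : V} {C : G.Switch → ℕ} (hv : v.1 ≠ G.target)
      (hu : (G.ord v)[C v]? = some u) : Move (v.1, C) (u, G.upd C v)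

/-- Nonempty finite initial segments of plays: they start in `init` and proceed by moves. -/
def IsPlayPrefix (p : List G.State) : Prop :=
  p.head? = some G.init ∧ p.IsChain G.Move

/-- Finite plays: the last state is at the target or at a vertex without outgoing edges. -/
def IsFinitePlay (p : List G.State) : Prop :=
  G.IsPlayPrefix p ∧
    ∀ x ∈ p.getLast?, x.1 = G.target ∨ ∀ u, (x.1, u) ∉ G.edges

/-- Infinite plays. -/
def IsInfinitePlay (π : ℕ → G.State) : Prop :=
  π 0 = G.init ∧ ∀ i, G.Move (π i) (π (i + 1))

/-- The (deterministic, history dependent) strategies of the reachability player. To each play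
prefix that ends at a vertex `v` of this player they assign the endpoint of an outgoing edge of `v`
(there is nothing to choose if the game is over or if `v` has no outgoing edge; values at lists of
another form are irrelevant). -/
def IsReachStrategy (σ : List G.State → V) : Prop :=
  ∀ p, G.IsPlayPrefix p → ∀ x ∈ p.getLast?,
    G.owner x.1 = Owner.reachability → x.1 ≠ G.target → (∃ u, (x.1, u) ∈ G.edges) →
      (x.1, σ p) ∈ G.edges

/-- A finite sequence of states follows `σ`: whenever a vertex of the reachability player is left,
the next vertex is the one that `σ` selects for the history so far. -/
def Follows (σ : List G.State → V) (p : List G.State) : Prop :=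
  ∀ i x y, p[i]? = some x → p[i + 1]? = some y →
    G.owner x.1 = Owner.reachability → y.1 = σ (p.take (i + 1))

/-- The strategy `σ` is winning for the reachability player: every play that is consistent with `σ`
is finite and ends at the target. -/
def IsWinning (σ : List G.State → V) : Prop :=
  (∀ p, G.IsFinitePlay p → G.Follows σ p → ∀ x ∈ p.getLast?, x.1 = G.target) ∧
    ∀ π : ℕ → G.State, G.IsInfinitePlay π →
      ¬ ∀ k, G.Follows σ ((List.range k).map π)

/-- The reachability player wins the game. -/
def ReachWins : Prop :=
  ∃ σ : List G.State → V, G.IsReachStrategy σ ∧ G.IsWinning σ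

/-- Outgoing minus incoming flow at `v`. -/
def bal (F : G.edges → ℕ) (v : V) : ℤ :=
  (∑ e : G.edges with e.1.1 = v, (F e : ℤ)) - ∑ e : G.edges with e.1.2 = v, (F e : ℤ)

/-- Controlled switching flows: integral flows of value one from the source to the target, which
at each switching vertex send `c + 1` units along the first `i` edges of the switching order, and
`c` units along the others, for some `c` and `i`. -/
structure IsControlledSwitchingFlow (F : G.edges → ℕ) : Prop where
  bal_source : G.bal F G.source = 1
  bal_target : G.bal F G.target = -1
  bal_other : ∀ v, v ≠ G.source → v ≠ G.target → G.bal F v = 0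
  switching : ∀ v : G.Switch, ∃ c i : ℕ, i ≤ (G.ord v).length ∧
    ∀ (j : ℕ) (e : G.edges), e.1.1 = v.1 → (G.ord v)[j]? = some e.1.2 →
      F e = if j < i then c + 1 else c

end SwitchingGame

/-- The input alphabet: `tick` and `sep` are used to write vertex names. -/
inductive GameSymbol where
  | owner (o : Owner)
  | tick
  | sep
deriving DecidableEq, Fintype

/-- Vertex names are written in unary. Since the description of a game with `n` vertices has length
at least `n` in any case, this changes its length only polynomially. -/
def vertexName {n : ℕ} (v : Fin n) : List GameSymbol :=
  List.replicate v GameSymbol.tick ++ [GameSymbol.sep]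

/-- The word `w` describes the game `G` by adjacency lists: first the source and the target, then
for every vertex its owner and the names of its out-neighbours, in the switching order for a
switching vertex, and in any order for the other vertices. -/
def SwitchingGame.IsDescribedBy {n : ℕ} (G : SwitchingGame (Fin n)) (w : List GameSymbol) : Prop :=
  ∃ adj : Fin n → List (Fin n),
    (∀ v, (adj v).Nodup ∧ ∀ u, u ∈ adj v ↔ (v, u) ∈ G.edges) ∧
    (∀ v : G.Switch, adj v.1 = G.ord v) ∧
    w = vertexName G.source ++ vertexName G.target ++
      (List.finRange n).flatMap fun v =>
        GameSymbol.owner (G.owner v) :: (adj v).flatMap vertexName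

/-- The decision problem, as a language: the descriptions of the one-player reachability switching
games that the reachability player wins. -/
def onePlayerReachability : Language GameSymbol :=
  {w | ∃ (n : ℕ) (G : SwitchingGame (Fin n)), G.OnePlayer ∧ G.IsDescribedBy w ∧ G.ReachWins}

/-- The input word for a verifier: an instance followed by a certificate, over the disjoint union
of the two alphabets. -/
def encodeInstanceCertificate {α : Type} (z : List α × List Bool) : List (α ⊕ Bool) :=
  z.1.map Sum.inl ++ z.2.map Sum.inr

/-- The class NP: there are a polynomial `p` and a relation between words and certificates that is
decided by a deterministic (multi-stack) Turing machine in polynomial time, such that the words in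
`L` are those that have a certificate of length at most `p (|x|)`. -/
def InNP {α : Type} [Fintype α] (L : Language α) : Prop :=
  ∃ (p : Polynomial ℕ) (verify : List α × List Bool → Bool),
    Nonempty (Turing.TM2ComputableInPolyTime encodeInstanceCertificate
      Computability.encodeBool verify) ∧
    ∀ x : List α, x ∈ L ↔ ∃ y : List Bool, y.length ≤ p.eval x.length ∧ verify (x, y) = true

/-! Part (i). A finite initial segment of a play is summarised by the number `U e` of times it has
used each edge `e`. These numbers form a unit flow from the source to the current vertex. A
switching vertex with `k` out-edges that has been left `N` times has sent `N / k + 1` tokens along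
the first `N % k` edges of its order and `N / k` along the others. The structure `Trace` records
these facts, and `Trace.step` preserves them. A winning strategy has a consistent play that reaches
the target, because it can neither stop elsewhere nor go on forever
(`ReachWins.exists_isPlayPrefix`). A move depends only on the current state, so cycles in the
sequence of states can be cut out (`List.exists_nodup_isChain`). Then a vertex is visited at most
once for each vector of counts. There are at most n^n such vectors (`countP_le_pow`), and `U` is the
required flow. Conversely, let a flow `F` be given, and keep `U ≤ F` during the play. Away from the
target, conservation leaves some out-edge with `U < F`. At a switching vertex the prescribed edge
then has room too, because `U` and `F` both have staircase shape there
(`Trace.exists_move_of_flow`). The unused flow shrinks with every move, so the target is reached;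
circulations left over in `F` do no harm. Nobody else makes choices, so replaying this play is a
winning strategy (`reachWins_of_isPlayPrefix`).

Part (ii). If source and target agree, the player wins at once. Otherwise the certificate encodes a
flow. Write `F e = g₀ e + b e`, where `g₀ e` is one bit and `b` is constant on the out-edges of each
switching vertex. The first slice of the certificate holds the bits `g₀ e`, one per edge in the
order of the description. The further slices hold the binary digits of `b`, lowest digits first.
Since n^n < 2^(n * n), there are n * n of them. The switching condition now says that `g₀` decreases
along the out-edges, and that each further slice is constant on them. Conservation is checked by
addition with carries. Two accumulators hold outflow plus `[v = t]` and inflow plus `[v = s]`; after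
each digit slice they must have equal parity and are halved, and at the end they must agree
(`foldl_step_certificate`). All numbers stay small, so counters in unary suffice. The verifier is
written in a language of counter programs whose only loops run over the input word. Such programs
compile to stack machines that run in polynomial time (`steps_code`, `computableInPolyTime`), and
`verifier_spec` states what this particular program accepts. -/

/-! ### Counter programs with bounded loops, and their machine code -/

/-- Programs over counters that can read the input word only by bounded loops. The loops are indexed
by `I`; nested loops must have different indices. -/
inductive CounterProg (A I R : Type) where
  | skip
  | inc (r : R)
  | clear (r : R)
  | halve (r e : R)
  | cmp (r s : R) (body : Ordering → CounterProg A I R)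
  | seq (p q : CounterProg A I R)
  | forIn (i : I) (body : A → CounterProg A I R)

namespace CounterProg

variable {A I R : Type}

/-- The denotation of a program on the input word `w`: it transforms the values of the counters. -/
def eval [DecidableEq R] (w : List A) : CounterProg A I R → (R → ℕ) → R → ℕ
  | skip, st => st
  | inc r, st => Function.update st r (st r + 1)
  | clear r, st => Function.update st r 0
  | halve r e, st => Function.update (Function.update st e (st r % 2)) r (st r / 2)
  | cmp r s body, st => eval w (body (compare (st r) (st s))) st
  | seq p q, st => eval w q (eval w p st)
  | forIn _ body, st => w.foldl (fun st a => eval w (body a) st) st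

/-- The loop with index `i` occurs in the program. -/
def Loops (i : I) : CounterProg A I R → Prop
  | skip | inc _ | clear _ | halve _ _ => False
  | cmp _ _ body => ∃ o, Loops i (body o)
  | seq p q => Loops i p ∨ Loops i q
  | forIn j body => i = j ∨ ∃ a, Loops i (body a)

/-- Well-formed programs: the two arguments of `halve` and `cmp` differ, and so do the indices of
nested loops. -/
def WF : CounterProg A I R → Prop
  | skip | inc _ | clear _ => True
  | halve r e => r ≠ e
  | cmp r s body => r ≠ s ∧ ∀ o, WF (body o)
  | seq p q => WF p ∧ WF q
  | forIn i body => ∀ a, WF (body a) ∧ ¬ Loops i (body a)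

/-- The stacks of the machine that runs a program. -/
inductive Stack (I R : Type) where
  | input
  | output
  | unread (i : I)
  | read (i : I)
  | reg (r : R)
  | scratch
deriving DecidableEq, Fintype

/-- The alphabets of the stacks. -/
abbrev Stack.Sym (A : Type) : Stack I R → Type
  | input | unread _ | read _ => A
  | output | reg _ | scratch => Bool

/-- The local memory of the machine. -/
abbrev Mem (A : Type) := Option A × Bool × Bool

/-- The labels of the machine code of a program. -/
def Label : CounterProg A I R → Type
  | skip | inc _ | clear _ => Unit
  | halve _ _ => Fin 3
  | cmp _ _ body => Option Ordering ⊕ (o : Ordering) × Label (body o)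
  | seq p q => Label p ⊕ Label q
  | forIn _ body => Bool ⊕ (a : A) × Label (body a)

instance finite_label [Finite A] : (p : CounterProg A I R) → Finite (Label p)
  | skip | inc _ | clear _ => inferInstanceAs (Finite Unit)
  | halve _ _ => inferInstanceAs (Finite (Fin 3))
  | cmp _ _ body =>
    have := fun o => finite_label (body o)
    have : Finite Ordering := Finite.of_surjective
      (fun i : Fin 3 => if i = 0 then Ordering.lt else if i = 1 then .eq else .gt)
      (by intro o; cases o; exacts [⟨0, rfl⟩, ⟨1, rfl⟩, ⟨2, rfl⟩])
    inferInstanceAs (Finite (Option Ordering ⊕ (o : Ordering) × Label (body o)))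
  | seq p q =>
    have := finite_label p
    have := finite_label q
    inferInstanceAs (Finite (Label p ⊕ Label q))
  | forIn _ body =>
    have := fun a => finite_label (body a)
    inferInstanceAs (Finite (Bool ⊕ (a : A) × Label (body a)))

/-- The label at which the machine code starts. -/
def entry : (p : CounterProg A I R) → Label p
  | skip | inc _ | clear _ => ()
  | halve _ _ => (0 : Fin 3)
  | cmp _ _ _ => Sum.inl none
  | seq p _ => Sum.inl (entry p)
  | forIn _ _ => Sum.inl false

section Code

variable {Λ : Type}

/-- Statements of the machine. -/
abbrev MStmt (A I R Λ : Type) := Turing.TM2.Stmt (Stack.Sym A (I := I) (R := R)) Λ (Mem A)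

/-- Jump to a fixed label. -/
def jump (l : Λ) : MStmt A I R Λ := .goto fun _ => l

/-- Push a mark on a counter. -/
def pushReg (r : R) (q : MStmt A I R Λ) : MStmt A I R Λ := .push (Stack.reg r) (fun _ => true) q

/-- Push a mark on the scratch stack. -/
def pushScratch (q : MStmt A I R Λ) : MStmt A I R Λ := .push Stack.scratch (fun _ => true) q

/-- Pop from a counter, and remember in the first flag if it was positive. -/
def popReg (r : R) (q : MStmt A I R Λ) : MStmt A I R Λ :=
  .pop (Stack.reg r) (fun v a => (v.1, a.isSome, v.2.2)) q

/-- Pop from a counter, and remember in the second flag if it was positive. -/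
def popReg' (r : R) (q : MStmt A I R Λ) : MStmt A I R Λ :=
  .pop (Stack.reg r) (fun v a => (v.1, v.2.1, a.isSome)) q

/-- Pop from the scratch stack, and remember in the first flag if it was nonempty. -/
def popScratch (q : MStmt A I R Λ) : MStmt A I R Λ :=
  .pop Stack.scratch (fun v a => (v.1, a.isSome, v.2.2)) q

/-- Pop a letter of the unread part of a tape. -/
def popUnread (i : I) (q : MStmt A I R Λ) : MStmt A I R Λ :=
  .pop (Stack.unread i) (fun v a => (a, v.2)) q

/-- Pop a letter of the read part of a tape. -/
def popRead (i : I) (q : MStmt A I R Λ) : MStmt A I R Λ :=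
  .pop (Stack.read i) (fun v a => (a, v.2)) q

variable [Inhabited A]

/-- Push the remembered letter on the unread part of a tape. -/
def pushUnread (i : I) (q : MStmt A I R Λ) : MStmt A I R Λ :=
  .push (Stack.unread i) (fun v => (v.1.getD default : A)) q

/-- Push the remembered letter on the read part of a tape. -/
def pushRead (i : I) (q : MStmt A I R Λ) : MStmt A I R Λ :=
  .push (Stack.read i) (fun v => (v.1.getD default : A)) q

/-- Branch on the first flag. -/
def ifFst (q q' : MStmt A I R Λ) : MStmt A I R Λ := .branch (fun v => v.2.1) q q'

/-- Branch on the second flag. -/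
def ifSnd (q q' : MStmt A I R Λ) : MStmt A I R Λ := .branch (fun v => v.2.2) q q'

/-- Branch on whether a letter was read. -/
def ifSome (q q' : MStmt A I R Λ) : MStmt A I R Λ := .branch (fun v => v.1.isSome) q q'

/-- The machine code for halving a counter. -/
def halveCode (r e : R) (emb : Fin 3 → Λ) (exit : Λ) : Fin 3 → MStmt A I R Λ
  | 0 => popReg e (ifFst (jump (emb 0)) (jump (emb 1)))
  | 1 => popReg r (popReg' r (ifFst
      (ifSnd (pushScratch (jump (emb 1))) (pushReg e (jump (emb 2)))) (jump (emb 2))))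
  | 2 => popScratch (ifFst (pushReg r (jump (emb 2))) (jump exit))

/-- The machine code of a program inside a machine with labels `Λ`; afterwards the control
passes to the label `exit`. -/
def code : (p : CounterProg A I R) → (Label p → Λ) → Λ → Label p → MStmt A I R Λ
  | skip, _, exit, _ => jump exit
  | inc r, _, exit, _ => pushReg r (jump exit)
  | clear r, emb, exit, l => popReg r (ifFst (jump (emb l)) (jump exit))
  | halve r e, emb, exit, l => halveCode r e emb exit l
  | cmp r s body, emb, exit, l => match l with
    | .inl none => popReg r (popReg' s (ifFst
        (ifSnd (pushScratch (jump (emb (.inl none)))) (pushReg r (jump (emb (.inl (some .gt))))))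
        (ifSnd (pushReg s (jump (emb (.inl (some .lt))))) (jump (emb (.inl (some .eq)))))))
    | .inl (some o) => popScratch (ifFst (pushReg r (pushReg s (jump (emb (.inl (some o))))))
        (jump (emb (.inr ⟨o, entry (body o)⟩))))
    | .inr ⟨o, l⟩ => code (body o) (fun l => emb (.inr ⟨o, l⟩)) exit l
  | seq p q, emb, exit, l => match l with
    | .inl l => code p (fun l => emb (.inl l)) (emb (.inr (entry q))) l
    | .inr l => code q (fun l => emb (.inr l)) exit l
  | forIn i body, emb, exit, l => match l with
    | .inl false => popUnread i (ifSome (pushRead i (.goto fun v =>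
          emb (.inr ⟨v.1.getD default, entry (body (v.1.getD default))⟩)))
        (jump (emb (.inl true))))
    | .inl true => popRead i (ifSome (pushUnread i (jump (emb (.inl true)))) (jump exit))
    | .inr ⟨a, l⟩ => code (body a) (fun l => emb (.inr ⟨a, l⟩)) (emb (.inl false)) l

end Code

/-- The contents of the stacks. -/
def contents (x : List A) (o : List Bool) (u z : I → List A) (st : R → ℕ) (n : ℕ) :
    (k : Stack I R) → List (Stack.Sym A k)
  | .input => x
  | .output => o
  | .unread i => u i
  | .read i => z i
  | .reg r => List.replicate (st r) true
  | .scratch => List.replicate n true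

section Steps

variable {Λ : Type} [DecidableEq I] [DecidableEq R]

/-- From the label `l` with stacks `S`, and any local memory, the machine reaches the label `l'` with
contents `S'` in at most `t` steps. -/
def Steps (M : Λ → MStmt A I R Λ) (l : Λ) (S : (k : Stack I R) → List (Stack.Sym A k))
    (l' : Λ) (S' : (k : Stack I R) → List (Stack.Sym A k)) (t : ℕ) : Prop :=
  ∀ v, ∃ v', ∃ n ≤ t, (fun c => c.bind (Turing.TM2.step M))^[n] (some ⟨some l, v, S⟩) =
    some ⟨some l', v', S'⟩

theorem Steps.refl {M : Λ → MStmt A I R Λ} (l : Λ) (S) : Steps M l S l S 0 :=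
  fun v => ⟨v, 0, le_rfl, rfl⟩

theorem Steps.trans {M : Λ → MStmt A I R Λ} {l l' l'' : Λ} {S S' S''} {t t' u : ℕ}
    (h : Steps M l S l' S' t) (h' : Steps M l' S' l'' S'' t') (hu : t + t' ≤ u) :
    Steps M l S l'' S'' u := by
  intro v
  obtain ⟨v', n, hn, e⟩ := h v
  obtain ⟨v'', n', hn', e'⟩ := h' v'
  refine ⟨v'', n' + n, by omega, ?_⟩
  rw [Function.iterate_add_apply, e, e']

theorem Steps.mono {M : Λ → MStmt A I R Λ} {l l' : Λ} {S S'} {t u : ℕ}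
    (h : Steps M l S l' S' t) (hu : t ≤ u) : Steps M l S l' S' u :=
  h.trans (.refl _ _) hu

theorem Steps.single {M : Λ → MStmt A I R Λ} {l l' : Λ} {S S'}
    (h : ∀ v, ∃ v', Turing.TM2.stepAux (M l) v S = ⟨some l', v', S'⟩) : Steps M l S l' S' 1 := by
  intro v
  obtain ⟨v', h⟩ := h v
  exact ⟨v', 1, le_rfl, by simp [h]⟩

variable {x : List A} {o : List Bool} {u z : I → List A} {st : R → ℕ} {n : ℕ}

theorem update_contents_reg (r : R) (m : ℕ) :
    Function.update (contents x o u z st n) (Stack.reg r)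
      (List.replicate m true : List Bool) = contents x o u z (Function.update st r m) n := by
  refine Function.update_eq_iff.2 ⟨?_, fun k hk => ?_⟩
  · simp [contents]
  · cases k <;> simp_all [contents]

theorem update_contents_scratch (m : ℕ) :
    Function.update (contents x o u z st n) Stack.scratch
      (List.replicate m true : List Bool) = contents x o u z st m := by
  refine Function.update_eq_iff.2 ⟨rfl, fun k hk => ?_⟩
  cases k <;> simp_all [contents]

theorem update_contents_unread (i : I) (y : List A) :
    Function.update (contents x o u z st n) (Stack.unread i) y =
      contents x o (Function.update u i y) z st n := by
  refine Function.update_eq_iff.2 ⟨?_, fun k hk => ?_⟩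
  · simp [contents]
  · cases k <;> simp_all [contents]

theorem update_contents_read (i : I) (y : List A) :
    Function.update (contents x o u z st n) (Stack.read i) y =
      contents x o u (Function.update z i y) st n := by
  refine Function.update_eq_iff.2 ⟨?_, fun k hk => ?_⟩
  · simp [contents]
  · cases k <;> simp_all [contents]

open Turing.TM2 (stepAux)

variable (q q' : MStmt A I R Λ) (v : Mem A)

@[simp] theorem stepAux_jump (l : Λ) (S) :
    stepAux (jump l : MStmt A I R Λ) v S = ⟨some l, v, S⟩ := rfl

@[simp] theorem stepAux_pushReg (r : R) :
    stepAux (pushReg r q) v (contents x o u z st n) =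
      stepAux q v (contents x o u z (Function.update st r (st r + 1)) n) := by
  rw [← update_contents_reg]; rfl

@[simp] theorem stepAux_pushScratch :
    stepAux (pushScratch q) v (contents x o u z st n) =
      stepAux q v (contents x o u z st (n + 1)) := by
  rw [← update_contents_scratch (n := n) (n + 1)]; rfl

@[simp] theorem stepAux_popReg (r : R) :
    stepAux (popReg r q) v (contents x o u z st n) =
      stepAux q (v.1, decide (0 < st r), v.2.2)
        (contents x o u z (Function.update st r (st r - 1)) n) := by
  rw [← update_contents_reg]
  simp only [popReg, Turing.TM2.stepAux, contents]
  rcases h : st r with _ | k <;> simp [List.replicate_succ]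

@[simp] theorem stepAux_popReg' (r : R) :
    stepAux (popReg' r q) v (contents x o u z st n) =
      stepAux q (v.1, v.2.1, decide (0 < st r))
        (contents x o u z (Function.update st r (st r - 1)) n) := by
  rw [← update_contents_reg]
  simp only [popReg', Turing.TM2.stepAux, contents]
  rcases h : st r with _ | k <;> simp [List.replicate_succ]

@[simp] theorem stepAux_popScratch :
    stepAux (popScratch q) v (contents x o u z st n) =
      stepAux q (v.1, decide (0 < n), v.2.2) (contents x o u z st (n - 1)) := by
  rw [← update_contents_scratch (n := n) (n - 1)]
  simp only [popScratch, Turing.TM2.stepAux, contents]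
  rcases n with _ | k <;> simp [List.replicate_succ]

@[simp] theorem stepAux_popUnread (i : I) :
    stepAux (popUnread i q) v (contents x o u z st n) =
      stepAux q ((u i).head?, v.2) (contents x o (Function.update u i (u i).tail) z st n) := by
  rw [← update_contents_unread]; rfl

@[simp] theorem stepAux_popRead (i : I) :
    stepAux (popRead i q) v (contents x o u z st n) =
      stepAux q ((z i).head?, v.2) (contents x o u (Function.update z i (z i).tail) st n) := by
  rw [← update_contents_read]; rfl

@[simp] theorem stepAux_ifFst (S) :
    stepAux (ifFst q q') v S = if v.2.1 then stepAux q v S else stepAux q' v S := by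
  simp only [ifFst, Turing.TM2.stepAux]
  cases v.2.1 <;> simp

@[simp] theorem stepAux_ifSnd (S) :
    stepAux (ifSnd q q') v S = if v.2.2 then stepAux q v S else stepAux q' v S := by
  simp only [ifSnd, Turing.TM2.stepAux]
  cases v.2.2 <;> simp

@[simp] theorem stepAux_ifSome (S) :
    stepAux (ifSome q q') v S = if v.1.isSome then stepAux q v S else stepAux q' v S := by
  simp only [ifSome, Turing.TM2.stepAux]
  cases v.1.isSome <;> simp

variable [Inhabited A]

@[simp] theorem stepAux_pushUnread (i : I) :
    stepAux (pushUnread i q) v (contents x o u z st n) =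
      stepAux q v (contents x o (Function.update u i (v.1.getD default :: u i)) z st n) := by
  rw [← update_contents_unread]; rfl

@[simp] theorem stepAux_pushRead (i : I) :
    stepAux (pushRead i q) v (contents x o u z st n) =
      stepAux q v (contents x o u (Function.update z i (v.1.getD default :: z i)) st n) := by
  rw [← update_contents_read]; rfl

end Steps

end CounterProg

/-! ### Growth of counters, running time, and correctness of the machine code -/

namespace CounterProg

variable {A I R : Type}

/-- Bound for the growth of the counters, as a function of the length of the input. -/
noncomputable def growth [Fintype A] : CounterProg A I R → Polynomial ℕ
  | skip | clear _ | halve _ _ => 0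
  | inc _ => 1
  | cmp _ _ body => growth (body .lt) + growth (body .eq) + growth (body .gt)
  | seq p q => growth p + growth q
  | forIn _ body => Polynomial.X * ∑ a, growth (body a)

/-- Bound for the running time, as a function of a bound for the length of the input and the
initial values of the counters. -/
noncomputable def time [Fintype A] : CounterProg A I R → Polynomial ℕ
  | skip | inc _ => 1
  | clear _ => .X + 1
  | halve _ _ => 3 * (.X + 1)
  | cmp _ _ body => 2 * (.X + 1) + (time (body .lt) + time (body .eq) + time (body .gt))
  | seq p q => time p + (time q).comp (.X + growth p)
  | forIn _ body => .X * (1 + (∑ a, time (body a)).comp (.X + .X * ∑ a, growth (body a))) + .X + 2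

theorem _root_.Polynomial.monotone_eval_nat (p : Polynomial ℕ) : Monotone fun n => p.eval n := by
  intro a b h
  simp only [Polynomial.eval_eq_sum, Polynomial.sum]
  exact Finset.sum_le_sum fun i _ => Nat.mul_le_mul_left _ (Nat.pow_le_pow_left h i)

/-- One command raises the maximum of the counters by at most one, and a loop body runs once per
letter. Hence the growth is additive and depends only on the length of the input, never on the
values of the counters. This is what keeps the running time of nested loops polynomial. -/
theorem eval_le [Fintype A] [DecidableEq R] (w : List A) :
    ∀ (p : CounterProg A I R) (st : R → ℕ) (K : ℕ), (∀ r, st r ≤ K) →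
      ∀ r, eval w p st r ≤ K + (growth p).eval w.length
  | skip, st, K, h, r => (h r).trans (by simp)
  | inc s, st, K, h, r => by
    have := h r
    have := h s
    simp only [eval, growth, Function.update_apply, Polynomial.eval_one]
    split_ifs <;> omega
  | clear s, st, K, h, r => by
    have := h r
    simp only [eval, growth, Function.update_apply, Polynomial.eval_zero]
    split_ifs <;> omega
  | halve s e, st, K, h, r => by
    have := h r
    have := h s
    simp only [eval, growth, Function.update_apply, Polynomial.eval_zero]
    split_ifs <;> omega
  | cmp s s' body, st, K, h, r => by
    have := eval_le w (body (compare (st s) (st s'))) st K h r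
    simp only [eval, growth, Polynomial.eval_add]
    generalize compare (st s) (st s') = o at this ⊢
    cases o <;> omega
  | seq p q, st, K, h, r => by
    have := eval_le w q _ _ (eval_le w p st K h) r
    simp only [eval, growth, Polynomial.eval_add]
    omega
  | forIn i body, st, K, h, r => by
    have key : ∀ (l : List A) (st : R → ℕ) (K : ℕ), (∀ r, st r ≤ K) → ∀ r,
        l.foldl (fun st a => eval w (body a) st) st r ≤
          K + l.length * (∑ a, growth (body a)).eval w.length := by
      intro l
      induction l with
      | nil => intro st K h r; simpa using h r
      | cons a l ih =>
        intro st K h r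
        have h1 := ih _ _ (eval_le w (body a) st K h) r
        have h2 : (growth (body a)).eval w.length ≤ (∑ a, growth (body a)).eval w.length := by
          rw [Polynomial.eval_finsetSum]
          exact Finset.single_le_sum (f := fun a => (growth (body a)).eval w.length)
            (fun _ _ => Nat.zero_le _) (Finset.mem_univ a)
        simp only [List.foldl_cons, List.length_cons]
        refine h1.trans ?_
        rw [add_mul]
        omega
    simpa [eval, growth] using key w st K h r

section Simulation

variable {Λ : Type} [DecidableEq I] [DecidableEq R]

theorem Steps.head {M : Λ → MStmt A I R Λ} {l l' l'' : Λ} {S S' S''} {t u : ℕ}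
    (h : ∀ v, ∃ v', Turing.TM2.stepAux (M l) v S = ⟨some l', v', S'⟩)
    (h' : Steps M l' S' l'' S'' t) (hu : t + 1 ≤ u) : Steps M l S l'' S'' u :=
  (Steps.single h).trans h' (by omega)

variable {M : Λ → MStmt A I R Λ} {x : List A} {o : List Bool} {u z : I → List A}

theorem steps_clear {r : R} {l exit : Λ} (hM : M l = popReg r (ifFst (jump l) (jump exit))) :
    ∀ (m : ℕ) (st : R → ℕ) (n : ℕ), st r = m → Steps M l (contents x o u z st n) exit
      (contents x o u z (Function.update st r 0) n) (m + 1) := by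
  intro m
  induction m with
  | zero =>
    intro st n h
    exact Steps.single fun v => ⟨_, by simp [hM, h]; exact rfl⟩
  | succ m ih =>
    intro st n h
    have := ih (Function.update st r m) n (by simp)
    rw [Function.update_idem] at this
    exact Steps.head (fun v => ⟨_, by simp [hM, h]; exact rfl⟩) this le_rfl

/-- Three passes of at most `K + 1` steps each: clear `e`, move pairs of marks from `r` to one mark
on the scratch stack (a single leftover mark goes to `e`), and move the scratch stack back to `r`.
-/
theorem steps_halve {r e : R} (hre : r ≠ e) {emb : Fin 3 → Λ} {exit : Λ}
    (hM : ∀ l, M (emb l) = halveCode r e emb exit l) (st : R → ℕ) (K : ℕ) (hr : st r ≤ K)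
    (he : st e ≤ K) : Steps M (emb 0) (contents x o u z st 0) exit
      (contents x o u z (Function.update (Function.update st e (st r % 2)) r (st r / 2)) 0)
      (3 * (K + 1)) := by
  have h1 := steps_clear (x := x) (o := o) (u := u) (z := z) (hM 0) (st e) st 0 rfl
  have h2 : ∀ (m : ℕ) (st : R → ℕ) (n : ℕ), st r = m → st e = 0 →
      Steps M (emb 1) (contents x o u z st n) (emb 2)
        (contents x o u z (Function.update (Function.update st e (m % 2)) r 0) (n + m / 2))
        (m + 1) := by
    intro m
    induction m using Nat.twoStepInduction with
    | zero =>
      intro st n h h'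
      have : Function.update (Function.update st e 0) r 0 = st := by
        funext i; simp only [Function.update_apply]; split_ifs <;> simp_all
      have h0 : Function.update st r 0 = st := by rw [← h, Function.update_eq_self]
      exact Steps.single fun v => ⟨(v.1, false, false), by simp [hM, halveCode, h, h0, this]⟩
    | one =>
      intro st n h h'
      have h0 : Function.update (Function.update st r 0) e 1 =
          Function.update (Function.update st e 1) r 0 := Function.update_comm hre _ _ _
      exact (Steps.single fun v => ⟨(v.1, true, false), by
        simp [hM, halveCode, h, h0, h', hre.symm]⟩).mono (Nat.le_succ 1)
    | more m ih _ =>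
      intro st n h h'
      have := ih (Function.update st r m) (n + 1) (by simp) (by simp [hre.symm, h'])
      refine Steps.head (S' := contents x o u z (Function.update st r m) (n + 1))
        (l' := emb 1) (fun v => ⟨(v.1, true, true), ?_⟩) (u := m + 1 + 1) ?_ le_rfl
        |>.mono (by omega)
      · simp [hM, halveCode, h]
      · convert this using 2
        · funext i; simp only [Function.update_apply]; split_ifs <;> simp_all
        · omega
  have h3 : ∀ (n : ℕ) (st : R → ℕ), Steps M (emb 2) (contents x o u z st n) exit
        (contents x o u z (Function.update st r (st r + n)) 0) (n + 1) := by
    intro n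
    induction n with
    | zero =>
      intro st
      exact Steps.single fun v => ⟨_, by simp [hM, halveCode]; exact rfl⟩
    | succ n ih =>
      intro st
      have := ih (Function.update st r (st r + 1))
      refine Steps.head (fun v => ⟨_, by simp [hM, halveCode]; exact ⟨rfl, rfl, rfl⟩⟩) ?_ le_rfl
      convert this using 2
      funext i; simp only [Function.update_apply]; split_ifs <;> simp_all; omega
  have h := h1.trans ((h2 (st r) _ 0 (by simp [hre]) (by simp)).trans (h3 _ _) le_rfl)
    (show _ ≤ 3 * (K + 1) by omega)
  convert h using 2
  funext i; simp only [Function.update_apply]; split_ifs <;> simp_all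

/-- Marks are popped from both counters in parallel, with one scratch mark per pair, until a counter
is empty. If just one of the two last pops succeeded, that mark is put back at once. The return
phase restores the pairs, and its label remembers the result of the comparison. -/
theorem steps_cmp {r s : R} (hrs : r ≠ s) {l : Λ} (ret : Ordering → Λ) (cont : Ordering → Λ)
    (hl : M l = popReg r (popReg' s (ifFst
        (ifSnd (pushScratch (jump l)) (pushReg r (jump (ret .gt))))
        (ifSnd (pushReg s (jump (ret .lt))) (jump (ret .eq))))))
    (hret : ∀ o, M (ret o) = popScratch (ifFst (pushReg r (pushReg s (jump (ret o))))
        (jump (cont o))))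
    (st : R → ℕ) (K : ℕ) (hr : st r ≤ K) :
    Steps M l (contents x o u z st 0) (cont (compare (st r) (st s))) (contents x o u z st 0)
      (2 * (K + 1)) := by
  have h1 : ∀ (m : ℕ) (st : R → ℕ) (n : ℕ), m = min (st r) (st s) →
      Steps M l (contents x o u z st n) (ret (compare (st r) (st s)))
        (contents x o u z (Function.update (Function.update st r (st r - m)) s (st s - m)) (n + m))
        (m + 1) := by
    intro m
    induction m with
    | zero =>
      intro st n hm
      have h0 : ∀ r, st r = 0 → Function.update st r 0 = st := fun r h => by
        rw [← h, Function.update_eq_self]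
      rcases Nat.lt_trichotomy (st r) (st s) with h | h | h
      · rw [compare_lt_iff_lt.2 h]
        have hr : st r = 0 := by omega
        exact Steps.single fun v => ⟨(v.1, false, true), by
          simp [hl, hr, h0, show 0 < st s by omega,
            show st s - 1 + 1 = st s by omega]⟩
      · rw [compare_eq_iff_eq.2 h]
        have hr : st r = 0 := by omega
        have hs : st s = 0 := by omega
        exact Steps.single fun v => ⟨(v.1, false, false), by
          simp [hl, hr, h0, hs]⟩
      · rw [compare_gt_iff_gt.2 h]
        have hs : st s = 0 := by omega
        refine Steps.single fun v => ⟨(v.1, true, false), ?_⟩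
        have h2 : Function.update st r (st r - 1) s = 0 := by simp [hrs.symm, hs]
        have h3 : Function.update (Function.update st r (st r - 1)) s 0 =
            Function.update st r (st r - 1) := by
          rw [← h2, Function.update_eq_self]
        simp [hl, h0, hs, hrs.symm, show 0 < st r by omega, h3,
            show st r - 1 + 1 = st r by omega]
    | succ m ih =>
      intro st n hm
      have := ih (Function.update (Function.update st r (st r - 1)) s (st s - 1)) (n + 1)
        (by simp [hrs]; omega)
      refine Steps.head (S' := contents x o u z
        (Function.update (Function.update st r (st r - 1)) s (st s - 1)) (n + 1))
        (l' := l) (fun v => ⟨(v.1, true, true), ?_⟩) ?_ le_rfl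
      · simp [hl, hrs.symm, show 0 < st r by omega, show 0 < st s by omega]
      · convert this using 2
        · simp only [ne_eq, hrs, not_false_eq_true, Function.update_of_ne, Function.update_self]
          rcases Nat.lt_trichotomy (st r) (st s) with h | h | h
          · rw [compare_lt_iff_lt.2 h, compare_lt_iff_lt.2 (by omega)]
          · rw [compare_eq_iff_eq.2 h, compare_eq_iff_eq.2 (by omega)]
          · rw [compare_gt_iff_gt.2 h, compare_gt_iff_gt.2 (by omega)]
        · funext i; simp only [Function.update_apply]; split_ifs <;> simp_all <;> omega
        · omega
  have h2 : ∀ (c : Ordering) (n : ℕ) (st : R → ℕ), Steps M (ret c) (contents x o u z st n) (cont c)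
      (contents x o u z (Function.update (Function.update st r (st r + n)) s (st s + n)) 0)
      (n + 1) := by
    intro c n
    induction n with
    | zero =>
      intro st
      exact Steps.single fun v => ⟨(v.1, false, v.2.2), by simp [hret]⟩
    | succ n ih =>
      intro st
      have := ih (Function.update (Function.update st r (st r + 1)) s (st s + 1))
      refine Steps.head (l' := ret c) (S' := contents x o u z
        (Function.update (Function.update st r (st r + 1)) s (st s + 1)) n)
        (fun v => ⟨(v.1, true, v.2.2), by simp [hret, hrs.symm]⟩) ?_ le_rfl
      convert this using 2
      funext i; simp only [Function.update_apply]; split_ifs <;> simp_all <;> omega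
  have h := (h1 (min (st r) (st s)) st 0 rfl).trans (h2 _ _ _) (show _ ≤ 2 * (K + 1) by omega)
  convert h using 2
  funext i; simp only [Function.update_apply]; split_ifs <;> simp_all

variable [Inhabited A]

theorem steps_rewind {i : I} {l exit : Λ}
    (hl : M l = popRead i (ifSome (pushUnread i (jump l)) (jump exit))) (st : R → ℕ) (n : ℕ) :
    ∀ (y : List A) (u z : I → List A), z i = y → Steps M l (contents x o u z st n) exit
      (contents x o (Function.update u i (y.reverse ++ u i)) (Function.update z i []) st n)
      (y.length + 1) := by
  intro y
  induction y with
  | nil =>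
    intro u z h
    have h0 : Function.update z i [] = z := by rw [← h, Function.update_eq_self]
    exact Steps.single fun v => ⟨(none, v.2), by simp [hl, h, h0]⟩
  | cons a y ih =>
    intro u z h
    refine Steps.head (l' := l) (S' := contents x o (Function.update u i (a :: u i))
      (Function.update z i y) st n) (fun v => ⟨(some a, v.2), by simp [hl, h]⟩) ?_ le_rfl
    convert ih (Function.update u i (a :: u i)) (Function.update z i y) (by simp) using 2 <;> simp

/-- The assumption on the tapes concerns only loops that occur in `p`. So the body of a loop may run
while the tape of that loop is half read, and this is where distinct indices of nested loops are
needed. -/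
theorem steps_code [Fintype A] :
    ∀ (p : CounterProg A I R) (_ : WF p) (emb : Label p → Λ) (exit : Λ)
      (_ : ∀ l, M (emb l) = code p emb exit l) (w : List A) (K : ℕ) (u z : I → List A)
      (_ : ∀ i, Loops i p → u i = w ∧ z i = []) (st : R → ℕ) (_ : ∀ r, st r ≤ K) (_ : w.length ≤ K),
      Steps M (emb (entry p)) (contents x o u z st 0) exit (contents x o u z (eval w p st) 0)
        ((time p).eval K)
  | skip, _, emb, exit, hM, w, K, u, z, hu, st, hst, hw => by
    refine (Steps.single fun v => ⟨v, ?_⟩).mono (by simp [time])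
    rw [hM]; simp [code, eval]
  | inc r, _, emb, exit, hM, w, K, u, z, hu, st, hst, hw => by
    refine (Steps.single fun v => ⟨v, ?_⟩).mono (by simp [time])
    rw [hM]; simp [code, eval]
  | clear r, _, emb, exit, hM, w, K, u, z, hu, st, hst, hw => by
    refine (steps_clear (hM ()) (st r) st 0 rfl).mono ?_
    have := hst r
    simp [time]; omega
  | halve r e, hp, emb, exit, hM, w, K, u, z, hu, st, hst, hw => by
    refine (steps_halve hp hM st K (hst r) (hst e)).mono ?_
    simp [time]
  | cmp r s body, hp, emb, exit, hM, w, K, u, z, hu, st, hst, hw => by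
    have h1 := steps_cmp (x := x) (o := o) (u := u) (z := z) hp.1 (l := emb (.inl none))
      (fun c => emb (.inl (some c))) (fun c => emb (.inr ⟨c, entry (body c)⟩))
      (hM _) (fun c => hM _) st K (hst r)
    have h2 := steps_code (body (compare (st r) (st s))) (hp.2 _) (fun l => emb (.inr ⟨_, l⟩)) exit
      (fun l => hM _) w K u z (fun i hi => hu i ⟨_, hi⟩) st hst hw
    refine h1.trans h2 ?_
    simp only [time, Polynomial.eval_add, Polynomial.eval_mul, Polynomial.eval_X,
      Polynomial.eval_one, Polynomial.eval_ofNat]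
    generalize compare (st r) (st s) = c
    cases c <;> omega
  | seq p q, hp, emb, exit, hM, w, K, u, z, hu, st, hst, hw => by
    have h1 := steps_code p hp.1 (fun l => emb (.inl l)) (emb (.inr (entry q)))
      (fun l => hM _) w K u z
      (fun i hi => hu i (.inl hi)) st hst hw
    have h2 := steps_code q hp.2 (fun l => emb (.inr l)) exit (fun l => hM _) w
      (K + (growth p).eval K) u z (fun i hi => hu i (.inr hi)) (eval w p st)
      (fun r => (eval_le w p st K hst r).trans
        (Nat.add_le_add_left (Polynomial.monotone_eval_nat _ hw) _)) (hw.trans (Nat.le_add_right _ _))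
    refine h1.trans h2 ?_
    simp [time]
  | forIn i body, hp, emb, exit, hM, w, K, u, z, hu, st, hst, hw => by
    set G := (∑ a, growth (body a)).eval K with hG
    set T := (∑ a, time (body a)).eval (K + K * G) with hT
    have hgrow : ∀ (a : A) (st : R → ℕ) (j : ℕ), (∀ r, st r ≤ K + j * G) →
        ∀ r, eval w (body a) st r ≤ K + (j + 1) * G := by
      intro a st j h r
      refine (eval_le w (body a) st _ h r).trans ?_
      have h1 := Polynomial.monotone_eval_nat (growth (body a)) hw
      have h2 : (growth (body a)).eval K ≤ G := by
        rw [hG, Polynomial.eval_finsetSum]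
        exact Finset.single_le_sum (f := fun a => (growth (body a)).eval K)
          (fun _ _ => Nat.zero_le _) (Finset.mem_univ a)
      simp only at h1
      rw [add_mul, one_mul]
      omega
    have hM0 : M (emb (.inl false)) = popUnread i (ifSome (pushRead i (.goto fun v =>
        emb (.inr ⟨v.1.getD default, entry (body (v.1.getD default))⟩)))
        (jump (emb (.inl true)))) := hM _
    -- Loop invariant: `y` is the unread suffix and `y'` the reversed prefix already read. After `j`
    -- letters the counters are at most `K + j * G`, so every run of the body starts below `K + K *
    -- G`.
    have key : ∀ (y y' : List A) (st : R → ℕ) (j : ℕ), y'.reverse ++ y = w → y'.length = j →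
        (∀ r, st r ≤ K + j * G) →
        Steps M (emb (.inl false))
          (contents x o (Function.update u i y) (Function.update z i y') st 0)
          (emb (.inl true))
          (contents x o (Function.update u i []) (Function.update z i w.reverse)
            (y.foldl (fun st a => eval w (body a) st) st) 0) (y.length * (1 + T) + 1) := by
      intro y
      induction y with
      | nil =>
        intro y' st j hy hj h
        refine (Steps.single fun v => ⟨(none, v.2), ?_⟩).mono (by simp)
        simp [hM0, ← hy]
      | cons a y ih =>
        intro y' st j hy hj h
        have hjK : j + 1 ≤ K := by
          have := congrArg List.length hy
          simp at this
          omega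
        have h1 : Steps M (emb (.inl false))
            (contents x o (Function.update u i (a :: y)) (Function.update z i y') st 0)
            (emb (.inr ⟨a, entry (body a)⟩))
            (contents x o (Function.update u i y) (Function.update z i (a :: y')) st 0) 1 := by
          refine Steps.single fun v => ⟨(some a, v.2), ?_⟩
          simp [hM0]
        have h2 := steps_code (body a) (hp a).1 (fun l => emb (.inr ⟨a, l⟩)) (emb (.inl false))
          (fun l => hM _) w (K + K * G) (Function.update u i y) (Function.update z i (a :: y'))
          -- Only the tape `i` is in an intermediate position, and the body does not loop over it.
          (fun i' hi' => by
            have hne : i' ≠ i := by rintro rfl; exact (hp a).2 hi'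
            rw [Function.update_of_ne hne, Function.update_of_ne hne]
            exact hu i' (.inr ⟨a, hi'⟩)) st
          (fun r => (h r).trans (by gcongr; omega)) (by omega)
        have h3 := ih (a :: y') (eval w (body a) st) (j + 1) (by simpa using hy) (by simp [hj])
          (hgrow a st j h)
        have hT' : (time (body a)).eval (K + K * G) ≤ T := by
          rw [hT, Polynomial.eval_finsetSum]
          exact Finset.single_le_sum (f := fun a => (time (body a)).eval (K + K * G))
            (fun _ _ => Nat.zero_le _) (Finset.mem_univ a)
        refine (h1.trans h2 le_rfl).trans h3 ?_
        rw [List.length_cons, add_mul]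
        omega
    obtain ⟨hui, hzi⟩ := hu i (.inl rfl)
    have h1 := key w [] st 0 rfl rfl (by simpa using hst)
    rw [Function.update_eq_self_iff.2 hui.symm, Function.update_eq_self_iff.2 hzi.symm] at h1
    have h2 := steps_rewind (x := x) (o := o) (hM (.inl true)) (eval w (forIn i body) st) 0
      w.reverse (Function.update u i []) (Function.update z i w.reverse) (by simp)
    have h := h1.trans h2 (show _ ≤ (time (forIn i body)).eval K from ?_)
    · convert h using 2
      · rfl
      · simp [← hui]
      · simp [← hzi]
    · simp only [time, Polynomial.eval_add, Polynomial.eval_mul, Polynomial.eval_X,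
        Polynomial.eval_one, Polynomial.eval_ofNat, Polynomial.eval_comp, List.length_reverse]
      rw [← hG, ← hT]
      have : w.length * (1 + T) ≤ K * (1 + T) := Nat.mul_le_mul_right _ hw
      omega

end Simulation

end CounterProg

/-! ### The complete machine of a program -/

namespace CounterProg

variable {A R : Type}

/-- The program that clears the counters in a list. -/
def clearAll {I : Type} : List R → CounterProg A I R
  | [] => skip
  | r :: rs => seq (clear r) (clearAll rs)

theorem wf_clearAll {I : Type} : ∀ rs : List R, WF (clearAll rs : CounterProg A I R)
  | [] => trivial
  | _ :: rs => ⟨trivial, wf_clearAll rs⟩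

theorem eval_clearAll {I : Type} [DecidableEq R] (w : List A) : ∀ (rs : List R) (st : R → ℕ) (r : R),
    eval w (clearAll rs : CounterProg A I R) st r = if r ∈ rs then 0 else st r
  | [], _, _ => by simp [clearAll, eval]
  | s :: rs, st, r => by
    simp only [clearAll, eval, eval_clearAll w rs, Function.update_apply, List.mem_cons]
    split_ifs <;> simp_all

/-- The phases of the machine that do not belong to the program. -/
inductive Phase where
  | load
  | rewind
  | output
  | drain
deriving DecidableEq

instance : Fintype Phase where
  elems := {.load, .rewind, .output, .drain}
  complete := by intro i; cases i <;> simp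

/-- The letter push and pop operations for the input stack. -/
def popInput {I Λ : Type} (q : MStmt A I R Λ) : MStmt A I R Λ :=
  .pop Stack.input (fun v a => (a, v.2)) q

/-- Push on the output stack whether the first flag is unset. -/
def pushOutput {I Λ : Type} (q : MStmt A I R Λ) : MStmt A I R Λ :=
  .push Stack.output (fun v => !v.2.1) q

section

variable [DecidableEq R] {I Λ : Type} [DecidableEq I] {x : List A} {o : List Bool} {u z : I → List A}
  {st : R → ℕ} {n : ℕ} (q : MStmt A I R Λ) (v : Mem A)

@[simp] theorem stepAux_popInput :
    Turing.TM2.stepAux (popInput q) v (contents x o u z st n) =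
      Turing.TM2.stepAux q (x.head?, v.2) (contents x.tail o u z st n) := by
  have : Function.update (contents x o u z st n) Stack.input x.tail =
      contents x.tail o u z st n := by
    refine Function.update_eq_iff.2 ⟨rfl, fun k hk => ?_⟩
    cases k <;> simp_all [contents]
  rw [← this]; rfl

@[simp] theorem stepAux_pushOutput :
    Turing.TM2.stepAux (pushOutput q) v (contents x o u z st n) =
      Turing.TM2.stepAux q v (contents x ((!v.2.1) :: o) u z st n) := by
  have : Function.update (contents x o u z st n) Stack.output ((!v.2.1) :: o) =
      contents x ((!v.2.1) :: o) u z st n := by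
    refine Function.update_eq_iff.2 ⟨rfl, fun k hk => ?_⟩
    cases k <;> simp_all [contents]
  rw [← this]; rfl

end

theorem update_const_fin_three (y y' : List A) :
    Function.update (Function.update (Function.update (fun _ : Fin 3 => y) 0 y') 1 y') 2 y' =
      fun _ => y' := by
  funext i
  fin_cases i <;> simp

variable [Inhabited A]

/-- The code of the machine that copies the input to three tapes, runs the program, outputs whether
the counter `res` is zero, and clears its stacks. -/
def machineCode (p : CounterProg A (Fin 3) R) (res : R) (rs : List R) :
    Phase ⊕ Label p ⊕ Label (clearAll rs : CounterProg A (Fin 3) R) →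
      MStmt A (Fin 3) R (Phase ⊕ Label p ⊕ Label (clearAll rs : CounterProg A (Fin 3) R))
  | .inl .load => popInput (ifSome (pushRead 0 (pushRead 1 (pushRead 2 (jump (.inl .load)))))
      (jump (.inl .rewind)))
  | .inl .rewind => popRead 0 (popRead 1 (popRead 2 (ifSome
      (pushUnread 0 (pushUnread 1 (pushUnread 2 (jump (.inl .rewind)))))
      (jump (.inr (.inl (entry p)))))))
  | .inl .output => popReg res (pushOutput (jump (.inr (.inr (entry (clearAll rs))))))
  | .inl .drain => popUnread 0 (popUnread 1 (popUnread 2 (ifSome (jump (.inl .drain))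
      (.load (fun _ => (none, false, false)) .halt))))
  | .inr (.inl l) => code p (fun l => .inr (.inl l)) (.inl .output) l
  | .inr (.inr l) => code (clearAll rs) (fun l => .inr (.inr l)) (.inl .drain) l

variable [Fintype A] [DecidableEq R]

/-- Loading reverses the input onto the three read stacks, and rewinding restores its order on the
unread stacks, so that the program starts with three intact copies. -/
theorem steps_machineCode {p : CounterProg A (Fin 3) R} (hp : WF p) (res : R) {rs : List R}
    (hrs : ∀ r, r ∈ rs) (w : List A) :
    Steps (machineCode p res rs) (.inl .load)
      (contents w [] (fun _ => []) (fun _ => []) 0 0) (.inl .drain)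
      (contents [] [decide (eval w p 0 res = 0)] (fun _ => w) (fun _ => []) 0 0)
      (w.length + 1 + (w.length + 1) + (time p).eval w.length + 1 +
        (time (clearAll rs : CounterProg A (Fin 3) R)).eval
          (w.length + (growth p).eval w.length)) := by
  have h1 : ∀ x y : List A, Steps (machineCode p res rs) (.inl .load)
      (contents x [] (fun _ => []) (fun _ => y) 0 0) (.inl .rewind)
      (contents [] [] (fun _ => []) (fun _ => x.reverse ++ y) 0 0) (x.length + 1) := by
    intro x
    induction x with
    | nil => exact fun y => Steps.single fun v => ⟨(none, v.2), by simp [machineCode]⟩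
    | cons a x ih =>
      intro y
      refine Steps.head (l' := .inl .load) (S' := contents x [] (fun _ => []) (fun _ => a :: y) 0 0)
        (fun v => ⟨(some a, v.2), ?_⟩) ?_ le_rfl
      · simp [machineCode, update_const_fin_three]
      · simpa using ih (a :: y)
  have h2 : ∀ x y : List A, Steps (machineCode p res rs) (.inl .rewind)
      (contents [] [] (fun _ => y) (fun _ => x) 0 0) (.inr (.inl (entry p)))
      (contents [] [] (fun _ => x.reverse ++ y) (fun _ => []) 0 0) (x.length + 1) := by
    intro x
    induction x with
    | nil => exact fun y => Steps.single fun v => ⟨(none, v.2), by simp [machineCode]⟩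
    | cons a x ih =>
      intro y
      refine Steps.head (l' := .inl .rewind) (S' := contents [] [] (fun _ => a :: y) (fun _ => x) 0 0)
        (fun v => ⟨(some a, v.2), ?_⟩) ?_ le_rfl
      · simp [machineCode, update_const_fin_three]
      · simpa using ih (a :: y)
  have h3 := steps_code (M := machineCode p res rs) (x := []) (o := []) p hp
    (fun l => .inr (.inl l)) (.inl .output) (fun l => rfl) w w.length (fun _ => w) (fun _ => [])
    (fun _ _ => ⟨rfl, rfl⟩) 0 (fun _ => Nat.zero_le _) le_rfl
  have h4 : Steps (machineCode p res rs) (.inl .output)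
      (contents [] [] (fun _ => w) (fun _ => []) (eval w p 0) 0)
      (.inr (.inr (entry (clearAll rs))))
      (contents [] [decide (eval w p 0 res = 0)] (fun _ => w) (fun _ => [])
        (Function.update (eval w p 0) res (eval w p 0 res - 1)) 0) 1 := by
    refine Steps.single fun v => ⟨(v.1, decide (0 < eval w p 0 res), v.2.2), ?_⟩
    simp only [machineCode, stepAux_popReg, stepAux_pushOutput, stepAux_jump]
    congr 3
    by_cases h : eval w p 0 res = 0 <;> simp [h, Nat.pos_iff_ne_zero]
  have hle : ∀ r, Function.update (eval w p 0) res (eval w p 0 res - 1) r ≤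
      w.length + (growth p).eval w.length := by
    intro r
    have := eval_le w p 0 w.length (fun _ => Nat.zero_le _)
    have h1 := this r
    have h2 := this res
    rw [Function.update_apply]
    split_ifs <;> omega
  have h5 := steps_code (M := machineCode p res rs) (x := []) (o := [decide (eval w p 0 res = 0)])
    (clearAll rs : CounterProg A (Fin 3) R) (wf_clearAll rs)
    (fun l => .inr (.inr l)) (.inl .drain) (fun l => rfl) w (w.length + (growth p).eval w.length)
    (fun _ => w) (fun _ => []) (fun _ _ => ⟨rfl, rfl⟩) _ hle (Nat.le_add_right _ _)
  have h0 : eval w (clearAll rs : CounterProg A (Fin 3) R)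
      (Function.update (eval w p 0) res (eval w p 0 res - 1)) = 0 := by
    funext r
    simp [eval_clearAll, hrs]
  rw [h0] at h5
  have h1 := h1 w []
  have h2 := h2 (w.reverse ++ []) []
  simp only [List.append_nil, List.reverse_reverse, List.length_reverse] at h1 h2
  exact (((h1.trans h2 le_rfl).trans h3 le_rfl).trans h4 le_rfl).trans h5 le_rfl

/-- The machine that runs a program. -/
noncomputable def machine [Fintype R] (p : CounterProg A (Fin 3) R) (res : R) : Turing.FinTM2 :=
  { K := Stack (Fin 3) R
    k₀ := Stack.input
    k₁ := Stack.output
    Γ := Stack.Sym A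
    Λ := Phase ⊕ Label p ⊕ Label (clearAll Finset.univ.toList : CounterProg A (Fin 3) R)
    main := .inl .load
    ΛFin := Fintype.ofFinite _
    σ := Mem A
    initialState := (none, false, false)
    Γk₀Fin := inferInstanceAs (Fintype A)
    m := machineCode p res Finset.univ.toList }

theorem computableInPolyTime [Fintype R] {α : Type} (enc : α → List A)
    {p : CounterProg A (Fin 3) R} (hp : WF p) (res : R) :
    Nonempty (Turing.TM2ComputableInPolyTime enc Computability.encodeBool
      fun a => decide (eval (enc a) p 0 res = 0)) := by
  let T : Polynomial ℕ := (.X + 1) + (.X + 1) + time p + 1 +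
    (time (clearAll Finset.univ.toList : CounterProg A (Fin 3) R)).comp (.X + growth p) + (.X + 1)
  refine ⟨{ tm := machine p res, inputAlphabet := Equiv.refl A, outputAlphabet := Equiv.refl Bool,
            time := T, outputsFun := fun a => Classical.choice ?_ }⟩
  have h1 := steps_machineCode hp res (rs := Finset.univ.toList) (by simp) (enc a)
  -- A halting configuration must have empty stacks except for the output, and the initial local
  -- memory. The final phase therefore empties the three tapes and resets the memory.
  have h2 : ∀ (x : List A) (o : List Bool) (v : Mem A), ∃ n ≤ x.length + 1,
      (fun c => c.bind (Turing.TM2.step (machineCode p res Finset.univ.toList)))^[n]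
        (some ⟨some (.inl .drain), v, contents [] o (fun _ => x) (fun _ => []) 0 0⟩) =
      some ⟨none, (none, false, false), contents [] o (fun _ => []) (fun _ => []) 0 0⟩ := by
    intro x o
    induction x with
    | nil =>
      refine fun v => ⟨1, by simp, ?_⟩
      simp [machineCode]
    | cons b x ih =>
      intro v
      obtain ⟨n, hn, h⟩ := ih (some b, v.2)
      refine ⟨n + 1, by simpa using hn, ?_⟩
      rw [Function.iterate_succ_apply, ← h]
      simp [machineCode, update_const_fin_three]
  obtain ⟨v, n, hn, h1⟩ := h1 (none, false, false)
  obtain ⟨n', hn', h2⟩ := h2 (enc a) [decide (eval (enc a) p 0 res = 0)] v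
  refine ⟨⟨⟨n' + n, ?_⟩, ?_⟩⟩
  · have hinit : Turing.initList (machine p res) (List.map (Equiv.refl A).invFun (enc a)) =
        (⟨some (.inl .load), (none, false, false),
          contents (enc a) [] (fun _ => []) (fun _ => []) 0 0⟩ : (machine p res).Cfg) := by
      refine congrArg (Turing.TM2.Cfg.mk _ _) (funext fun k => ?_)
      cases k <;> simp [contents, machine]
      rfl
    have hhalt : Turing.haltList (machine p res) (List.map (Equiv.refl Bool).invFun
          (Computability.encodeBool (decide (eval (enc a) p 0 res = 0)))) =
        (⟨none, (none, false, false), contents [] [decide (eval (enc a) p 0 res = 0)]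
          (fun _ => []) (fun _ => []) 0 0⟩ : (machine p res).Cfg) := by
      refine congrArg (Turing.TM2.Cfg.mk _ _) (funext fun k => ?_)
      cases k <;> simp [contents, machine, Computability.encodeBool]
      rfl
    rw [hinit]
    refine Eq.trans ?_ (congrArg some hhalt).symm
    have h3 := (Function.iterate_add_apply _ n' n _).trans ((congrArg _ h1).trans h2)
    exact h3
  · refine (Nat.add_le_add hn' hn).trans ?_
    simp only [T, Polynomial.eval_add, Polynomial.eval_X, Polynomial.eval_one, Polynomial.eval_comp]
    omega

end CounterProg

/-! ### Unchanged counters, and derived program constructs -/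

namespace CounterProg

variable {A I R : Type}

/-- The program changes the counter `r` somewhere. -/
def Writes (r : R) : CounterProg A I R → Prop
  | skip => False
  | inc s | clear s => r = s
  | halve s e => r = s ∨ r = e
  | cmp _ _ body => ∃ o, Writes r (body o)
  | seq p q => Writes r p ∨ Writes r q
  | forIn _ body => ∃ a, Writes r (body a)

/-- The frame rule: later specifications mention only the counters that a subprogram computes, and
this lemma transports all others. -/
theorem eval_of_not_writes [DecidableEq R] (w : List A) {r : R} :
    ∀ (p : CounterProg A I R) (st : R → ℕ), ¬ Writes r p → eval w p st r = st r
  | skip, _, _ => rfl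
  | inc s, _, h => Function.update_of_ne h _ _
  | clear s, _, h => Function.update_of_ne h _ _
  | halve s e, _, h => by
    rw [Writes, not_or] at h
    rw [eval, Function.update_of_ne h.1, Function.update_of_ne h.2]
  | cmp s s' body, st, h => eval_of_not_writes w (body (compare (st s) (st s'))) st fun h' => h ⟨_, h'⟩
  | seq p q, st, h => by
    rw [Writes, not_or] at h
    rw [eval, eval_of_not_writes w q _ h.2, eval_of_not_writes w p _ h.1]
  | forIn i body, st, h => by
    have : ∀ (l : List A) (st : R → ℕ), l.foldl (fun st a => eval w (body a) st) st r = st r := by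
      intro l
      induction l with
      | nil => exact fun _ => rfl
      | cons a l ih =>
        exact fun st => (ih _).trans (eval_of_not_writes w (body a) st fun h' => h ⟨_, h'⟩)
    exact this w st

/-- Run `p` if two counters are equal, and `q` otherwise. -/
def ifElse (r s : R) (p q : CounterProg A I R) : CounterProg A I R :=
  cmp r s fun | .eq => p | _ => q

/-- Run the programs in a list one after the other. -/
def seqs : List (CounterProg A I R) → CounterProg A I R
  | [] => skip
  | p :: ps => seq p (seqs ps)

theorem eval_ifElse [DecidableEq R] (w : List A) (r s : R) (p q : CounterProg A I R) (st : R → ℕ) :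
    eval w (ifElse r s p q) st = if st r = st s then eval w p st else eval w q st := by
  simp only [ifElse, eval]
  split_ifs with h
  · rw [compare_eq_iff_eq.2 h]
  · have := mt compare_eq_iff_eq.1 h
    cases hc : compare (st r) (st s) <;> simp_all

theorem _root_.Ordering.exists_iff {P : Ordering → Prop} :
    (∃ o, P o) ↔ P .lt ∨ P .eq ∨ P .gt := by
  constructor
  · rintro ⟨o, h⟩
    cases o
    exacts [.inl h, .inr (.inl h), .inr (.inr h)]
  · rintro (h | h | h)
    exacts [⟨_, h⟩, ⟨_, h⟩, ⟨_, h⟩]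

theorem _root_.Ordering.forall_iff {P : Ordering → Prop} :
    (∀ o, P o) ↔ P .lt ∧ P .eq ∧ P .gt :=
  ⟨fun h => ⟨h _, h _, h _⟩, fun h o => by cases o; exacts [h.1, h.2.1, h.2.2]⟩

theorem writes_ifElse {r s t : R} {p q : CounterProg A I R} :
    Writes t (ifElse r s p q) ↔ Writes t p ∨ Writes t q := by
  simp only [ifElse, Writes, Ordering.exists_iff]
  tauto

theorem loops_ifElse {r s : R} {i : I} {p q : CounterProg A I R} :
    Loops i (ifElse r s p q) ↔ Loops i p ∨ Loops i q := by
  simp only [ifElse, Loops, Ordering.exists_iff]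
  tauto

theorem wf_ifElse {r s : R} {p q : CounterProg A I R} :
    WF (ifElse r s p q) ↔ r ≠ s ∧ WF p ∧ WF q := by
  simp only [ifElse, WF, Ordering.forall_iff]
  tauto

end CounterProg

/-! ### Game descriptions as words, and loops over their edges -/

/-- The name of the vertex with index `k`. -/
def indexName (k : ℕ) : List GameSymbol := List.replicate k .tick ++ [.sep]

/-- The part of the description of a game that belongs to a vertex with given owner and
adjacency list. -/
def renderBlock (b : Owner × List ℕ) : List GameSymbol := .owner b.1 :: b.2.flatMap indexName

/-- The description of a game from its source, its target, and the owners and adjacency lists of its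
vertices. -/
def render (s t : ℕ) (bs : List (Owner × List ℕ)) : List GameSymbol :=
  indexName s ++ indexName t ++ bs.flatMap renderBlock

/-- The edges in the order of a description, if the first vertex has index `v`. -/
def edgeList (v : ℕ) : List (Owner × List ℕ) → List (ℕ × ℕ)
  | [] => []
  | b :: bs => b.2.map (v, ·) ++ edgeList (v + 1) bs

/-- The input alphabet of the verifier. -/
abbrev InputSymbol := GameSymbol ⊕ Bool

instance : Inhabited InputSymbol := ⟨.inr false⟩

namespace CounterProg

variable {I R : Type}

/-- A loop over the letters of the instance. -/
def forInstance (i : I) (body : GameSymbol → CounterProg InputSymbol I R) :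
    CounterProg InputSymbol I R :=
  forIn i fun | .inl g => body g | .inr _ => skip

/-- A loop over the bits of the certificate. -/
def forCertificate (i : I) (body : Bool → CounterProg InputSymbol I R) :
    CounterProg InputSymbol I R :=
  forIn i fun | .inl _ => skip | .inr β => body β

/-- The loop body of `forEdges`. -/
def edgeStep (zero b c : R) (p : CounterProg InputSymbol I R) :
    GameSymbol → CounterProg InputSymbol I R
  | .owner _ => inc b
  | .tick => inc c
  | .sep => seq (ifElse b zero skip p) (clear c)

/-- A loop over the edges of the game: the program `p` finds in `b` the index of the initial vertex
plus one, and in `c` the index of the terminal vertex. -/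
def forEdges (zero : R) (i : I) (b c : R) (p : CounterProg InputSymbol I R) :
    CounterProg InputSymbol I R :=
  seq (clear b) (seq (clear c) (forInstance i (edgeStep zero b c p)))

theorem writes_forInstance {i : I} {r : R} {p : GameSymbol → CounterProg InputSymbol I R} :
    Writes r (forInstance i p) ↔ ∃ g, Writes r (p g) := by
  simp [forInstance, Writes]

theorem writes_forCertificate {i : I} {r : R} {p : Bool → CounterProg InputSymbol I R} :
    Writes r (forCertificate i p) ↔ ∃ g, Writes r (p g) := by
  simp [forCertificate, Writes]

theorem loops_forInstance {i j : I} {p : GameSymbol → CounterProg InputSymbol I R} :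
    Loops j (forInstance i p) ↔ j = i ∨ ∃ g, Loops j (p g) := by
  simp [forInstance, Loops]

theorem loops_forCertificate {i j : I} {p : Bool → CounterProg InputSymbol I R} :
    Loops j (forCertificate i p) ↔ j = i ∨ ∃ g, Loops j (p g) := by
  simp [forCertificate, Loops]

theorem wf_forInstance {i : I} {p : GameSymbol → CounterProg InputSymbol I R} :
    WF (forInstance i p) ↔ ∀ g, WF (p g) ∧ ¬ Loops i (p g) := by
  simp [forInstance, WF, Loops]

theorem wf_forCertificate {i : I} {p : Bool → CounterProg InputSymbol I R} :
    WF (forCertificate i p) ↔ ∀ g, WF (p g) ∧ ¬ Loops i (p g) := by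
  simp [forCertificate, WF, Loops]

theorem _root_.GameSymbol.exists_iff {P : GameSymbol → Prop} :
    (∃ g, P g) ↔ (∃ o, P (.owner o)) ∨ P .tick ∨ P .sep := by
  constructor
  · rintro ⟨g, h⟩
    cases g
    exacts [.inl ⟨_, h⟩, .inr (.inl h), .inr (.inr h)]
  · rintro (⟨o, h⟩ | h | h)
    exacts [⟨_, h⟩, ⟨_, h⟩, ⟨_, h⟩]

theorem _root_.GameSymbol.forall_iff {P : GameSymbol → Prop} :
    (∀ g, P g) ↔ (∀ o, P (.owner o)) ∧ P .tick ∧ P .sep :=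
  ⟨fun h => ⟨fun _ => h _, h _, h _⟩, fun h g => by cases g; exacts [h.1 _, h.2.1, h.2.2]⟩

theorem writes_forEdges {zero b c r : R} {i : I} {p : CounterProg InputSymbol I R} :
    Writes r (forEdges zero i b c p) ↔ r = b ∨ r = c ∨ Writes r p := by
  simp [forEdges, Writes, GameSymbol.exists_iff, edgeStep, writes_forInstance, writes_ifElse]
  tauto

theorem loops_forEdges {zero b c : R} {i j : I} {p : CounterProg InputSymbol I R} :
    Loops j (forEdges zero i b c p) ↔ j = i ∨ Loops j p := by
  simp [forEdges, Loops, GameSymbol.exists_iff, edgeStep, loops_forInstance, loops_ifElse]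

theorem wf_forEdges {zero b c : R} {i : I} {p : CounterProg InputSymbol I R} :
    WF (forEdges zero i b c p) ↔ b ≠ zero ∧ WF p ∧ ¬ Loops i p := by
  simp [forEdges, WF, Loops, GameSymbol.forall_iff, edgeStep, wf_forInstance, wf_ifElse, loops_ifElse]
  tauto

variable [DecidableEq R] (x : List GameSymbol) (y : List Bool)

theorem eval_forInstance (i : I) (p : GameSymbol → CounterProg InputSymbol I R) (st : R → ℕ) :
    eval (encodeInstanceCertificate (x, y)) (forInstance i p) st =
      x.foldl (fun st g => eval (encodeInstanceCertificate (x, y)) (p g) st) st := by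
  have key : ∀ w, (x.map Sum.inl ++ y.map Sum.inr : List InputSymbol).foldl
      (fun st a => eval w ((fun | .inl g => p g | .inr _ => skip : InputSymbol → _) a) st) st =
      x.foldl (fun st g => eval w (p g) st) st := by
    intro w
    rw [List.foldl_append, List.foldl_map, List.foldl_map]
    generalize x.foldl _ st = st'
    induction y <;> simp_all [eval]
  exact key _

theorem eval_forCertificate (i : I) (p : Bool → CounterProg InputSymbol I R) (st : R → ℕ) :
    eval (encodeInstanceCertificate (x, y)) (forCertificate i p) st =
      y.foldl (fun st β => eval (encodeInstanceCertificate (x, y)) (p β) st) st := by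
  have key : ∀ w, (x.map Sum.inl ++ y.map Sum.inr : List InputSymbol).foldl
      (fun st a => eval w ((fun | .inl _ => skip | .inr β => p β : InputSymbol → _) a) st) st =
      y.foldl (fun st β => eval w (p β) st) st := by
    intro w
    rw [List.foldl_append, List.foldl_map, List.foldl_map]
    congr 1
    induction x <;> simp_all [eval]
  exact key _

/-- The effect of `p` in `forEdges` at an edge. -/
def atEdge (w : List InputSymbol) (b c : R) (p : CounterProg InputSymbol I R) (st : R → ℕ)
    (e : ℕ × ℕ) : R → ℕ :=
  eval w p (Function.update (Function.update st b (e.1 + 1)) c e.2)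

/-- Here `b` counts owner letters and `c` the ticks of the current name. The names of source and
target precede all owner letters, so `b` is still zero there and `p` is skipped; this is why `b` is
the vertex index plus one. The program `p` may spoil `c`, since `c` is cleared after each name. -/
theorem eval_forEdges {zero b c : R} (hb : b ≠ zero) (hc : c ≠ zero) (hbc : b ≠ c) (i : I)
    {p : CounterProg InputSymbol I R} (hpb : ¬ Writes b p) (hpz : ¬ Writes zero p)
    {s t : ℕ} {bs : List (Owner × List ℕ)} (st : R → ℕ) (h0 : st zero = 0) :
    eval (encodeInstanceCertificate (render s t bs, y)) (forEdges zero i b c p) st =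
      Function.update (Function.update ((edgeList 0 bs).foldl
        (atEdge (encodeInstanceCertificate (render s t bs, y)) b c p) st) b bs.length) c 0 := by
  simp only [forEdges, eval, eval_forInstance]
  generalize encodeInstanceCertificate (render s t bs, y) = w
  set F := fun st g => eval w (edgeStep zero b c p g) st with hF
  have hticks : ∀ (k : ℕ) (st : R → ℕ),
      (List.replicate k GameSymbol.tick).foldl F st = Function.update st c (st c + k) := by
    intro k
    induction k with
    | zero => simp
    | succ k ih =>
      intro st
      rw [List.replicate_succ, List.foldl_cons, ih]
      funext r
      simp only [hF, edgeStep, eval, Function.update_apply]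
      split_ifs <;> omega
  have hname0 : ∀ (k : ℕ) (st : R → ℕ), st zero = 0 →
      (indexName k).foldl F (Function.update (Function.update st b 0) c 0) =
        Function.update (Function.update st b 0) c 0 := by
    intro k st h0
    rw [indexName, List.foldl_append, hticks]
    simp [hF, edgeStep, eval, eval_ifElse, hbc, hb.symm, hc.symm, h0]
  have hnames : ∀ (l : List ℕ) (v : ℕ) (st : R → ℕ), st zero = 0 →
      (l.flatMap indexName).foldl F (Function.update (Function.update st b (v + 1)) c 0) =
        Function.update (Function.update ((l.map (v, ·)).foldl (atEdge w b c p) st) b (v + 1))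
          c 0 := by
    intro l v
    induction l with
    | nil => simp
    | cons k l ih =>
      intro st h0
      have h1 : (indexName k).foldl F (Function.update (Function.update st b (v + 1)) c 0) =
          Function.update (Function.update (atEdge w b c p st (v, k)) b (v + 1)) c 0 := by
        rw [indexName, List.foldl_append, hticks]
        simp only [hF, edgeStep, eval, eval_ifElse, List.foldl_cons, List.foldl_nil,
          Function.update_self, Function.update_idem, zero_add]
        -- Inside a block `b` has the nonzero value `v + 1`, so `p` is run.
        rw [if_neg (by simp [hbc, hb.symm, hc.symm, h0])]
        congr 1
        refine (Function.update_eq_self_iff.2 ?_).symm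
        refine ((eval_of_not_writes w p _ hpb).trans ?_).symm
        simp [hbc]
      rw [List.flatMap_cons, List.foldl_append, h1, ih]
      · rfl
      · refine (eval_of_not_writes w p _ hpz).trans ?_
        simp [hb.symm, hc.symm, h0]
  have hfold : ∀ (l : List (ℕ × ℕ)) (st : R → ℕ), l.foldl (atEdge w b c p) st zero = st zero := by
    intro l
    induction l with
    | nil => exact fun _ => rfl
    | cons e l ih =>
      intro st
      rw [List.foldl_cons, ih]
      refine (eval_of_not_writes w p _ hpz).trans ?_
      simp [hb.symm, hc.symm]
  have hblocks : ∀ (bs : List (Owner × List ℕ)) (v : ℕ) (st : R → ℕ), st zero = 0 →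
      (bs.flatMap renderBlock).foldl F (Function.update (Function.update st b v) c 0) =
        Function.update (Function.update ((edgeList v bs).foldl (atEdge w b c p) st)
          b (v + bs.length)) c 0 := by
    intro bs
    induction bs with
    | nil => simp [edgeList]
    | cons d bs ih =>
      intro v st h0
      have h1 : F (Function.update (Function.update st b v) c 0) (.owner d.1) =
          Function.update (Function.update st b (v + 1)) c 0 := by
        funext r
        simp only [hF, edgeStep, eval, Function.update_apply]
        split_ifs <;> simp_all
      rw [List.flatMap_cons, List.foldl_append, renderBlock, List.foldl_cons, h1, hnames _ _ _ h0,
        ih _ _ (by rw [hfold, h0]), edgeList, List.foldl_append, List.length_cons]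
      congr 2
      omega
  rw [render, List.foldl_append, List.foldl_append, hname0 _ _ h0, hname0 _ _ h0, hblocks _ _ _ h0,
    zero_add]

end CounterProg

/-! ### The verifier -/

/-- The counters of the verifier. -/
inductive Reg where
  | zero | one | two | n | m | hdr | s | t | bad | c | b | c1 | b1 | cnt | v0 | v1
  | dp | dm | ep | em | q | k | pv | slice | ho | hi
deriving DecidableEq

namespace Reg

instance : Fintype Reg where
  elems := {zero, one, two, n, m, hdr, s, t, bad, c, b, c1, b1, cnt, v0, v1,
    dp, dm, ep, em, q, k, pv, slice, ho, hi}
  complete := by intro r; cases r <;> decide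

end Reg

namespace CounterProg

open Reg

/-- Programs of the verifier. -/
abbrev VProg := CounterProg InputSymbol (Fin 3) Reg

/-- Reject the input. -/
def reject : VProg := inc bad

/-- Reject the input unless one counter is smaller than another one. -/
def requireLt (r r' : Reg) : VProg := cmp r r' fun | .lt => skip | _ => reject

/-- Reject games with two players. -/
def rejectSafety : Owner → VProg
  | .safety => reject
  | _ => skip

/-- One letter of the instance, in the check that it describes a one-player game. -/
def formatStep : GameSymbol → VProg
  | .owner o => seqs [rejectSafety o, ifElse c zero skip reject, ifElse hdr two skip reject, inc n]
  | .tick => seqs [inc c, ifElse n zero (ifElse hdr zero (inc s) (inc t)) skip]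
  | .sep => seqs [clear c, ifElse n zero (inc hdr) (inc m)]

/-- Check the format of the instance, and compute its source, its target, and the numbers of
vertices and edges. -/
def checkFormat : VProg :=
  seqs [inc one, inc two, inc two, forInstance 0 formatStep, ifElse c zero skip reject,
    ifElse n zero reject skip]

/-- Check that all names belong to vertices. -/
def checkNames : VProg :=
  seqs [requireLt s n, requireLt t n, forEdges zero 0 b c (requireLt c n)]

/-- One edge in the search for the edge in the counters `b` and `c`. -/
def countStep : VProg := ifElse b b1 (ifElse c c1 (inc cnt) skip) skip

/-- Count how often the edge in the counters `b` and `c` occurs. -/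
def countEdge : VProg :=
  seqs [clear cnt, forEdges zero 1 b1 c1 countStep]

/-- Check that no edge occurs twice. -/
def checkNodup : VProg :=
  forEdges zero 0 b c (seqs [countEdge, ifElse cnt one skip reject])

/-- One edge in the search for edge number `q`. -/
def locateStep : VProg :=
  seqs [ifElse k q (seqs [ifElse b1 v1 (inc ho) skip, ifElse c1 v0 (inc hi) skip]) skip, inc k]

/-- Find out whether edge number `q` starts (flag `ho`) or ends (flag `hi`) at the vertex `v0`. -/
def locate : VProg :=
  seqs [clear k, clear ho, clear hi, forEdges zero 2 b1 c1 locateStep]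

/-- Add a bit to the balance of the vertex `v0`. -/
def addBit : Bool → VProg
  | true => seqs [ifElse ho one (inc dp) skip, ifElse hi one (inc dm) skip]
  | false => skip

/-- Check the switching condition at the vertex `v0`: in the first slice the bits of the outgoing
edges decrease, in all other slices they are constant. -/
def checkBit : Owner → Bool → VProg
  | .switching, true => ifElse ho one
      (seqs [ifElse pv one reject skip, clear pv, inc pv, inc pv]) skip
  | .switching, false => ifElse ho one
      (seqs [ifElse slice zero skip (ifElse pv two reject skip), clear pv, inc pv]) skip
  | _, _ => skip

/-- The end of a slice of the certificate. -/
def endSlice : VProg :=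
  seqs [clear q, clear pv, ifElse slice zero (inc slice)
    (seqs [halve dp ep, halve dm em, ifElse ep em skip reject])]

/-- One bit of the certificate. -/
def bitStep (o : Owner) (β : Bool) : VProg :=
  seqs [locate, addBit β, checkBit o β, inc q, ifElse q m endSlice skip]

/-- Check the flow at the vertex `v0`. -/
def checkFlowAt (o : Owner) : VProg :=
  seqs [clear dp, clear dm, clear q, clear pv, clear slice, ifElse t v0 (inc dp) skip,
    ifElse s v0 (inc dm) skip, forCertificate 1 (bitStep o), ifElse q zero skip reject,
    ifElse dp dm skip reject]

/-- One letter of the instance, in the check of the flow. -/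
def flowStep : GameSymbol → VProg
  | .owner o => seqs [checkFlowAt o, inc v0, inc v1]
  | _ => skip

/-- The verifier. -/
def verifier : VProg :=
  seqs [checkFormat, ifElse bad zero (seqs [checkNames, checkNodup, ifElse s t skip
    (seqs [inc v1, forInstance 0 flowStep])]) skip]

theorem _root_.Owner.forall_iff {P : Owner → Prop} :
    (∀ o, P o) ↔ P .reachability ∧ P .safety ∧ P .switching :=
  ⟨fun h => ⟨h _, h _, h _⟩, fun h o => by cases o; exacts [h.1, h.2.1, h.2.2]⟩

/-- Three indices suffice, because the deepest nesting is vertices, then certificate bits, then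
edges. -/
theorem wf_verifier : WF verifier := by
  simp [verifier, seqs, WF, checkFormat, checkNames, checkNodup, wf_forInstance, wf_forEdges,
    wf_forCertificate, wf_ifElse, formatStep, rejectSafety, GameSymbol.forall_iff, Owner.forall_iff,
    reject, requireLt, Ordering.forall_iff, countEdge, countStep, flowStep, checkFlowAt, bitStep,
    locate, locateStep, addBit, checkBit, endSlice, Loops, Ordering.exists_iff, loops_forEdges,
    loops_forCertificate, loops_ifElse]

end CounterProg

/-! ### The effect of one certificate bit -/

namespace CounterProg

open Reg

/-- Whether the edge with index `q` starts at `v`. -/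
def hitOut (l : List (ℕ × ℕ)) (v q : ℕ) : ℕ := l[q]?.elim 0 fun e => if e.1 = v then 1 else 0

/-- Whether the edge with index `q` ends at `v`. -/
def hitIn (l : List (ℕ × ℕ)) (v q : ℕ) : ℕ := l[q]?.elim 0 fun e => if e.2 = v then 1 else 0

/-- The counter `k` numbers the edges during the scan, so the flags are touched at most once, at
edge number `j`. The initial vertex is compared with `v1` rather than `v0` because of the offset in
`forEdges`. -/
theorem foldl_locateStep (w : List InputSymbol) (v j : ℕ) (st : Reg → ℕ) (hk : st k = 0)
    (hho : st ho = 0) (hhi : st hi = 0) (hv0 : st v0 = v) (hv1 : st v1 = v + 1) (hq : st q = j) :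
    ∀ l : List (ℕ × ℕ), ∃ st', l.foldl (atEdge w b1 c1 locateStep) st = st' ∧
      st' k = l.length ∧ st' ho = hitOut l v j ∧ st' hi = hitIn l v j ∧ st' v0 = v ∧
      st' v1 = v + 1 ∧ st' q = j := by
  intro l
  refine ⟨_, rfl, ?_⟩
  induction l using List.reverseRecOn with
  | nil => simp [hk, hho, hhi, hv0, hv1, hq, hitOut, hitIn]
  | append_singleton l e ih =>
    rw [List.foldl_append, List.foldl_cons, List.foldl_nil]
    generalize l.foldl (atEdge w b1 c1 locateStep) st = st at ih ⊢
    obtain ⟨h1, h2, h3, h4, h5, h6⟩ := ih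
    -- Edge number `j` was passed before, is the new edge `e`, or has not been reached.
    rcases Nat.lt_trichotomy j l.length with h | h | h
    · simp [atEdge, locateStep, seqs, eval, eval_ifElse, h1, h2, h3, h4, h5, h6, h.ne', hitOut,
        hitIn, List.getElem?_append_left h]
    · have h7 : hitOut l v j = 0 := by simp [hitOut, h]
      have h8 : hitIn l v j = 0 := by simp [hitIn, h]
      rw [h7] at h2
      rw [h8] at h3
      simp only [atEdge, locateStep, seqs, eval, eval_ifElse]
      by_cases h9 : e.1 = v <;> by_cases h10 : e.2 = v <;>
      simp [h1, h2, h3, h4, h5, h6, h, h9, h10, hitOut, hitIn]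
    · have h7 : l[j]? = none := by simp [h.le]
      have h8 : (l ++ [e])[j]? = none := by simp; omega
      simp [atEdge, locateStep, seqs, eval, eval_ifElse, h1, h2, h3, h4, h5, h6, h.ne, hitOut,
        hitIn, h7, h8]

variable (s' t' : ℕ) (bs : List (Owner × List ℕ)) (y : List Bool)

theorem locate_spec {st : Reg → ℕ} {v : ℕ} (h0 : st zero = 0) (hv0 : st v0 = v)
    (hv1 : st v1 = v + 1) :
    ∃ st', eval (encodeInstanceCertificate (render s' t' bs, y)) locate st = st' ∧
      st' ho = hitOut (edgeList 0 bs) v (st q) ∧ st' hi = hitIn (edgeList 0 bs) v (st q) ∧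
      ∀ r ∉ [k, ho, hi, b1, c1], st' r = st r := by
  refine ⟨_, rfl, ?_⟩
  have hframe : ∀ r ∉ [k, ho, hi, b1, c1],
      eval (encodeInstanceCertificate (render s' t' bs, y)) locate st r = st r := by
    intro r hr
    refine eval_of_not_writes _ _ _ ?_
    simp only [List.mem_cons, List.not_mem_nil, or_false, not_or] at hr
    simp [locate, seqs, Writes, writes_forEdges, locateStep, writes_ifElse, hr]
  refine ⟨?_, ?_, hframe⟩ <;>
  · simp only [locate, seqs, eval]
    rw [eval_forEdges _ (by decide) (by decide) (by decide) _
      (by simp [seqs, Writes, locateStep, writes_ifElse])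
      (by simp [seqs, Writes, locateStep, writes_ifElse]) _ (by simp [h0])]
    obtain ⟨st', h, h1, h2, h3, -⟩ := foldl_locateStep
      (encodeInstanceCertificate (render s' t' bs, y)) v (st q)
      (Function.update (Function.update (Function.update st k 0) ho 0) hi 0) (by simp) (by simp)
      (by simp) (by simp [hv0]) (by simp [hv1]) (by simp) (edgeList 0 bs)
    rw [h]
    simp [h2, h3]

/-- The values of the counters that matter in the check of the flow at a vertex. -/
@[ext]
structure Acc where
  dp : ℕ
  dm : ℕ
  q : ℕ
  pv : ℕ
  slice : ℕ
  bad : ℕ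

/-- The values of the counters that matter in the check of the flow at a vertex. -/
def view (st : Reg → ℕ) : Acc :=
  ⟨st dp, st dm, st q, st pv, st slice, st bad⟩

/-- `addBit` and `checkBit` in terms of the relevant counters. -/
def Acc.bit (o : Owner) (out inn : ℕ) (β : Bool) (a : Acc) : Acc :=
  { a with
    dp := a.dp + β.toNat * out
    dm := a.dm + β.toNat * inn
    pv := if o = .switching ∧ out = 1 then β.toNat + 1 else a.pv
    bad := if o = .switching ∧ out = 1 ∧
      (β = true ∧ a.pv = 1 ∨ β = false ∧ a.slice ≠ 0 ∧ a.pv = 2) then a.bad + 1 else a.bad }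

/-- `endSlice` in terms of the relevant counters. -/
def Acc.endSlice (a : Acc) : Acc :=
  if a.slice = 0 then { a with q := 0, pv := 0, slice := 1 }
  else
    { a with
      q := 0
      pv := 0
      dp := a.dp / 2
      dm := a.dm / 2
      bad := if a.dp % 2 = a.dm % 2 then a.bad else a.bad + 1 }

/-- `bitStep` in terms of the relevant counters. -/
def Acc.step (l : List (ℕ × ℕ)) (v : ℕ) (o : Owner) (a : Acc) (β : Bool) : Acc :=
  let a := a.bit o (hitOut l v a.q) (hitIn l v a.q) β
  if a.q + 1 = l.length then endSlice { a with q := a.q + 1 } else { a with q := a.q + 1 }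

theorem hitOut_eq (l : List (ℕ × ℕ)) (v q : ℕ) : hitOut l v q = 0 ∨ hitOut l v q = 1 := by
  unfold hitOut
  cases l[q]? with
  | none => simp
  | some e => simp; tauto

theorem hitIn_eq (l : List (ℕ × ℕ)) (v q : ℕ) : hitIn l v q = 0 ∨ hitIn l v q = 1 := by
  unfold hitIn
  cases l[q]? with
  | none => simp
  | some e => simp; tauto

/-- The values of the counters that are constant while the flow at the vertex `v` is checked. -/
structure FlowConst (s' t' n' m' v : ℕ) (st : Reg → ℕ) : Prop where
  zero : st zero = 0
  one : st one = 1
  two : st two = 2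
  s : st s = s'
  t : st t = t'
  n : st n = n'
  m : st m = m'
  v0 : st v0 = v
  v1 : st v1 = v + 1

theorem FlowConst.of_eq {s' t' n' m' v : ℕ} {st st' : Reg → ℕ} (h : FlowConst s' t' n' m' v st)
    (h' : ∀ r ∈ [Reg.zero, .one, .two, .s, .t, .n, .m, .v0, .v1], st' r = st r) :
    FlowConst s' t' n' m' v st' := by
  constructor <;> rw [h' _ (by decide)]
  exacts [h.zero, h.one, h.two, h.s, h.t, h.n, h.m, h.v0, h.v1]

/-- Only the six counters in `Acc` carry information from one bit to the next; the flags `ho` and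
`hi` are computed afresh by `locate`. This reduces the analysis of the program to a fold over the
certificate. -/
theorem view_bitStep {n' v : ℕ} {st : Reg → ℕ}
    (h : FlowConst s' t' n' (edgeList 0 bs).length v st) (o : Owner) (β : Bool) :
    view (eval (encodeInstanceCertificate (render s' t' bs, y)) (bitStep o β) st) =
      (view st).step (edgeList 0 bs) v o β := by
  have hl := locate_spec s' t' bs y h.zero h.v0 h.v1
  simp only [bitStep, seqs, eval]
  generalize encodeInstanceCertificate (render s' t' bs, y) = w at hl ⊢
  obtain ⟨st', h1, hho, hhi, hfr⟩ := hl
  rw [h1]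
  have h' : FlowConst s' t' n' (edgeList 0 bs).length v st' := h.of_eq fun r hr => hfr r (by
    revert hr; revert r; decide)
  have hv : view st = view st' := by
    simp only [view]
    rw [hfr dp (by decide), hfr dm (by decide), hfr q (by decide), hfr pv (by decide),
      hfr slice (by decide), hfr bad (by decide)]
  rw [hv]
  rw [← hfr q (by decide)] at hho hhi
  clear hv hfr h1 h
  have hbit : ∃ st'', eval w (checkBit o β)
      (eval w (addBit β) st') = st'' ∧ view st'' = (view st').bit o (hitOut (edgeList 0 bs) v (st' q))
        (hitIn (edgeList 0 bs) v (st' q)) β ∧ st'' zero = 0 ∧ st'' m = (edgeList 0 bs).length := by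
    refine ⟨_, rfl, ?_⟩
    -- Both flags are 0 or 1, so finitely many cases of flags, bit and owner remain.
    rcases hitOut_eq (edgeList 0 bs) v (st' q) with h1 | h1 <;>
    rcases hitIn_eq (edgeList 0 bs) v (st' q) with h2 | h2 <;>
    rw [h1] at hho ⊢ <;> rw [h2] at hhi ⊢ <;> cases β <;> cases o <;>
    simp [addBit, checkBit, eval, seqs, eval_ifElse, hho, hhi, h'.one, h'.two, h'.zero, h'.m,
      reject, view, Acc.bit] <;>
    split_ifs <;> simp_all [h'.zero, h'.m]
  obtain ⟨st'', h1, h2, h3, h4⟩ := hbit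
  rw [h1]
  have hq : st'' q = st' q := congrArg Acc.q h2
  rw [Acc.step]
  simp only [show (view st').q = st' q from rfl]
  rw [← h2]
  clear h2
  simp only [eval_ifElse, endSlice, seqs, eval, reject, Acc.endSlice, view, hq]
  simp [h3, h4]
  split_ifs <;> simp_all

end CounterProg

/-! ### Slices of the certificate -/

namespace CounterProg

/-- The number of edges selected by `g` that start at `v`. -/
def outCount (v : ℕ) (g : ℕ × ℕ → Bool) (l : List (ℕ × ℕ)) : ℕ :=
  (l.map fun e => (g e).toNat * if e.1 = v then 1 else 0).sum

/-- The number of edges selected by `g` that end at `v`. -/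
def inCount (v : ℕ) (g : ℕ × ℕ → Bool) (l : List (ℕ × ℕ)) : ℕ :=
  (l.map fun e => (g e).toNat * if e.2 = v then 1 else 0).sum

/-- The bits of a slice pass `checkBit`. -/
def BitsOK (slice : ℕ) : ℕ → List Bool → Prop
  | _, [] => True
  | pv, β :: βs => ¬ (β = true ∧ pv = 1 ∨ β = false ∧ slice ≠ 0 ∧ pv = 2) ∧
      BitsOK slice (β.toNat + 1) βs

/-- The bits at the outgoing edges of `v`. -/
def outBits (v : ℕ) (g : ℕ × ℕ → Bool) (l : List (ℕ × ℕ)) : List Bool :=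
  (l.filter fun e => e.1 = v).map g

/-- The list `L` is the part of the slice still to be read; being nonempty, it triggers
`Acc.endSlice` exactly at its last bit. The value `pv'` is left open because the end of the slice
clears it, and of `bad'` only its vanishing matters. -/
theorem foldl_step_slice (v : ℕ) (o : Owner) (g : ℕ × ℕ → Bool) (l : List (ℕ × ℕ)) :
    ∀ (L pre : List (ℕ × ℕ)) (_ : l = pre ++ L) (_ : L ≠ []) (a : Acc) (_ : a.q = pre.length),
      ∃ pv' bad', (bad' = 0 ↔ a.bad = 0 ∧
          (o = .switching → BitsOK a.slice a.pv (outBits v g L))) ∧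
        (L.map g).foldl (Acc.step l v o) a = Acc.endSlice
          ⟨a.dp + outCount v g L, a.dm + inCount v g L, l.length, pv', a.slice, bad'⟩ := by
  intro L
  induction L with
  | nil => exact fun _ _ h => absurd rfl h
  | cons e L ih =>
    intro pre hl _ a hq
    have he : l[a.q]? = some e := by simp [hl, hq]
    have hout : hitOut l v a.q = if e.1 = v then 1 else 0 := by simp [hitOut, he]
    have hin : hitIn l v a.q = if e.2 = v then 1 else 0 := by simp [hitIn, he]
    set a' : Acc := a.bit o (hitOut l v a.q) (hitIn l v a.q) (g e) with ha'
    have hbits : (a'.bad = 0 ∧ (o = .switching → BitsOK a.slice a'.pv (outBits v g L))) ↔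
        a.bad = 0 ∧ (o = .switching → BitsOK a.slice a.pv (outBits v g (e :: L))) := by
      by_cases ho : o = .switching
      · by_cases hev : e.1 = v
        · simp only [ha', Acc.bit, hout, ho, hev, outBits, List.filter_cons, decide_true, if_true,
            List.map_cons, BitsOK, true_and, forall_const]
          split_ifs with h3 <;> simp [h3]
        · simp [ha', Acc.bit, hout, ho, hev, outBits]
      · simp [ha', Acc.bit, ho]
    have hdp : a'.dp = a.dp + (g e).toNat * if e.1 = v then 1 else 0 := by simp [ha', Acc.bit, hout]
    have hdm : a'.dm = a.dm + (g e).toNat * if e.2 = v then 1 else 0 := by simp [ha', Acc.bit, hin]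
    have hs : a'.slice = a.slice := rfl
    have hq' : a'.q = a.q := rfl
    rcases L.eq_nil_or_concat with rfl | ⟨L', e', hL'⟩
    · refine ⟨a'.pv, a'.bad, ?_, ?_⟩
      · rw [← hbits]; simp [outBits, BitsOK]
      · have hlen : a.q + 1 = l.length := by simp [hl, hq]
        simp only [List.map_cons, List.map_nil, List.foldl_cons, List.foldl_nil, Acc.step, ← ha']
        rw [if_pos (by rw [hq', hlen])]
        congr 1
        ext <;> simp [hdp, hdm, hs, hq', hlen, outCount, inCount]
    · have hne : L ≠ [] := by simp [hL']
      have hlen : a.q + 1 ≠ l.length := by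
        have := List.length_pos_of_ne_nil hne
        simp only [hl, hq, List.length_append, List.length_cons]
        omega
      have hstep : Acc.step l v o a (g e) = { a' with q := a.q + 1 } := by
        simp only [Acc.step, ← ha']
        rw [if_neg (by rw [hq']; exact hlen), hq']
      obtain ⟨pv', bad', h1, h2⟩ := ih (pre ++ [e]) (by simp [hl]) hne { a' with q := a.q + 1 }
        (by simp [hq])
      refine ⟨pv', bad', ?_, ?_⟩
      · rw [← hbits]; exact h1
      · rw [List.map_cons, List.foldl_cons, hstep, h2]
        congr 1
        ext <;> simp [hdp, hdm, hs, outCount, inCount, add_assoc]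

/-- The final test of `q` thus means that the certificate consists of complete slices. Without edges
the modulus is zero, and then `q` is just the number of bits read. -/
theorem foldl_step_q (l : List (ℕ × ℕ)) (v : ℕ) (o : Owner) :
    ∀ (y : List Bool) (a : Acc), a.q % l.length = a.q →
      (y.foldl (Acc.step l v o) a).q = (a.q + y.length) % l.length := by
  intro y
  induction y with
  | nil => intro a ha; simp [ha]
  | cons β y ih =>
    intro a ha
    have h1 : (Acc.step l v o a β).q = (a.q + 1) % l.length := by
      simp only [Acc.step]
      split_ifs with h
      · simp only [Acc.bit] at h
        rw [h, Nat.mod_self, Acc.endSlice]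
        split_ifs <;> rfl
      · simp only [Acc.bit] at h ⊢
        rcases Nat.eq_zero_or_pos l.length with h0 | h0
        · simp [h0]
        · have := Nat.mod_lt a.q h0
          rw [Nat.mod_eq_of_lt (by omega)]
    rw [List.foldl_cons, ih _ (by rw [h1, Nat.mod_mod]), h1, List.length_cons, Nat.mod_add_mod]
    congr 1
    ring

/-- The binary value of the balance at `v` of a list of slices. -/
def sliceValue (v : ℕ) (l : List (ℕ × ℕ)) : List (ℕ × ℕ → Bool) → ℤ
  | [] => 0
  | g :: gs => outCount v g l - inCount v g l + 2 * sliceValue v l gs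

/-- Addition with carries. All slices after the current one contribute an even amount, so the total
can vanish only if the two accumulators have equal parity. In that case halving the accumulators and
dropping the slice preserves the condition. -/
theorem foldl_step_slices (v : ℕ) (o : Owner) {l : List (ℕ × ℕ)} (hl : l ≠ []) :
    ∀ (gs : List (ℕ × ℕ → Bool)) (dp dm bad : ℕ),
      ∃ a, (gs.flatMap fun g => l.map g).foldl (Acc.step l v o) ⟨dp, dm, 0, 0, 1, bad⟩ = a ∧
        a.q = 0 ∧
        ((a.bad = 0 ∧ a.dp = a.dm) ↔ bad = 0 ∧
          (o = .switching → ∀ g ∈ gs, BitsOK 1 0 (outBits v g l)) ∧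
          (dp : ℤ) - dm + sliceValue v l gs = 0) := by
  intro gs
  induction gs with
  | nil =>
    intro dp dm bad
    refine ⟨_, rfl, rfl, ?_⟩
    simp only [List.flatMap_nil, List.foldl_nil, sliceValue, List.not_mem_nil]
    simp
    omega
  | cons g gs ih =>
    intro dp dm bad
    obtain ⟨pv', bad', h1, h2⟩ := foldl_step_slice v o g l l [] rfl hl ⟨dp, dm, 0, 0, 1, bad⟩ rfl
    rw [List.flatMap_cons, List.foldl_append, h2]
    simp only at h1
    simp only [Acc.endSlice, one_ne_zero, if_false]
    obtain ⟨a, h3, h4, h5⟩ := ih ((dp + outCount v g l) / 2) ((dm + inCount v g l) / 2)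
      (if (dp + outCount v g l) % 2 = (dm + inCount v g l) % 2 then bad' else bad' + 1)
    refine ⟨a, h3, h4, ?_⟩
    rw [h5, sliceValue]
    have h6 : (if (dp + outCount v g l) % 2 = (dm + inCount v g l) % 2 then bad' else bad' + 1) = 0 ↔
        (dp + outCount v g l) % 2 = (dm + inCount v g l) % 2 ∧ bad = 0 ∧
          (o = .switching → BitsOK 1 0 (outBits v g l)) := by
      split_ifs with h <;> simp [h, h1]
    rw [h6]
    -- Equal parities make the difference of the two quotients exactly half of the difference of the
    -- accumulators.
    have h7 : ((dp + outCount v g l) % 2 = (dm + inCount v g l) % 2 ∧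
        (((dp + outCount v g l) / 2 : ℕ) : ℤ) - ((dm + inCount v g l) / 2 : ℕ) +
          sliceValue v l gs = 0) ↔
        (dp : ℤ) - dm + (outCount v g l - inCount v g l + 2 * sliceValue v l gs) = 0 := by
      omega
    rw [← h7]
    simp only [List.forall_mem_cons]
    constructor
    · rintro ⟨⟨ha, hb, hc⟩, hd, he⟩
      exact ⟨hb, fun h => ⟨hc h, hd h⟩, ha, he⟩
    · rintro ⟨hb, hcd, ha, he⟩
      exact ⟨⟨ha, hb, fun h => (hcd h).1⟩, fun h => (hcd h).2, he⟩

theorem foldl_step_certificate (v : ℕ) (o : Owner) {l : List (ℕ × ℕ)} (hl : l ≠ [])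
    (g₀ : ℕ × ℕ → Bool) (gs : List (ℕ × ℕ → Bool)) (dp dm bad : ℕ) :
      ∃ a, (l.map g₀ ++ gs.flatMap fun g => l.map g).foldl (Acc.step l v o)
        ⟨dp, dm, 0, 0, 0, bad⟩ = a ∧ a.q = 0 ∧
        ((a.bad = 0 ∧ a.dp = a.dm) ↔ bad = 0 ∧
          (o = .switching → BitsOK 0 0 (outBits v g₀ l) ∧ ∀ g ∈ gs, BitsOK 1 0 (outBits v g l)) ∧
          (dp : ℤ) - dm + (outCount v g₀ l - inCount v g₀ l) + sliceValue v l gs = 0) := by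
  obtain ⟨pv', bad', h1, h2⟩ := foldl_step_slice v o g₀ l l [] rfl hl ⟨dp, dm, 0, 0, 0, bad⟩ rfl
  obtain ⟨a, h3, h4, h5⟩ := foldl_step_slices v o hl gs (dp + outCount v g₀ l)
    (dm + inCount v g₀ l) bad'
  refine ⟨a, ?_, h4, ?_⟩
  -- The end of the first slice only sets `slice` to one. The bits `g₀` have the same weight as the
  -- lowest binary digits, so nothing is halved yet.
  · rw [List.foldl_append, h2, ← h3]
    rfl
  · have h6 : (((dp + outCount v g₀ l : ℕ) : ℤ) - (dm + inCount v g₀ l : ℕ) +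
        sliceValue v l gs = 0) ↔
        ((dp : ℤ) - dm + (outCount v g₀ l - inCount v g₀ l) + sliceValue v l gs = 0) := by
      push_cast
      constructor <;> intro h <;> linarith
    rw [h5, h1, h6]
    constructor
    · rintro ⟨⟨ha, hb⟩, hc, hd⟩
      exact ⟨ha, fun h => ⟨hb h, hc h⟩, hd⟩
    · rintro ⟨ha, hbc, hd⟩
      exact ⟨⟨ha, fun h => (hbc h).1⟩, fun h => (hbc h).2, hd⟩

/-- Since no edge occurs twice, any block of bits of the right length is the list of values of a
function on the edges, obtained by looking up the position of the edge. -/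
theorem exists_slices {l : List (ℕ × ℕ)} (hl : l.Nodup) :
    ∀ (J : ℕ) (y : List Bool), y.length = J * l.length →
      ∃ gs : List (ℕ × ℕ → Bool), gs.length = J ∧ y = gs.flatMap fun g => l.map g := by
  intro J
  induction J with
  | zero => intro y hy; exact ⟨[], rfl, by simpa using hy⟩
  | succ J ih =>
    intro y hy
    obtain ⟨gs, h1, h2⟩ := ih (y.drop l.length) (by rw [List.length_drop, hy, add_mul]; omega)
    have hlen : l.length ≤ y.length := by rw [hy, add_mul]; omega
    refine ⟨(fun e => y.getD (l.idxOf e) false) :: gs, by simp [h1], ?_⟩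
    rw [List.flatMap_cons, ← h2]
    conv_lhs => rw [← List.take_append_drop l.length y]
    congr 1
    refine List.ext_getElem (by simp [hlen]) fun i hi hi' => ?_
    have hil : i < l.length := by simpa using hi'
    simp [hl.idxOf_getElem, List.getElem?_eq_getElem (hil.trans_le hlen)]

/-- The previous bit is stored increased by one, because the value 0 means that no outgoing edge has
been met in this slice. -/
theorem bitsOK_iff {slice : ℕ} : ∀ (β : Bool) (βs : List Bool), BitsOK slice (β.toNat + 1) βs ↔
    (β :: βs).IsChain fun β β' => ¬ (β' = true ∧ β = false ∨ β' = false ∧ slice ≠ 0 ∧ β = true)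
  | β, [] => by simp [BitsOK]
  | β, β' :: βs => by
    rw [BitsOK, bitsOK_iff β' βs, List.isChain_cons_cons]
    cases β <;> cases β' <;> simp

theorem bitsOK_zero {βs : List Bool} :
    BitsOK 0 0 βs ↔ βs.IsChain fun β β' => β' = true → β = true := by
  cases βs with
  | nil => simp [BitsOK]
  | cons β βs =>
    rw [BitsOK, bitsOK_iff]
    simp

theorem bitsOK_one {βs : List Bool} : BitsOK 1 0 βs ↔ βs.IsChain fun β β' => β = β' := by
  cases βs with
  | nil => simp [BitsOK]
  | cons β βs =>
    rw [BitsOK, bitsOK_iff]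
    have : ∀ β β' : Bool, ¬ (β' = true ∧ β = false ∨ β' = false ∧ 1 ≠ 0 ∧ β = true) ↔ β = β' := by
      decide
    simp only [this]
    simp

end CounterProg

/-! ### The check of the flow at all vertices -/

namespace CounterProg

open Reg

theorem writes_bitStep {r : Reg} {o : Owner} {β : Bool} (h : Writes r (bitStep o β)) :
    r ∈ [dp, dm, ep, em, q, k, pv, slice, ho, hi, b1, c1, bad] := by
  cases o <;> cases β <;>
  simp [bitStep, seqs, Writes, locate, locateStep, writes_forEdges, writes_ifElse, addBit, checkBit,
    endSlice, reject] at h ⊢ <;> tauto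

theorem writes_checkFlowAt {r : Reg} {o : Owner} (h : Writes r (checkFlowAt o)) :
    r ∈ [dp, dm, ep, em, q, k, pv, slice, ho, hi, b1, c1, bad] := by
  have := fun β => writes_bitStep (r := r) (o := o) (β := β)
  simp only [checkFlowAt, seqs, Writes, writes_forCertificate, writes_ifElse, reject] at h
  simp only [List.mem_cons, List.not_mem_nil, or_false] at this ⊢
  rcases h with h | h | h | h | h | (h | h) | (h | h) | ⟨β, h⟩ | (h | h) | (h | h) | h <;>
    first | exact this _ h | simp [h] | exact h.elim

variable {s' t' : ℕ} {bs : List (Owner × List ℕ)} {y : List Bool}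

theorem FlowConst.eval_of_writes {n' m' v : ℕ} {st : Reg → ℕ} {p : VProg}
    {w : List InputSymbol} (h : FlowConst s' t' n' m' v st)
    (hp : ∀ r, Writes r p → r ∈ [dp, dm, ep, em, q, k, pv, slice, ho, hi, b1, c1, bad]) :
    FlowConst s' t' n' m' v (eval w p st) :=
  h.of_eq fun r hr => eval_of_not_writes _ _ _ fun hw => by
    have := hp r hw
    clear hw
    revert this hr
    revert r
    decide

theorem view_foldl_bitStep {n' v : ℕ} (o : Owner) (y' : List Bool) :
    ∀ {st : Reg → ℕ} (_ : FlowConst s' t' n' (edgeList 0 bs).length v st),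
      view (y'.foldl (fun st β =>
        eval (encodeInstanceCertificate (render s' t' bs, y)) (bitStep o β) st) st) =
        y'.foldl ((Acc.step (edgeList 0 bs) v o)) (view st) ∧
      FlowConst s' t' n' (edgeList 0 bs).length v (y'.foldl (fun st β =>
        eval (encodeInstanceCertificate (render s' t' bs, y)) (bitStep o β) st) st) := by
  induction y' with
  | nil => exact fun h => ⟨rfl, h⟩
  | cons β y' ih =>
    intro st h
    rw [List.foldl_cons, List.foldl_cons, ← view_bitStep s' t' bs y h]
    exact ih (h.eval_of_writes fun r => writes_bitStep)

/-- The certificate `y` passes the check of the flow at the vertex `v`. -/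
def AcceptAt (s' t' : ℕ) (l : List (ℕ × ℕ)) (y : List Bool) (v : ℕ) (o : Owner) : Prop :=
  ∃ a, y.foldl (Acc.step l v o)
    ⟨if t' = v then 1 else 0, if s' = v then 1 else 0, 0, 0, 0, 0⟩ = a ∧
    a.q = 0 ∧ a.bad = 0 ∧ a.dp = a.dm

/-- A rejection is never revoked. Therefore `AcceptAt` may start with `bad = 0`, whatever earlier
vertices have done. -/
theorem Acc.bad_le_foldl (l : List (ℕ × ℕ)) (v : ℕ) (o : Owner) (y : List Bool) :
    ∀ a : Acc, a.bad ≤ (y.foldl (Acc.step l v o) a).bad := by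
  induction y with
  | nil => exact fun _ => le_rfl
  | cons β y ih =>
    intro a
    refine le_trans ?_ (ih _)
    have h1 : ∀ a : Acc, a.bad ≤ a.endSlice.bad := by
      intro a
      rw [Acc.endSlice]
      split_ifs <;> first | exact le_rfl | exact Nat.le_succ _
    have h2 : a.bad ≤ (a.bit o (hitOut l v a.q) (hitIn l v a.q) β).bad := by
      rw [Acc.bit]
      dsimp only
      split_ifs <;> omega
    rw [Acc.step]
    split_ifs
    · exact h2.trans (h1 ⟨_, _, _, _, _, _⟩)
    · exact h2

theorem checkFlowAt_spec {n' v : ℕ} {st : Reg → ℕ} (o : Owner)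
    (h : FlowConst s' t' n' (edgeList 0 bs).length v st) :
    eval (encodeInstanceCertificate (render s' t' bs, y)) (checkFlowAt o) st bad = 0 ↔
      st bad = 0 ∧ AcceptAt s' t' (edgeList 0 bs) y v o := by
  simp only [checkFlowAt, seqs, eval, eval_forCertificate]
  set st₁ := eval (encodeInstanceCertificate (render s' t' bs, y)) (ifElse t v0 (inc dp) skip)
      (Function.update (Function.update (Function.update (Function.update (Function.update st dp 0)
        dm 0) q 0) pv 0) slice 0) with hst₁
  set st₂ := eval (encodeInstanceCertificate (render s' t' bs, y)) (ifElse s v0 (inc dm) skip) st₁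
    with hst₂
  have hv : view st₂ = ⟨if t' = v then 1 else 0, if s' = v then 1 else 0, 0, 0, 0, st bad⟩ := by
    simp only [hst₂, hst₁, eval_ifElse, eval]
    by_cases h1 : t' = v <;> by_cases h2 : s' = v <;> simp [h.s, h.t, h.v0, h1, h2, view]
  have h₂ : FlowConst s' t' n' (edgeList 0 bs).length v st₂ := by
    refine h.of_eq fun r hr => ?_
    rw [hst₂, eval_of_not_writes, hst₁, eval_of_not_writes]
    · revert hr; revert r; simp
    · revert hr; revert r; simp [writes_ifElse, Writes]
    · revert hr; revert r; simp [writes_ifElse, Writes]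
  obtain ⟨h3, h4⟩ := view_foldl_bitStep (y := y) o y h₂
  rw [hv] at h3
  clear_value st₂
  generalize y.foldl (fun st β => eval (encodeInstanceCertificate (render s' t' bs, y))
    (bitStep o β) st) st₂ = st₃ at h3 h4 ⊢
  have hbad : eval (encodeInstanceCertificate (render s' t' bs, y)) (ifElse dp dm skip reject)
      (eval (encodeInstanceCertificate (render s' t' bs, y)) (ifElse q zero skip reject) st₃) bad
        = 0 ↔ st₃ q = 0 ∧ st₃ bad = 0 ∧ st₃ dp = st₃ dm := by
    simp only [eval_ifElse, eval, reject, h4.zero]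
    split_ifs <;> simp_all
  rw [hbad, AcceptAt]
  by_cases h0 : st bad = 0
  · rw [h0] at h3
    rw [← h3]
    simp [view, h0]
  · have := Acc.bad_le_foldl (edgeList 0 bs) v o y
      ⟨if t' = v then 1 else 0, if s' = v then 1 else 0, 0, 0, 0, st bad⟩
    rw [← h3] at this
    simp only [view] at this
    have h5 : st₃ bad ≠ 0 := by omega
    simp [h5, h0]

/-- The vertex names are ignored, so this pass amounts to a fold over the owners. -/
theorem foldl_flowStep (w : List InputSymbol) (s' t' : ℕ) (bs : List (Owner × List ℕ))
    (st : Reg → ℕ) :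
    (render s' t' bs).foldl (fun st g => eval w (flowStep g) st) st =
      (bs.map Prod.fst).foldl (fun st o => eval w (flowStep (.owner o)) st) st := by
  have hname : ∀ (j : ℕ) (st : Reg → ℕ),
      (indexName j).foldl (fun st g => eval w (flowStep g) st) st = st := by
    intro j st
    rw [indexName, List.foldl_append]
    have : ∀ (j : ℕ) (st : Reg → ℕ),
      (List.replicate j GameSymbol.tick).foldl (fun st g => eval w (flowStep g) st) st = st := by
      intro j
      induction j with
      | zero => exact fun _ => rfl
      | succ j ih => exact fun st => ih st
    rw [this]
    rfl
  have hnames : ∀ (l : List ℕ) (st : Reg → ℕ),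
      (l.flatMap indexName).foldl (fun st g => eval w (flowStep g) st) st = st := by
    intro l
    induction l with
    | nil => exact fun _ => rfl
    | cons j l ih => intro st; rw [List.flatMap_cons, List.foldl_append, hname, ih]
  rw [render, List.foldl_append, List.foldl_append, hname, hname]
  induction bs generalizing st with
  | nil => rfl
  | cons b bs ih =>
    rw [List.flatMap_cons, List.foldl_append, renderBlock, List.foldl_cons, hnames, ih]
    rfl

theorem foldl_owners_spec {n' : ℕ} (os : List Owner) :
    ∀ (v : ℕ) (st : Reg → ℕ), FlowConst s' t' n' (edgeList 0 bs).length v st →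
      (os.foldl (fun st o => eval (encodeInstanceCertificate (render s' t' bs, y))
          (flowStep (.owner o)) st) st bad = 0 ↔
        st bad = 0 ∧ ∀ i o, os[i]? = some o → AcceptAt s' t' (edgeList 0 bs) y (v + i) o) := by
  induction os with
  | nil => simp
  | cons o os ih =>
    intro v st h
    rw [List.foldl_cons]
    have h1 := checkFlowAt_spec (y := y) o h
    have h2 : FlowConst s' t' n' (edgeList 0 bs).length v
      (eval (encodeInstanceCertificate (render s' t' bs, y)) (checkFlowAt o) st) :=
        h.eval_of_writes fun r => writes_checkFlowAt
    have h3 : FlowConst s' t' n' (edgeList 0 bs).length (v + 1)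
        (eval (encodeInstanceCertificate (render s' t' bs, y)) (flowStep (.owner o)) st) := by
      simp only [flowStep, seqs, eval]
      constructor <;> simp [h2.zero, h2.one, h2.two, h2.s, h2.t, h2.n, h2.m, h2.v0, h2.v1]
    rw [ih _ _ h3]
    have h4 : eval (encodeInstanceCertificate (render s' t' bs, y)) (flowStep (.owner o)) st bad =
        eval (encodeInstanceCertificate (render s' t' bs, y)) (checkFlowAt o) st bad := by
      simp [flowStep, seqs, eval]
    rw [h4, h1]
    constructor
    · rintro ⟨⟨h5, h6⟩, h7⟩
      refine ⟨h5, fun i o' hi => ?_⟩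
      cases i with
      | zero => simp at hi; subst hi; exact h6
      | succ i =>
        have := h7 i o' (by simpa using hi)
        rwa [add_assoc, add_comm 1 i] at this
    · rintro ⟨h5, h6⟩
      refine ⟨⟨h5, h6 0 o rfl⟩, fun i o' hi => ?_⟩
      rw [add_assoc, add_comm 1 i]
      exact h6 (i + 1) o' (by simpa using hi)

end CounterProg

/-! ### The checks of the instance, and the specification of the verifier -/

namespace CounterProg

open Reg

variable {s' t' : ℕ} {bs : List (Owner × List ℕ)} {y : List Bool}

/-- Turns a test of single edges into a test of all edges; `Inv` protects the counters that the test
reads. -/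
theorem foldl_atEdge_check {w : List InputSymbol} {rb rc : Reg} {p : VProg} {Inv : (Reg → ℕ) → Prop}
    {P : ℕ × ℕ → Prop} (hInv : ∀ st e, Inv st → Inv (atEdge w rb rc p st e))
    (hP : ∀ st e, Inv st → (atEdge w rb rc p st e bad = 0 ↔ st bad = 0 ∧ P e)) :
    ∀ (l : List (ℕ × ℕ)) (st : Reg → ℕ), Inv st →
      (l.foldl (atEdge w rb rc p) st bad = 0 ↔ st bad = 0 ∧ ∀ e ∈ l, P e) := by
  intro l
  induction l with
  | nil => simp
  | cons e l ih =>
    intro st h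
    rw [List.foldl_cons, ih _ (hInv st e h), hP st e h, List.forall_mem_cons, and_assoc]

theorem eval_requireLt (w : List InputSymbol) (r r' : Reg) (st : Reg → ℕ) :
    eval w (requireLt r r') st bad = 0 ↔ st bad = 0 ∧ st r < st r' := by
  simp only [requireLt, eval]
  rcases Nat.lt_trichotomy (st r) (st r') with h | h | h
  · rw [compare_lt_iff_lt.2 h]; simp [eval, h]
  · rw [compare_eq_iff_eq.2 h]; simp [eval, h, reject]
  · rw [compare_gt_iff_gt.2 h]; simp [eval, h.le, reject]

theorem writes_requireLt {r r' r'' : Reg} (h : Writes r'' (requireLt r r')) : r'' = bad := by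
  obtain ⟨o, h⟩ := h
  cases o
  exacts [h.elim, h, h]

theorem writes_checkNames {r : Reg} (h : Writes r checkNames) : r ∈ [b, c, bad] := by
  simp only [checkNames, seqs, Writes, writes_forEdges, or_false] at h
  rcases h with h | h | h | h | h
  · simp [writes_requireLt h]
  · simp [writes_requireLt h]
  · simp [h]
  · simp [h]
  · simp [writes_requireLt h]

theorem checkNames_spec {st : Reg → ℕ} (h0 : st zero = 0) :
    eval (encodeInstanceCertificate (render s' t' bs, y)) checkNames st bad = 0 ↔
      st bad = 0 ∧ st s < st n ∧ st t < st n ∧ ∀ e ∈ edgeList 0 bs, e.2 < st n := by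
  simp only [checkNames, seqs, eval]
  have hw : ∀ r r' r'' : Reg, r'' ≠ bad → ∀ st : Reg → ℕ,
      eval (encodeInstanceCertificate (render s' t' bs, y)) (requireLt r r') st r'' = st r'' :=
    fun r r' r'' h st => eval_of_not_writes _ _ _ fun h' => h (writes_requireLt h')
  rw [eval_forEdges _ (by decide) (by decide) (by decide) _ (fun h => by cases writes_requireLt h)
    (fun h => by cases writes_requireLt h) _ (by rw [hw _ _ _ (by decide), hw _ _ _ (by decide), h0])]
  rw [Function.update_of_ne (by decide), Function.update_of_ne (by decide),
    foldl_atEdge_check (Inv := fun st' => st' n = st n) (P := fun e => e.2 < st n),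
    eval_requireLt, eval_requireLt, hw _ _ _ (by decide), hw _ _ _ (by decide), and_assoc, and_assoc]
  · intro st' e h
    rw [atEdge, hw _ _ _ (by decide)]
    simpa using h
  · intro st' e h
    rw [atEdge, eval_requireLt]
    simp [h]
  · rw [hw _ _ _ (by decide), hw _ _ _ (by decide)]

theorem foldl_countEdge (w : List InputSymbol) (e : ℕ × ℕ) :
    ∀ (l : List (ℕ × ℕ)) (st : Reg → ℕ), st b = e.1 + 1 → st c = e.2 →
      l.foldl (atEdge w b1 c1 countStep) st cnt =
        st cnt + l.count e := by
  intro l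
  induction l with
  | nil => simp
  | cons e' l ih =>
    intro st hb hc
    have h : ∀ r ∈ [b, c], atEdge w b1 c1 countStep st e' r =
        st r := by
      intro r hr
      rw [atEdge, eval_of_not_writes, Function.update_of_ne, Function.update_of_ne]
      · revert hr; revert r; decide
      · revert hr; revert r; decide
      · revert hr; revert r; simp [countStep, writes_ifElse, Writes]
    rw [List.foldl_cons, ih _ (by rw [h _ (by decide), hb]) (by rw [h _ (by decide), hc]),
      List.count_cons]
    have h1 : atEdge w b1 c1 countStep st e' cnt =
        st cnt + if e' = e then 1 else 0 := by
      simp only [atEdge, countStep, eval_ifElse, eval]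
      by_cases h2 : e'.1 = e.1 <;> by_cases h3 : e'.2 = e.2 <;>
        simp [hb, hc, h2, h3, Prod.ext_iff, eq_comm (a := e.1), eq_comm (a := e.2)]
    rw [h1]
    simp only [beq_iff_eq]
    omega

theorem countEdge_spec {st : Reg → ℕ} {e : ℕ × ℕ} (h0 : st zero = 0) (hb : st b = e.1 + 1)
    (hc : st c = e.2) :
    eval (encodeInstanceCertificate (render s' t' bs, y)) countEdge st cnt =
      (edgeList 0 bs).count e := by
  simp only [countEdge, seqs, eval]
  rw [eval_forEdges _ (by decide) (by decide) (by decide) _ (by simp [countStep, writes_ifElse, Writes])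
    (by simp [countStep, writes_ifElse, Writes]) _ (by simp [h0])]
  rw [Function.update_of_ne (by decide), Function.update_of_ne (by decide),
    foldl_countEdge _ e _ _ (by simp [hb]) (by simp [hc])]
  simp

theorem writes_countEdge {r : Reg} (h : Writes r countEdge) : r ∈ [b1, c1, cnt] := by
  simp [countEdge, seqs, Writes, writes_forEdges, countStep, writes_ifElse] at h ⊢
  tauto

theorem writes_checkNodup {r : Reg} (h : Writes r checkNodup) : r ∈ [b, c, b1, c1, cnt, bad] := by
  have := writes_countEdge (r := r)
  simp [checkNodup, seqs, Writes, writes_forEdges, writes_ifElse, reject] at h this ⊢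
  tauto

theorem checkNodup_spec {st : Reg → ℕ} (h0 : st zero = 0) (h1 : st one = 1) :
    eval (encodeInstanceCertificate (render s' t' bs, y)) checkNodup st bad = 0 ↔
      st bad = 0 ∧ (edgeList 0 bs).Nodup := by
  have hw : ∀ r ∉ [b1, c1, cnt, bad], ¬ Writes r (seqs [countEdge, ifElse cnt one skip reject]) := by
    intro r hr h
    have := writes_countEdge (r := r)
    simp [seqs, Writes, writes_ifElse, reject] at h this hr
    tauto
  simp only [checkNodup]
  rw [eval_forEdges _ (by decide) (by decide) (by decide) _ (hw _ (by decide)) (hw _ (by decide)) _ h0,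
    Function.update_of_ne (by decide), Function.update_of_ne (by decide), List.nodup_iff_count_eq_one,
    foldl_atEdge_check (Inv := fun st => st zero = 0 ∧ st one = 1)
      (P := fun e => (edgeList 0 bs).count e = 1)]
  · intro st e h
    simp only [atEdge]
    rw [eval_of_not_writes _ _ _ (hw _ (by decide)), eval_of_not_writes _ _ _ (hw _ (by decide))]
    simpa using h
  · intro st e h
    simp only [atEdge, seqs, eval, eval_ifElse]
    rw [countEdge_spec (e := e) (by simp [h.1]) (by simp) (by simp),
      eval_of_not_writes _ countEdge _ (r := one) (fun h => absurd (writes_countEdge h) (by decide))]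
    have hbad := eval_of_not_writes (encodeInstanceCertificate (render s' t' bs, y)) countEdge
      (Function.update (Function.update st b (e.1 + 1)) c e.2) (r := bad)
      (fun h => absurd (writes_countEdge h) (by decide))
    simp only [ne_eq, reduceCtorEq, not_false_eq_true, Function.update_of_ne] at hbad ⊢
    rw [h.2]
    split_ifs with h2
    · simp [hbad, h2]
    · simp [h2, reject, eval]
  · exact ⟨h0, h1⟩

/-- The values of the counters in the check of the format. -/
structure FormatConst (hdr' c' n' m' s' t' : ℕ) (st : Reg → ℕ) : Prop where
  zero : st zero = 0
  one : st one = 1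
  two : st two = 2
  c : st c = c'
  bad : st bad = 0
  hdr : st hdr = hdr'
  n : st n = n'
  m : st m = m'
  s : st s = s'
  t : st t = t'

/-- The shape of an instance that has passed the check of the format so far. -/
def FormatShape (x : List GameSymbol) (st : Reg → ℕ) : Prop :=
  (st n = 0 ∧ st m = 0 ∧
    (st hdr = 0 ∧ st s = st c ∧ st t = 0 ∧ x = List.replicate (st c) .tick ∨
      st hdr = 1 ∧ st t = st c ∧ x = indexName (st s) ++ List.replicate (st c) .tick ∨
      st hdr = 2 ∧ (st c = 0 → x = indexName (st s) ++ indexName (st t)) ∨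
      2 < st hdr)) ∨
  0 < st n ∧ ∃ bs, x = render (st s) (st t) bs ++ List.replicate (st c) .tick ∧ st n = bs.length ∧
    st m = (edgeList 0 bs).length ∧ ∀ b ∈ bs, b.1 ≠ .safety

theorem edgeList_append (v : ℕ) : ∀ bs bs' : List (Owner × List ℕ),
    edgeList v (bs ++ bs') = edgeList v bs ++ edgeList (v + bs.length) bs'
  | [], bs' => by simp [edgeList]
  | d :: bs, bs' => by
    simp only [List.cons_append, edgeList, edgeList_append (v + 1) bs bs', List.append_assoc,
      List.length_cons]
    congr 3
    omega

theorem writes_formatStep {r : Reg} {g : GameSymbol} (h : Writes r (formatStep g)) :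
    r ∈ [bad, hdr, n, m, c, s, t] := by
  cases g with
  | owner o =>
    cases o <;> simp [formatStep, seqs, rejectSafety, Writes, writes_ifElse, reject] at h ⊢ <;> tauto
  | _ => simp [formatStep, seqs, Writes, writes_ifElse] at h ⊢; tauto

theorem eval_formatStep_tick (w : List InputSymbol) {st : Reg → ℕ} (h0 : st zero = 0) :
    eval w (formatStep .tick) st = if st n = 0 then
      if st hdr = 0 then Function.update (Function.update st c (st c + 1)) s (st s + 1) else
        Function.update (Function.update st c (st c + 1)) t (st t + 1) else
      Function.update st c (st c + 1) := by
  by_cases h3 : st n = 0 <;> by_cases h4 : st hdr = 0 <;>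
  simp [formatStep, seqs, eval, eval_ifElse, h0, h3, h4]

theorem eval_formatStep_sep (w : List InputSymbol) {st : Reg → ℕ} (h0 : st zero = 0) :
    eval w (formatStep .sep) st = if st n = 0 then
      Function.update (Function.update st c 0) hdr (st hdr + 1) else
      Function.update (Function.update st c 0) m (st m + 1) := by
  by_cases h3 : st n = 0 <;> simp [formatStep, seqs, eval, eval_ifElse, h0, h3]

/-- Soundness of the format check. While `bad` is zero, the word read so far is determined by the
counters, except in header states that can no longer be accepted. Ticks after the second name are
such a case: they corrupt `t`, but an owner letter is rejected while `c` is positive, and a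
separator makes `hdr` exceed 2, after which every owner letter is rejected. -/
theorem formatShape_foldl (w : List InputSymbol) {st : Reg → ℕ} (h : FormatConst 0 0 0 0 0 0 st) :
    ∀ x : List GameSymbol, ∃ st', x.foldl (fun st g => eval w (formatStep g) st) st = st' ∧
      st' zero = 0 ∧ st' two = 2 ∧ (st' bad = 0 → FormatShape x st') := by
  intro x
  refine ⟨_, rfl, ?_⟩
  induction x using List.reverseRecOn with
  | nil =>
    refine ⟨h.zero, h.two, fun _ => .inl ⟨h.n, h.m, .inl ⟨h.hdr, ?_, h.t, ?_⟩⟩⟩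
    · simp [h.s, h.c]
    · simp [h.c]
  | append_singleton x g ih =>
    rw [List.foldl_append, List.foldl_cons, List.foldl_nil]
    generalize x.foldl (fun st g => eval w (formatStep g) st) st = st at ih ⊢
    obtain ⟨h0, h2, ih⟩ := ih
    have hw : ∀ r ∉ [bad, hdr, n, m, c, s, t], eval w (formatStep g) st r = st r :=
      fun r hr => eval_of_not_writes _ _ _ fun h => hr (writes_formatStep h)
    refine ⟨by rw [hw _ (by decide), h0], by rw [hw _ (by decide), h2], fun hbad => ?_⟩
    clear hw
    cases g with
    | owner o =>
      have h1 : st bad = 0 ∧ o ≠ .safety ∧ st c = 0 ∧ st hdr = 2 ∧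
          eval w (formatStep (.owner o)) st = Function.update st n (st n + 1) := by
        revert hbad
        by_cases h3 : st c = 0 <;> by_cases h4 : st hdr = 2 <;> cases o <;>
          simp [formatStep, seqs, rejectSafety, reject, eval, eval_ifElse, h0, h2, h3, h4]
      obtain ⟨h3, h4, h5, h6, h7⟩ := h1
      rw [h7]
      rcases ih h3 with ⟨h8, h9, h10⟩ | ⟨h8, bs, h9, h10, h11, h12⟩
      · have h10 : x = indexName (st s) ++ indexName (st t) := by
          rcases h10 with h10 | h10 | h10 | h10
          · omega
          · omega
          · exact h10.2 h5
          · omega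
        refine .inr ⟨by simp, [(o, [])], ?_⟩
        simp [h10, h5, h8, h9, edgeList, render, renderBlock, h4]
      · refine .inr ⟨by simp, bs ++ [(o, [])], ?_⟩
        simp [h5, h9, h10, h11, edgeList_append, edgeList, render, renderBlock]
        rintro a l (h | ⟨rfl, rfl⟩)
        · exact h12 _ h
        · exact h4
    | tick =>
      rw [eval_formatStep_tick w h0] at hbad ⊢
      have hbad' : st bad = 0 := by split_ifs at hbad <;> simpa using hbad
      rcases ih hbad' with ⟨h8, h9, h10⟩ | ⟨h8, bs, h9, h10, h11, h12⟩
      · refine .inl ?_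
        rw [if_pos h8]
        rcases h10 with ⟨h10, h11, h12, h13⟩ | ⟨h10, h11, h12⟩ | ⟨h10, h11⟩ | h10
        · simp [h8, h9, h10, h11, h12]
          rw [List.replicate_succ', h13]
        · simp [h8, h9, h10, h11]
          rw [List.replicate_succ', h12, List.append_assoc]
        · simp [h8, h9, h10]
        · have h11 : st hdr ≠ 0 := by omega
          simp [h8, h9, h10, h11]
      · refine .inr ?_
        rw [if_neg h8.ne']
        refine ⟨by simpa using h8, bs, ?_, by simpa using h10, by simpa using h11, h12⟩
        rw [h9]
        simp [List.replicate_succ']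
    | sep =>
      rw [eval_formatStep_sep w h0] at hbad ⊢
      have hbad' : st bad = 0 := by split_ifs at hbad <;> simpa using hbad
      rcases ih hbad' with ⟨h8, h9, h10⟩ | ⟨h8, bs, h9, h10, h11, h12⟩
      · refine .inl ?_
        rw [if_pos h8]
        rcases h10 with ⟨h10, h11, h12, h13⟩ | ⟨h10, h11, h12⟩ | ⟨h10, h11⟩ | h10
        · simp [h8, h9, h10, h12, indexName]
          rw [h11, h13]
        · simp [h8, h9, h10, h12, indexName]
          rw [h11]
        · simp [h8, h9, h10]
        · simp [h8, h9]
          omega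
      · refine .inr ?_
        rw [if_neg h8.ne']
        rcases bs.eq_nil_or_concat with rfl | ⟨bs, d, rfl⟩
        · simp at h10; omega
        rw [List.concat_eq_append] at h9 h10 h11 h12
        -- The separator completes the name of index `st c`, which becomes the last neighbour of the
        -- last block.
        refine ⟨by simpa using h8, bs ++ [(d.1, d.2 ++ [st c])], ?_, by simpa using h10, ?_, ?_⟩
        · rw [h9]
          simp [render, renderBlock, indexName]
        · simp [h11, edgeList_append, edgeList, add_assoc]
        · simpa [or_imp, forall_and] using h12

theorem formatConst_name (w : List InputSymbol) {hdr' n' m' s' t' : ℕ} {st : Reg → ℕ}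
    (h : FormatConst hdr' 0 n' m' s' t' st) (j : ℕ) :
    ∃ st', (indexName j).foldl (fun st g => eval w (formatStep g) st) st = st' ∧
      FormatConst (if n' = 0 then hdr' + 1 else hdr') 0 n' (if n' = 0 then m' else m' + 1)
        (if n' = 0 ∧ hdr' = 0 then s' + j else s') (if n' = 0 ∧ hdr' ≠ 0 then t' + j else t') st' := by
  refine ⟨_, rfl, ?_⟩
  have hticks : ∀ j, FormatConst hdr' j n' m' (if n' = 0 ∧ hdr' = 0 then s' + j else s')
      (if n' = 0 ∧ hdr' ≠ 0 then t' + j else t')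
      ((List.replicate j GameSymbol.tick).foldl (fun st g => eval w (formatStep g) st) st) := by
    intro j
    induction j with
    | zero => simpa using h
    | succ j ih =>
      rw [List.replicate_succ', List.foldl_append]
      generalize (List.replicate j GameSymbol.tick).foldl (fun st g => eval w (formatStep g) st) st
        = st at ih ⊢
      rw [List.foldl_cons, List.foldl_nil, eval_formatStep_tick w ih.zero, ih.n, ih.hdr, ih.c, ih.s,
        ih.t]
      by_cases h1 : n' = 0 <;> by_cases h2 : hdr' = 0 <;> constructor <;>
      simp [h1, h2, ih.n, ih.hdr, ih.zero, ih.one, ih.two, ih.bad, ih.m, ih.s, ih.t, add_assoc]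
  have ih := hticks j
  rw [indexName, List.foldl_append]
  generalize (List.replicate j GameSymbol.tick).foldl (fun st g => eval w (formatStep g) st) st
    = st at ih ⊢
  rw [List.foldl_cons, List.foldl_nil, eval_formatStep_sep w ih.zero, ih.n, ih.hdr, ih.m]
  by_cases h1 : n' = 0 <;> constructor <;>
  simp [h1, ih.n, ih.hdr, ih.zero, ih.one, ih.two, ih.bad, ih.m, ih.s, ih.t]

/-- Completeness of the format check: nothing is rejected, and the counters receive the data of the
game. -/
theorem formatConst_render (w : List InputSymbol) {st : Reg → ℕ} (h : FormatConst 0 0 0 0 0 0 st)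
    (s' t' : ℕ) : ∀ bs : List (Owner × List ℕ), (∀ d ∈ bs, d.1 ≠ .safety) →
    FormatConst 2 0 bs.length (edgeList 0 bs).length s' t'
      ((render s' t' bs).foldl (fun st g => eval w (formatStep g) st) st) := by
  intro bs
  induction bs using List.reverseRecOn with
  | nil =>
    intro _
    rw [render, List.foldl_append, List.foldl_append]
    obtain ⟨st', h1, h2⟩ := formatConst_name w h s'
    simp only [if_true, true_and, ne_eq, not_true, and_false, if_false, zero_add] at h2
    obtain ⟨st'', h3, h4⟩ := formatConst_name w h2 t'
    rw [h1, h3]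
    simpa [edgeList] using h4
  | append_singleton bs d ih =>
    intro hbs
    have ih := ih fun d hd => hbs d (by simp [hd])
    have hd := hbs d (by simp)
    have hr : render s' t' (bs ++ [d]) = render s' t' bs ++ renderBlock d := by simp [render]
    rw [hr, List.foldl_append]
    generalize (render s' t' bs).foldl (fun st g => eval w (formatStep g) st) st = st at ih ⊢
    have h1 : FormatConst 2 0 (bs.length + 1) (edgeList 0 bs).length s' t'
        (eval w (formatStep (.owner d.1)) st) := by
      cases ho : d.1 <;> simp only [ho, ne_eq, not_true, reduceCtorEq] at hd <;> constructor <;>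
      simp [formatStep, rejectSafety, seqs, eval, eval_ifElse, ih.n, ih.hdr, ih.zero, ih.one,
        ih.two, ih.bad, ih.m, ih.s, ih.t, ih.c]
    have h2 : ∀ (l : List ℕ) (m' : ℕ) (st : Reg → ℕ), FormatConst 2 0 (bs.length + 1) m' s' t' st →
        FormatConst 2 0 (bs.length + 1) (m' + l.length) s' t'
          ((l.flatMap indexName).foldl (fun st g => eval w (formatStep g) st) st) := by
      intro l
      induction l with
      | nil => exact fun _ _ h => h
      | cons j l ih =>
        intro m' st h
        obtain ⟨st', h3, h4⟩ := formatConst_name w h j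
        rw [List.flatMap_cons, List.foldl_append, h3]
        have := ih (m' + 1) st' (by simpa using h4)
        rwa [add_assoc, add_comm 1] at this
    have h3 := h2 d.2 _ _ h1
    rw [renderBlock, List.foldl_cons]
    simpa [edgeList_append, edgeList] using h3

theorem checkFormat_render {s' t' : ℕ} {bs : List (Owner × List ℕ)} (hne : bs ≠ [])
    (hbs : ∀ d ∈ bs, d.1 ≠ .safety) :
    FormatConst 2 0 bs.length (edgeList 0 bs).length s' t'
      (eval (encodeInstanceCertificate (render s' t' bs, y)) checkFormat 0) := by
  have h0 := formatConst_render (encodeInstanceCertificate (render s' t' bs, y))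
    (st := Function.update (Function.update (Function.update (0 : Reg → ℕ) one 1) two 1) two 2)
    (by constructor <;> simp) s' t' bs hbs
  have h2 : bs.length ≠ 0 := by simpa using hne
  simp only [checkFormat, seqs, eval, eval_forInstance, Pi.zero_apply, zero_add,
    Function.update_self, ne_eq, reduceCtorEq, not_false_eq_true, Function.update_of_ne,
    Nat.reduceAdd]
  generalize (render s' t' bs).foldl _ _ = st at h0 ⊢
  rw [eval_ifElse _ c, if_pos (by rw [h0.c, h0.zero]), eval, eval_ifElse,
    if_neg (by rw [h0.n, h0.zero]; exact h2), eval]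
  exact h0

theorem checkFormat_shape {x : List GameSymbol}
    (h : eval (encodeInstanceCertificate (x, y)) checkFormat 0 bad = 0) :
    ∃ s' t' bs, bs ≠ [] ∧ x = render s' t' bs ∧ ∀ d ∈ bs, d.1 ≠ .safety := by
  simp only [checkFormat, seqs, eval, eval_forInstance] at h
  obtain ⟨st, h1, h2, -, h4⟩ := formatShape_foldl (encodeInstanceCertificate (x, y))
    (st := Function.update (Function.update (Function.update 0 one 1) two 1) two 2)
    (by constructor <;> simp) x
  simp only [Pi.zero_apply, zero_add, Function.update_self, ne_eq, reduceCtorEq, not_false_eq_true,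
    Function.update_of_ne, Nat.reduceAdd] at h
  rw [h1] at h
  have h5 : st bad = 0 ∧ st c = 0 ∧ st n ≠ 0 := by
    revert h
    by_cases h5 : st c = 0 <;> by_cases h6 : st n = 0 <;>
    simp [eval_ifElse, eval, reject, h2, h5, h6]
  obtain ⟨h5, h6, h7⟩ := h5
  rcases h4 h5 with ⟨h8, -⟩ | ⟨-, bs, h9, h10, -, h12⟩
  · exact absurd h8 h7
  · refine ⟨st s, st t, bs, ?_, ?_, h12⟩
    · rintro rfl
      exact h7 (by simpa using h10)
    · rw [h9, h6]; simp

theorem writes_checkFormat {r : Reg} (h : Writes r checkFormat) :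
    r ∈ [one, two, bad, hdr, n, m, c, s, t] := by
  simp only [checkFormat, seqs, Writes, writes_forInstance, writes_ifElse, reject] at h
  rcases h with h | h | h | ⟨g, h⟩ | (h | h) | (h | h) | h
  · simp [h]
  · simp [h]
  · simp [h]
  · have := writes_formatStep h
    revert this
    clear h
    revert r
    decide
  · exact h.elim
  · simp [h]
  · simp [h]
  · exact h.elim
  · exact h.elim

/-- The list `bs` contains the owners and adjacency lists of a one-player game, and `s'` and `t'`
are vertices of this game. -/
structure ValidDescription (s' t' : ℕ) (bs : List (Owner × List ℕ)) : Prop where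
  owner : ∀ d ∈ bs, d.1 ≠ .safety
  source : s' < bs.length
  target : t' < bs.length
  name : ∀ e ∈ edgeList 0 bs, e.2 < bs.length
  nodup : (edgeList 0 bs).Nodup

/-- Once the input is known to be a `render`, the checks are composed one by one. For equal source
and target the certificate is not inspected. -/
theorem verifier_spec {x : List GameSymbol} :
    eval (encodeInstanceCertificate (x, y)) verifier 0 bad = 0 ↔
      ∃ s' t' bs, x = render s' t' bs ∧ ValidDescription s' t' bs ∧
        (s' = t' ∨ ∀ v o, (bs.map Prod.fst)[v]? = some o →
          AcceptAt s' t' (edgeList 0 bs) y v o) := by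
  have key : ∀ s' t' bs, bs ≠ [] → (∀ d ∈ bs, d.1 ≠ .safety) → x = render s' t' bs →
      (eval (encodeInstanceCertificate (x, y)) verifier 0 bad = 0 ↔
        ValidDescription s' t' bs ∧ (s' = t' ∨ ∀ v o, (bs.map Prod.fst)[v]? = some o →
          AcceptAt s' t' (edgeList 0 bs) y v o)) := by
    rintro s' t' bs hne hbs rfl
    have h1 := checkFormat_render (y := y) (s' := s') (t' := t') hne hbs
    have hv0 : eval (encodeInstanceCertificate (render s' t' bs, y)) checkFormat 0 v0 = 0 :=
      eval_of_not_writes _ _ _ fun h => absurd (writes_checkFormat h) (by decide)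
    have hv1 : eval (encodeInstanceCertificate (render s' t' bs, y)) checkFormat 0 v1 = 0 :=
      eval_of_not_writes _ _ _ fun h => absurd (writes_checkFormat h) (by decide)
    simp only [verifier, seqs, eval]
    generalize eval (encodeInstanceCertificate (render s' t' bs, y)) checkFormat 0 = st at *
    rw [eval_ifElse, if_pos (by rw [h1.bad, h1.zero])]
    simp only [eval]
    have h2 := checkNames_spec (s' := s') (t' := t') (bs := bs) (y := y) h1.zero
    have hw2 : ∀ r ∉ [b, c, bad],
        eval (encodeInstanceCertificate (render s' t' bs, y)) checkNames st r = st r :=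
      fun r hr => eval_of_not_writes _ _ _ fun h => hr (writes_checkNames h)
    generalize eval (encodeInstanceCertificate (render s' t' bs, y)) checkNames st = st₁ at *
    have h3 := checkNodup_spec (s' := s') (t' := t') (bs := bs) (y := y) (st := st₁)
      (by rw [hw2 _ (by decide), h1.zero]) (by rw [hw2 _ (by decide), h1.one])
    have hw3 : ∀ r ∉ [b, c, b1, c1, cnt, bad],
        eval (encodeInstanceCertificate (render s' t' bs, y)) checkNodup st₁ r = st r := by
      intro r hr
      rw [eval_of_not_writes _ _ _ fun h => hr (writes_checkNodup h), hw2]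
      revert hr; clear h1 hv0 hv1 h2 hw2 h3; revert r; decide
    generalize eval (encodeInstanceCertificate (render s' t' bs, y)) checkNodup st₁ = st₂ at *
    rw [h2, h1.bad, h1.s, h1.t, h1.n] at h3
    have hvalid : st₂ bad = 0 ↔ ValidDescription s' t' bs := by
      rw [h3]
      exact ⟨fun ⟨⟨_, h4, h5, h6⟩, h7⟩ => ⟨hbs, h4, h5, h6, h7⟩,
        fun h => ⟨⟨rfl, h.source, h.target, h.name⟩, h.nodup⟩⟩
    rw [eval_ifElse, hw3 _ (by decide), hw3 _ (by decide), h1.s, h1.t]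
    split_ifs with hst
    · simp [eval, hvalid, hst]
    · simp only [eval, eval_forInstance]
      rw [foldl_flowStep, foldl_owners_spec (n' := bs.length) _ 0]
      · simp [hvalid, hst]
      · constructor <;> simp [hw3, h1.zero, h1.one, h1.two, h1.s, h1.t, h1.n, h1.m, hv0, hv1]
  constructor
  · intro h
    -- A format error skips all later checks, so `bad` would still be nonzero at the end.
    have hbad : eval (encodeInstanceCertificate (x, y)) checkFormat 0 bad = 0 := by
      by_contra h0
      simp only [verifier, seqs, eval] at h
      have hz : eval (encodeInstanceCertificate (x, y)) checkFormat 0 zero = 0 :=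
        eval_of_not_writes _ _ _ fun h => absurd (writes_checkFormat h) (by decide)
      rw [eval_ifElse, hz, if_neg h0] at h
      exact h0 h
    obtain ⟨s', t', bs, hne, hx, hbs⟩ := checkFormat_shape hbad
    exact ⟨s', t', bs, hx, (key s' t' bs hne hbs hx).1 h⟩
  · rintro ⟨s', t', bs, hx, h⟩
    refine (key s' t' bs ?_ h.1.owner hx).2 h
    rintro rfl
    exact absurd h.1.source (by simp)

end CounterProg

/-! ### Plays, their edge counts, and strategies -/

namespace SwitchingGame

variable {V : Type*} {G : SwitchingGame V}

theorem Follows.of_append {σ : List G.State → V} {p q : List G.State}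
    (h : G.Follows σ (p ++ q)) : G.Follows σ p := by
  intro i x y h1 h2 ho
  have hi := (List.getElem?_eq_some_iff.1 h2).1
  rw [h i x y (by rw [List.getElem?_append_left (by omega), h1])
    (by rw [List.getElem?_append_left hi, h2]) ho, List.take_append_of_le_length hi.le]

variable [DecidableEq V]

theorem Move.mem_edges {x y : G.State} (h : G.Move x y) : (x.1, y.1) ∈ G.edges := by
  cases h with
  | player hv ho he => exact he
  | switch hv hu => exact (G.mem_ord _ _).1 (List.mem_of_getElem? hu)

theorem Move.ne_target {x y : G.State} (h : G.Move x y) : x.1 ≠ G.target := by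
  cases h with
  | player hv ho he => exact hv
  | switch hv hu => exact hv

theorem isPlayPrefix_append_iff {p : List G.State} {x y : G.State} :
    G.IsPlayPrefix (p ++ [x] ++ [y]) ↔ G.IsPlayPrefix (p ++ [x]) ∧ G.Move x y := by
  rw [IsPlayPrefix, IsPlayPrefix, List.isChain_append (l₁ := p ++ [x])]
  cases p <;> simp [and_assoc, List.getLast?_cons]

theorem bal_add_single (F : G.edges → ℕ) (e : G.edges) (v : V) :
    G.bal (F + Pi.single e 1) v =
      G.bal F v + (if v = e.1.1 then 1 else 0) - if v = e.1.2 then 1 else 0 := by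
  have h : ∀ f : G.edges → V,
      ∑ e' : G.edges with f e' = v, ((F + Pi.single e 1 : G.edges → ℕ) e' : ℤ) =
      ∑ e' : G.edges with f e' = v, (F e' : ℤ) + if v = f e then 1 else 0 := by
    intro f
    simp only [Pi.add_apply, Nat.cast_add, Finset.sum_add_distrib, add_right_inj]
    rw [Finset.sum_filter, Finset.sum_eq_single e]
    · simp [eq_comm]
    · intro e' _ he'
      simp [he']
    · simp
  rw [bal, h fun e => e.1.1, h fun e => e.1.2, bal]
  ring

/-- The function `U` counts how often a play that has visited the states in `q` and is now in the
state `x` has used the edges, and `N` counts how often it has left the switching vertices. -/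
structure Trace (q : List G.State) (x : G.State) (U : G.edges → ℕ) (N : G.Switch → ℕ) : Prop where
  isPlayPrefix : G.IsPlayPrefix (q ++ [x])
  bal : ∀ v, G.bal U v = (if v = G.source then 1 else 0) - if v = x.1 then 1 else 0
  le_countP : ∀ e, U e ≤ q.countP fun y => y.1 = e.1.1
  state : ∀ v, x.2 v = N v % (G.ord v).length
  eq_zero : ∀ v, (G.ord v).length = 0 → N v = 0
  shape : ∀ (v : G.Switch) (j : ℕ) (e : G.edges), e.1.1 = v.1 → (G.ord v)[j]? = some e.1.2 →
    U e = N v / (G.ord v).length + if j < N v % (G.ord v).length then 1 else 0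

theorem trace_init : Trace [] G.init 0 0 where
  isPlayPrefix := by simp [IsPlayPrefix]
  bal v := by simp [SwitchingGame.bal, init]; exact (sub_self _).symm
  le_countP := by simp
  state := by simp [init]
  eq_zero := by simp
  shape := by simp

/-- The departure after `N` earlier ones uses position `N % k`. When the order wraps around, the
quotient rises and the residue drops to zero, and the staircase still changes at this position only.
-/
theorem _root_.Nat.succ_div_mod_shape {k N j : ℕ} (hj : j < k) :
    (N + 1) / k + (if j < (N + 1) % k then 1 else 0) =
      N / k + (if j < N % k then 1 else 0) + if j = N % k then 1 else 0 := by
  have hk : 0 < k := by omega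
  have h1 := Nat.mod_lt N hk
  rw [Nat.succ_div, Nat.add_mod]
  rcases Nat.lt_or_ge (N % k + 1) k with h | h
  · have h2 : ¬ k ∣ N + 1 := by
      intro h3
      have := Nat.mod_eq_zero_of_dvd h3
      rw [Nat.add_mod, Nat.mod_eq_of_lt (show 1 < k by omega), Nat.mod_eq_of_lt h] at this
      omega
    rw [if_neg h2, Nat.mod_eq_of_lt (show 1 < k by omega), Nat.mod_eq_of_lt h]
    split_ifs <;> omega
  · have h3 : N % k + 1 = k := by omega
    have h2 : k ∣ N + 1 := by
      refine Nat.dvd_of_mod_eq_zero ?_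
      rw [← Nat.mod_add_mod, h3, Nat.mod_self]
    have h4 : (N % k + 1 % k) % k = 0 := by rw [Nat.add_mod_mod, h3, Nat.mod_self]
    rw [if_pos h2, h4]
    split_ifs <;> omega

/-- Using the edge from `x` to `y` moves the sink of the unit flow from `x` to `y`. If a switching
vertex is left, its departure count grows by one, as do its position modulo the out-degree and the
corresponding step of the staircase. -/
theorem Trace.step {q : List G.State} {x y : G.State} {U : G.edges → ℕ} {N : G.Switch → ℕ}
    (h : Trace q x U N) (hxy : G.Move x y) (e : G.edges) (he : e.1 = (x.1, y.1)) :
    ∃ N', Trace (q ++ [x]) y (U + Pi.single e 1) N' := by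
  have he1 : e.1.1 = x.1 := by rw [he]
  have he2 : e.1.2 = y.1 := by rw [he]
  have hpre := isPlayPrefix_append_iff.2 ⟨h.isPlayPrefix, hxy⟩
  have hbal : ∀ v, G.bal (U + Pi.single e 1) v =
      (if v = G.source then 1 else 0) - if v = y.1 then 1 else 0 := by
    intro v
    rw [bal_add_single, h.bal, he1, he2]
    ring
  have hcount : ∀ e', (U + Pi.single e 1 : G.edges → ℕ) e' ≤
      (q ++ [x]).countP fun y => y.1 = e'.1.1 := by
    intro e'
    have := h.le_countP e'
    rw [List.countP_append, Pi.add_apply]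
    refine add_le_add this ?_
    by_cases hee : e' = e
    · subst hee; simp [he1]
    · simp [hee]
  cases hxy with
  | @player v u C hv ho hvu =>
    refine ⟨N, hpre, hbal, hcount, h.state, h.eq_zero, fun v' j e' h1 h2 => ?_⟩
    rw [Pi.add_apply, h.shape v' j e' h1 h2, Pi.single_eq_of_ne, add_zero]
    rintro rfl
    refine ho ?_
    rw [← show e'.1.1 = v from he1, h1]
    exact v'.2
  | @switch v u C hv hu =>
    simp only at he1 he2 hu
    have hlt := (List.getElem?_eq_some_iff.1 hu).1
    have hC : C v = N v % (G.ord v).length := h.state v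
    refine ⟨Function.update N v (N v + 1), hpre, hbal, hcount, fun v' => ?_,
      fun v' hv' => ?_, fun v' j e' h1 h2 => ?_⟩
    · by_cases hvv : v = v'
      · subst hvv
        simp [upd, hC]
      · have := h.state v'
        simp only at this
        simp [upd, hvv, Ne.symm hvv, this]
    · rw [Function.update_of_ne, h.eq_zero v' hv']
      rintro rfl
      omega
    · rw [Pi.add_apply, h.shape v' j e' h1 h2]
      by_cases hvv : v' = v
      · subst hvv
        have hj := (List.getElem?_eq_some_iff.1 h2).1
        rw [Function.update_self, Nat.succ_div_mod_shape hj, Pi.single_apply]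
        -- The switching order has no repetitions, so the edge at position `j` is the one just used
        -- exactly if `j` is the current position.
        congr 2
        rw [← hC, eq_iff_iff]
        constructor
        · rintro rfl
          refine (List.getElem_inj (h₀ := hj) (h₁ := hlt) (G.ord_nodup v')).1 ?_
          rw [List.getElem?_eq_some_iff] at h2 hu
          rw [h2.2, hu.2, he2]
        · rintro rfl
          rw [h2, Option.some_inj] at hu
          exact Subtype.ext (Prod.ext (h1.trans he1.symm) (hu.trans he2.symm))
      · rw [Function.update_of_ne hvv, Pi.single_eq_of_ne, add_zero]
        rintro rfl
        exact hvv (Subtype.ext (h1.symm.trans he1))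

theorem exists_trace {q : List G.State} : ∀ {x : G.State}, G.IsPlayPrefix (q ++ [x]) →
    ∃ U N, Trace q x U N := by
  induction q using List.reverseRecOn with
  | nil =>
    intro x h
    have : x = G.init := by simpa [IsPlayPrefix] using h.1
    subst this
    exact ⟨0, 0, trace_init⟩
  | append_singleton q y ih =>
    intro x h
    rw [isPlayPrefix_append_iff] at h
    obtain ⟨U, N, hU⟩ := ih h.1
    obtain ⟨N', hN'⟩ := hU.step h.2 ⟨_, h.2.mem_edges⟩ rfl
    exact ⟨_, N', hN'⟩

/-- In a reachable state the count is a residue modulo the length of the order, hence a valid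
position unless the vertex has no out-edge. -/
theorem exists_move_of_switching {q : List G.State} {x : G.State} (h : G.IsPlayPrefix (q ++ [x]))
    (ht : x.1 ≠ G.target) {u : V} (hu : (x.1, u) ∈ G.edges) (ho : G.owner x.1 = .switching) :
    ∃ y, G.Move x y := by
  obtain ⟨v, C⟩ := x
  obtain ⟨U, N, hU⟩ := exists_trace h
  have hmem := (G.mem_ord ⟨v, ho⟩ u).2 hu
  have hlt : C ⟨v, ho⟩ < (G.ord ⟨v, ho⟩).length := by
    rw [show C ⟨v, ho⟩ = _ from hU.state ⟨v, ho⟩]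
    exact Nat.mod_lt _ (List.length_pos_of_mem hmem)
  exact ⟨_, Move.switch (v := ⟨v, ho⟩) ht (List.getElem?_eq_getElem hlt)⟩

theorem _root_.List.exists_seq_of_forall_extension {α : Type*} {P : List α → Prop} {a : α}
    (h0 : P [a]) (h : ∀ p, P p → ∃ y, P (p ++ [y])) :
    ∃ π : ℕ → α, π 0 = a ∧ ∀ k, P ((List.range (k + 1)).map π) := by
  choose f hf using h
  let g : ℕ → {p // P p} := fun k =>
    Nat.rec ⟨[a], h0⟩ (fun _ p => ⟨p.1 ++ [f p.1 p.2], hf p.1 p.2⟩) k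
  have hg : ∀ k, (g (k + 1)).1 = (g k).1 ++ [f (g k).1 (g k).2] := fun k => rfl
  let π : ℕ → α := fun k => k.casesOn a fun k => f (g k).1 (g k).2
  refine ⟨π, rfl, fun k => ?_⟩
  have : (List.range (k + 1)).map π = (g k).1 := by
    induction k with
    | zero => rfl
    | succ k ih => rw [List.range_succ, List.map_append, ih, hg]; rfl
  rw [this]
  exact (g k).2

theorem Follows.append_singleton {σ : List G.State → V} {p : List G.State} {x y : G.State}
    (h : G.Follows σ (p ++ [x])) (hxy : G.owner x.1 = .reachability → y.1 = σ (p ++ [x])) :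
    G.Follows σ (p ++ [x] ++ [y]) := by
  intro i x' y' h1 h2 ho
  rcases Nat.lt_trichotomy (i + 1) (p ++ [x]).length with hi | hi | hi
  · rw [List.getElem?_append_left (by omega)] at h1
    rw [List.getElem?_append_left hi] at h2
    rw [List.take_append_of_le_length hi.le]
    exact h i x' y' h1 h2 ho
  · rw [hi, List.getElem?_append_right le_rfl] at h2
    rw [List.length_append, List.length_singleton, Nat.succ_inj] at hi
    subst hi
    simp at h1 h2
    subst h1 h2
    rw [List.take_append_of_le_length (by simp), List.take_of_length_le (by simp)]
    exact hxy ho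
  · have := (List.getElem?_eq_some_iff.1 h2).1
    simp at this hi
    omega

/-- If no play prefix reached the target, each prefix consistent with the winning strategy could be
prolonged: stopping at a dead end would be a lost finite play. Prolonging forever gives a consistent
infinite play, which is also excluded. -/
theorem ReachWins.exists_isPlayPrefix (hG : G.OnePlayer) (h : G.ReachWins) :
    ∃ q x, G.IsPlayPrefix (q ++ [x]) ∧ x.1 = G.target := by
  obtain ⟨σ, hσ, hfin, hinf⟩ := h
  by_contra! hnot
  obtain ⟨π, h0, hπ⟩ := List.exists_seq_of_forall_extension (a := G.init)
    (P := fun p => p ≠ [] ∧ G.IsPlayPrefix p ∧ G.Follows σ p)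
    ⟨by simp, trace_init.isPlayPrefix, fun i x y _ h2 => by simp at h2⟩ (by
      rintro p ⟨hp0, hp, hf⟩
      rcases p.eq_nil_or_concat with rfl | ⟨q, x, rfl⟩
      · exact absurd rfl hp0
      rw [List.concat_eq_append] at *
      have ht := hnot q x hp
      have hu : ∃ u, (x.1, u) ∈ G.edges := by
        by_contra! hu
        refine ht (hfin _ ⟨hp, fun x' hx' => .inr ?_⟩ hf x (by simp))
        simp at hx'
        subst hx'
        exact hu
      have hy : ∃ y, G.Move x y ∧ (G.owner x.1 = .reachability → y.1 = σ (q ++ [x])) := by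
        cases ho : G.owner x.1 with
        | safety => exact absurd ho (hG _)
        | reachability =>
          exact ⟨(σ (q ++ [x]), x.2), .player ht (by simp [ho]) (hσ _ hp x (by simp) ho ht hu),
            fun _ => rfl⟩
        | switching =>
          obtain ⟨u, hu⟩ := hu
          obtain ⟨y, hy⟩ := exists_move_of_switching hp ht hu ho
          exact ⟨y, hy, by simp⟩
      obtain ⟨y, hxy, hy⟩ := hy
      exact ⟨y, by simp, isPlayPrefix_append_iff.2 ⟨hp, hxy⟩, hf.append_singleton hy⟩)
  refine hinf π ⟨h0, fun i => ?_⟩ fun k => ?_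
  · have := (hπ (i + 1)).2.1
    rw [List.range_succ, List.map_append, List.range_succ, List.map_append] at this
    exact (isPlayPrefix_append_iff.1 this).2
  · have := (hπ k).2.2
    rw [List.range_succ, List.map_append] at this
    exact this.of_append

theorem Move.of_switching {x y : G.State} (h : G.Move x y) {v : G.Switch} (hv : x.1 = v.1) :
    (G.ord v)[x.2 v]? = some y.1 ∧ y.2 = G.upd x.2 v := by
  cases h with
  | player _ ho _ => exact absurd ((congrArg G.owner hv).trans v.2) ho
  | @switch v' u C _ hu =>
    obtain rfl : v' = v := Subtype.ext hv
    exact ⟨hu, rfl⟩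

theorem Move.of_not_switching {x y : G.State} (h : G.Move x y)
    (ho : G.owner x.1 ≠ .switching) : y.2 = x.2 := by
  cases h with
  | player => rfl
  | @switch v => exact absurd v.2 ho

/-- Without safety vertices the successor is determined as soon as the choice of the reachability
player is. -/
theorem Move.eq_of_eq (hG : G.OnePlayer) {x y y' : G.State} (h : G.Move x y) (h' : G.Move x y')
    (hy : G.owner x.1 = .reachability → y.1 = y'.1) : y = y' := by
  cases ho : G.owner x.1 with
  | safety => exact absurd ho (hG _)
  | reachability =>
    refine Prod.ext (hy ho) ?_
    rw [h.of_not_switching (by simp [ho]), h'.of_not_switching (by simp [ho])]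
  | switching =>
    obtain ⟨h1, h2⟩ := h.of_switching (v := ⟨x.1, ho⟩) rfl
    obtain ⟨h3, h4⟩ := h'.of_switching (v := ⟨x.1, ho⟩) rfl
    exact Prod.ext (Option.some_inj.1 (h1.symm.trans h3)) (h2.trans h4.symm)

/-- The strategy replays the given play. By determinism every consistent prefix is a prefix of that
play, so a consistent play can end only at the target and cannot be longer. -/
theorem reachWins_of_isPlayPrefix (hG : G.OnePlayer) {q : List G.State} {x : G.State}
    (hp : G.IsPlayPrefix (q ++ [x])) (hx : x.1 = G.target) : G.ReachWins := by
  classical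
  -- Off the given play any outgoing edge is chosen, merely to make `σ` a legal strategy; the last
  -- value is a dummy.
  let σ : List G.State → V := fun p =>
    if h : ∃ y, p ++ [y] <+: q ++ [x] then h.choose.1
    else if h : ∃ u, ∃ z ∈ p.getLast?, (z.1, u) ∈ G.edges then h.choose
    else G.target
  have hσ : ∀ p y, p ++ [y] <+: q ++ [x] → σ p = y.1 := by
    intro p y h
    have h1 : ∃ y, p ++ [y] <+: q ++ [x] := ⟨y, h⟩
    have h2 := List.prefix_of_prefix_length_le h1.choose_spec h (by simp)
    have h3 := h2.eq_of_length (by simp)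
    simp only [σ, dif_pos h1]
    rw [(List.append_cancel_left_eq _ _ _ ▸ h3 : [h1.choose] = [y]) |> List.singleton_inj.1]
  have hmove : ∀ p y z, p ++ [z] ++ [y] <+: q ++ [x] → G.Move z y := by
    rintro p y z ⟨r, hr⟩
    rw [← hr] at hp
    have : G.IsPlayPrefix (p ++ [z] ++ [y]) := by
      refine ⟨?_, (List.isChain_append.1 hp.2).1⟩
      have := hp.1
      cases p <;> simpa using this
    exact (isPlayPrefix_append_iff.1 this).2
  have hnext : ∀ p z, p ++ [z] <+: q ++ [x] → z.1 ≠ G.target →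
      ∃ y, p ++ [z] ++ [y] <+: q ++ [x] := by
    rintro p z ⟨r, hr⟩ hz
    cases r with
    | nil =>
      rw [List.append_nil] at hr
      have := (List.append_inj' hr rfl).2
      simp at this
      exact absurd (this ▸ hx) hz
    | cons y r => exact ⟨y, r, by rw [← hr]; simp⟩
  have hfollow : ∀ p z, G.IsPlayPrefix (p ++ [z]) → G.Follows σ (p ++ [z]) →
      p ++ [z] <+: q ++ [x] := by
    intro p
    induction p using List.reverseRecOn with
    | nil =>
      intro z hz _
      have h1 := hz.1
      have h2 := hp.1
      cases q with
      | nil => simp at h1 h2; simp [h1, h2]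
      | cons a q => simp at h1 h2; simp [h1, h2]
    | append_singleton p z ih =>
      intro y hy hf
      have h1 := isPlayPrefix_append_iff.1 hy
      have h2 := ih z h1.1 hf.of_append
      obtain ⟨y', hy'⟩ := hnext p z h2 h1.2.ne_target
      have h3 : y = y' := by
        refine h1.2.eq_of_eq hG (hmove _ _ _ hy') fun ho => ?_
        have := hf p.length z y (by simp) (by simp) ho
        rw [this, ← hσ _ _ hy']
        congr 1
        rw [List.append_assoc, List.take_append]
        simp
      rw [h3]
      exact hy'
  refine ⟨σ, ?_, ?_, ?_⟩
  · intro p _ z hz _ _ he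
    by_cases h : ∃ y, p ++ [y] <+: q ++ [x]
    · obtain ⟨y, hy⟩ := h
      rw [hσ p y hy]
      rw [Option.mem_def, List.getLast?_eq_some_iff] at hz
      obtain ⟨p', rfl⟩ := hz
      exact (hmove _ _ _ hy).mem_edges
    · have h2 : ∃ u, ∃ z ∈ p.getLast?, (z.1, u) ∈ G.edges := he.imp fun u hu => ⟨z, hz, hu⟩
      simp only [σ, dif_neg h, dif_pos h2]
      obtain ⟨z', hz', h3⟩ := h2.choose_spec
      rwa [Option.mem_unique hz' hz] at h3
  · rintro p hpf hf z hz
    have hz' := hz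
    rw [Option.mem_def, List.getLast?_eq_some_iff] at hz'
    obtain ⟨p', rfl⟩ := hz'
    rcases hpf.2 z hz with h | h
    · exact h
    · by_contra hzt
      obtain ⟨y, hy⟩ := hnext _ _ (hfollow _ _ hpf.1 hf) hzt
      exact h _ (hmove _ _ _ hy).mem_edges
  · intro π hπ hf
    have hpre : ∀ k, G.IsPlayPrefix ((List.range (k + 1)).map π) := by
      intro k
      induction k with
      | zero => simp [IsPlayPrefix, hπ.1]
      | succ k ih =>
        rw [List.range_succ, List.map_append, List.range_succ, List.map_append] at *
        exact isPlayPrefix_append_iff.2 ⟨by simpa using ih, hπ.2 k⟩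
    -- A consistent prefix with one state more than the given play would have to be a prefix of it.
    have h1 := hpre (q ++ [x]).length
    have h2 := hf ((q ++ [x]).length + 1)
    rw [List.range_succ, List.map_append] at h1 h2
    have := (hfollow _ _ h1 h2).length_le
    simp at this

theorem reachWins_of_source_eq_target (hG : G.OnePlayer) (h : G.source = G.target) : G.ReachWins :=
  reachWins_of_isPlayPrefix hG trace_init.isPlayPrefix h

end SwitchingGame

/-! ### From flows to plays and back, with the bound n^n -/

namespace SwitchingGame

variable {V : Type*} [DecidableEq V] {G : SwitchingGame V}

/-- If all out-edges of the current vertex were saturated, `U ≤ F` on the in-edges would make the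
balance of `U` at least that of `F`. But away from the target it is smaller by one, since the token
has arrived there and not yet left. -/
theorem Trace.exists_lt_of_flow {q : List G.State} {x : G.State} {U F : G.edges → ℕ}
    {N : G.Switch → ℕ} (h : Trace q x U N) (hF : G.IsControlledSwitchingFlow F) (hle : U ≤ F)
    (hx : x.1 ≠ G.target) : ∃ e : G.edges, e.1.1 = x.1 ∧ U e < F e := by
  by_contra! hnot
  have h1 : ∑ e : G.edges with e.1.1 = x.1, (U e : ℤ) = ∑ e : G.edges with e.1.1 = x.1, (F e : ℤ) :=
    Finset.sum_congr rfl fun e he => by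
      rw [le_antisymm (hle e) (hnot e (Finset.mem_filter.1 he).2)]
  have h2 : ∑ e : G.edges with e.1.2 = x.1, (U e : ℤ) ≤ ∑ e : G.edges with e.1.2 = x.1, (F e : ℤ) :=
    Finset.sum_le_sum fun e _ => by exact_mod_cast hle e
  have h3 := h.bal x.1
  have h4 : G.bal F x.1 = if x.1 = G.source then 1 else 0 := by
    split_ifs with hs
    · rw [hs, hF.bal_source]
    · exact hF.bal_other _ hs hx
  rw [SwitchingGame.bal] at h3 h4
  rw [if_pos rfl] at h3
  linarith

theorem Trace.exists_move_of_flow {q : List G.State} {x : G.State} {U F : G.edges → ℕ}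
    {N : G.Switch → ℕ} (h : Trace q x U N) (hF : G.IsControlledSwitchingFlow F) (hle : U ≤ F)
    (hx : x.1 ≠ G.target) :
    ∃ y, G.Move x y ∧ ∃ e : G.edges, e.1 = (x.1, y.1) ∧ U e < F e := by
  obtain ⟨e, he, hlt⟩ := h.exists_lt_of_flow hF hle hx
  obtain ⟨v, C⟩ := x
  simp only at he hx
  by_cases ho : G.owner v = .switching
  · obtain ⟨c, i, hi, hF⟩ := hF.switching ⟨v, ho⟩
    have hmem : e.1.2 ∈ G.ord ⟨v, ho⟩ := (G.mem_ord _ _).2 (by subst he; exact e.2)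
    obtain ⟨j, hj, hje⟩ := List.getElem_of_mem hmem
    have hje' := List.getElem?_eq_some_iff.2 ⟨hj, hje⟩
    have hC : C ⟨v, ho⟩ = _ := h.state ⟨v, ho⟩
    have hClt : C ⟨v, ho⟩ < (G.ord ⟨v, ho⟩).length := hC ▸ Nat.mod_lt _ (by omega)
    have hu := List.getElem?_eq_getElem hClt
    refine ⟨_, .switch (v := ⟨v, ho⟩) hx hu,
      ⟨⟨_, (G.mem_ord _ _).1 (List.getElem_mem hClt)⟩, rfl, ?_⟩⟩
    -- Compare the staircases `N / k` plus a step at `N % k` and `c` plus a step at `i`. An edge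
    -- with room gives `N / k ≤ c`, and in case of equality its position lies in `[N % k, i)`.
    -- Either way position `N % k` has room.
    rw [h.shape ⟨v, ho⟩ j e he hje', hF j e he hje'] at hlt
    rw [h.shape ⟨v, ho⟩ _ _ rfl hu, hF _ _ rfl hu]
    rw [← hC] at hlt ⊢
    split_ifs at hlt ⊢ <;> omega
  · exact ⟨(e.1.2, C), .player hx ho (by rw [← he]; exact e.2), e, by rw [← he], hlt⟩

/-- Induction on the unused flow: each move consumes one unit of it, so a play that stays below `F`
must reach the target. -/
theorem IsControlledSwitchingFlow.exists_isPlayPrefix {F : G.edges → ℕ}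
    (hF : G.IsControlledSwitchingFlow F) :
    ∃ q x, G.IsPlayPrefix (q ++ [x]) ∧ x.1 = G.target := by
  by_contra! hnot
  have key : ∀ (k : ℕ) (q : List G.State) (x : G.State) (U : G.edges → ℕ) (N : G.Switch → ℕ),
      Trace q x U N → U ≤ F → ∑ e, F e = ∑ e, U e + k → False := by
    intro k
    induction k using Nat.strong_induction_on with
    | _ k ih =>
      intro q x U N h hle hk
      obtain ⟨y, hxy, e, he, hlt⟩ := h.exists_move_of_flow hF hle (hnot q x h.isPlayPrefix)
      obtain ⟨N', h'⟩ := h.step hxy e he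
      have hle' : U + Pi.single e 1 ≤ F := by
        intro e'
        by_cases hee : e' = e
        · subst hee; simpa using hlt
        · simpa [hee] using hle e'
      have hsum : ∑ e', (U + Pi.single e 1 : G.edges → ℕ) e' = ∑ e', U e' + 1 := by
        simp [Finset.sum_add_distrib]
      have hle'' : ∑ e', (U + Pi.single e 1 : G.edges → ℕ) e' ≤ ∑ e', F e' :=
        Finset.sum_le_sum fun e' _ => hle' e'
      exact ih (k - 1) (by omega) _ _ _ _ h' hle' (by omega)
  exact key (∑ e, F e) [] _ 0 0 trace_init (fun _ => Nat.zero_le _) (by simp)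

/-- Loop erasure: when the new last state has occurred before, cut back to that occurrence. -/
theorem _root_.List.exists_nodup_isChain {α : Type*} {r : α → α → Prop} :
    ∀ {p : List α} {a b : α}, p.head? = some a → p.getLast? = some b → p.IsChain r →
      ∃ q : List α, (q ++ [b]).head? = some a ∧ (q ++ [b]).IsChain r ∧ (q ++ [b]).Nodup := by
  intro p
  induction p using List.reverseRecOn with
  | nil => simp
  | append_singleton p y ih =>
    intro a b h1 h2 h3
    obtain rfl : y = b := by simpa using h2
    rcases p.eq_nil_or_concat with rfl | ⟨p', x, rfl⟩
    · exact ⟨[], h1, by simp, by simp⟩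
    rw [List.concat_eq_append] at *
    rw [List.isChain_append] at h3
    obtain ⟨q, h4, h5, h6⟩ := ih (a := a) (b := x) (by cases p' <;> simpa using h1) (by simp) h3.1
    by_cases hy : y ∈ q ++ [x]
    · obtain ⟨q', r, hq⟩ := List.append_of_mem hy
      rw [hq, List.append_cons] at h4 h5 h6
      refine ⟨q', ?_, (List.isChain_append.1 h5).1, (List.nodup_append.1 h6).1⟩
      cases q' <;> simpa using h4
    · refine ⟨q ++ [x], ?_, List.isChain_append.2 ⟨h5, by simp, ?_⟩, ?_⟩
      · cases q <;> simpa using h4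
      · simpa using h3.2.2
      · rw [List.nodup_append]
        exact ⟨h6, by simp, fun z hz w hw => by simp at hw; rintro rfl; exact hy (hw ▸ hz)⟩

/-- Distinct states at the same vertex differ in their counts. Each count is below n: it is a
residue modulo the out-degree, which is at most n, or it is zero if the order is empty. -/
theorem countP_le_pow [Fintype V] {p : List G.State} (hp : G.IsPlayPrefix p) (hnodup : p.Nodup)
    (v : V) : p.countP (fun y => y.1 = v) ≤ Fintype.card V ^ Fintype.card V := by
  have hn : 0 < Fintype.card V := Fintype.card_pos_iff.2 ⟨v⟩
  have hlt : ∀ x ∈ p, ∀ w : G.Switch, x.2 w < Fintype.card V := by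
    intro x hx w
    obtain ⟨q, r, rfl⟩ := List.append_of_mem hx
    rw [List.append_cons] at hp
    have hq : G.IsPlayPrefix (q ++ [x]) := by
      refine ⟨?_, (List.isChain_append.1 hp.2).1⟩
      have := hp.1
      cases q <;> simpa using this
    obtain ⟨U, N, hU⟩ := exists_trace hq
    rw [hU.state]
    rcases Nat.eq_zero_or_pos (G.ord w).length with h0 | h0
    · rw [hU.eq_zero w h0, Nat.zero_mod]
      exact hn
    · exact (Nat.mod_lt _ h0).trans_le (G.ord_nodup w).length_le_card
  classical
  have hnd : ((p.filter fun y => y.1 = v).map Prod.snd).Nodup := by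
    refine (hnodup.filter _).map_on fun y hy z hz hyz => ?_
    have h1 := (List.mem_filter.1 hy).2
    have h2 := (List.mem_filter.1 hz).2
    simp only [decide_eq_true_eq] at h1 h2
    exact Prod.ext (h1.trans h2.symm) hyz
  rw [List.countP_eq_length_filter, ← List.length_map (f := Prod.snd),
    ← List.toFinset_card_of_nodup hnd]
  calc _ ≤ (Fintype.piFinset fun _ : G.Switch => Finset.range (Fintype.card V)).card := by
        refine Finset.card_le_card fun C hC => ?_
        simp only [List.mem_toFinset, List.mem_map, List.mem_filter] at hC
        obtain ⟨y, hy, rfl⟩ := hC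
        simpa using hlt y hy.1
    _ = Fintype.card V ^ Fintype.card G.Switch := by simp
    _ ≤ _ := Nat.pow_le_pow_right hn (Fintype.card_subtype_le _)

theorem reachWins_iff_flow [Fintype V] (hG : G.OnePlayer) (hst : G.source ≠ G.target) :
    G.ReachWins ↔ ∃ F : G.edges → ℕ, G.IsControlledSwitchingFlow F ∧
      ∀ e, F e ≤ Fintype.card V ^ Fintype.card V := by
  constructor
  · intro h
    obtain ⟨q, x, hp, hx⟩ := h.exists_isPlayPrefix hG
    -- Being a play prefix depends only on consecutive states, so the loop-erased sequence is again
    -- one, and its edge counts are the flow.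
    obtain ⟨q, h1, h2, h3⟩ := List.exists_nodup_isChain (b := x) hp.1 (by simp) hp.2
    obtain ⟨U, N, hU⟩ := exists_trace ⟨h1, h2⟩
    refine ⟨U, ⟨?_, ?_, ?_, fun v =>
      ⟨N v / (G.ord v).length, N v % (G.ord v).length, ?_, ?_⟩⟩, fun e => ?_⟩
    · rw [hU.bal, hx, if_pos rfl, if_neg hst]; rfl
    · rw [hU.bal, hx, if_pos rfl, if_neg hst.symm]; rfl
    · intro v hvs hvt
      rw [hU.bal, hx, if_neg hvs, if_neg hvt]; rfl
    · rcases Nat.eq_zero_or_pos (G.ord v).length with h0 | h0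
      · rw [hU.eq_zero v h0, Nat.zero_mod]
        exact Nat.zero_le _
      · exact (Nat.mod_lt _ h0).le
    · intro j e he hj
      rw [hU.shape v j e he hj]
      split_ifs <;> rfl
    · refine ((hU.le_countP e).trans ?_).trans (countP_le_pow ⟨h1, h2⟩ h3 e.1.1)
      rw [List.countP_append]
      omega
  · rintro ⟨F, hF, -⟩
    obtain ⟨q, x, hp, hx⟩ := hF.exists_isPlayPrefix
    exact reachWins_of_isPlayPrefix hG hp hx

end SwitchingGame

/-! ### Encoding flows by certificates -/

namespace CounterProg

/-- The total flow of `F` on edges of `l` that start at `v`. -/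
def outSum (v : ℕ) (F : ℕ × ℕ → ℕ) (l : List (ℕ × ℕ)) : ℕ :=
  (l.map fun e => F e * if e.1 = v then 1 else 0).sum

/-- The total flow of `F` on edges of `l` that end at `v`. -/
def inSum (v : ℕ) (F : ℕ × ℕ → ℕ) (l : List (ℕ × ℕ)) : ℕ :=
  (l.map fun e => F e * if e.2 = v then 1 else 0).sum

/-- The conditions that a controlled switching flow satisfies at the vertex `v`. -/
structure FlowAt (s' t' : ℕ) (l : List (ℕ × ℕ)) (F : ℕ × ℕ → ℕ) (v : ℕ) (o : Owner) : Prop where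
  balance : (outSum v F l : ℤ) - inSum v F l =
    (if s' = v then 1 else 0) - if t' = v then 1 else 0
  switching : o = .switching → ∃ c i, ∀ (j : ℕ) (e : ℕ × ℕ),
    (l.filter fun e => e.1 = v)[j]? = some e → F e = if j < i then c + 1 else c

/-- The flow that is given by the bits in a list of slices. -/
def sliceFlow (gs : List (ℕ × ℕ → Bool)) (e : ℕ × ℕ) : ℕ :=
  gs.foldr (fun g a => (g e).toNat + 2 * a) 0

theorem outSum_add (v : ℕ) (F F' : ℕ × ℕ → ℕ) (l : List (ℕ × ℕ)) :
    outSum v (fun e => F e + F' e) l = outSum v F l + outSum v F' l := by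
  simp only [outSum, add_mul, List.sum_map_add]

theorem inSum_add (v : ℕ) (F F' : ℕ × ℕ → ℕ) (l : List (ℕ × ℕ)) :
    inSum v (fun e => F e + F' e) l = inSum v F l + inSum v F' l := by
  simp only [inSum, add_mul, List.sum_map_add]

theorem sliceValue_eq (v : ℕ) (l : List (ℕ × ℕ)) (gs : List (ℕ × ℕ → Bool)) :
    sliceValue v l gs = outSum v (sliceFlow gs) l - inSum v (sliceFlow gs) l := by
  induction gs with
  | nil => simp [sliceValue, outSum, inSum, sliceFlow]
  | cons g gs ih =>
    have h : sliceFlow (g :: gs) = fun e => (g e).toNat + (sliceFlow gs e + sliceFlow gs e) := by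
      funext e
      simp only [sliceFlow, List.foldr_cons]
      ring
    rw [sliceValue, ih, h, outSum_add, inSum_add, outSum_add, inSum_add]
    simp only [outCount, inCount, outSum, inSum]
    push_cast
    ring

theorem _root_.List.exists_decide_lt_of_isChain :
    ∀ {βs : List Bool}, βs.IsChain (fun β β' => β' = true → β = true) →
      ∃ i : ℕ, ∀ j β, βs[j]? = some β → β = decide (j < i)
  | [], _ => ⟨0, by simp⟩
  | false :: βs, h => by
    refine ⟨0, fun j β hj => ?_⟩
    have hall : ∀ (βs : List Bool) (_ : (false :: βs).IsChain fun β β' => β' = true → β = true),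
        ∀ β ∈ false :: βs, β = false := by
      intro βs
      induction βs with
      | nil => simp
      | cons β βs ih =>
        intro h
        rw [List.isChain_cons_cons] at h
        have : β = false := by simpa using h.1
        subst this
        simpa using ih h.2
    simpa using hall βs h β (List.mem_of_getElem? hj)
  | true :: βs, h => by
    obtain ⟨i, hi⟩ := exists_decide_lt_of_isChain h.of_cons
    refine ⟨i + 1, fun j β hj => ?_⟩
    cases j with
    | zero => simpa using hj.symm
    | succ j => simpa using hi j β (by simpa using hj)

theorem _root_.List.isChain_decide_lt {α : Type*} {L : List α} {g : α → Bool} {i : ℕ}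
    (h : ∀ j e, L[j]? = some e → g e = decide (j < i)) :
    (L.map g).IsChain fun β β' => β' = true → β = true := by
  rw [List.isChain_iff_getElem]
  intro j hj
  simp only [List.length_map] at hj
  rw [List.getElem_map, List.getElem_map, h j _ (List.getElem?_eq_getElem (by omega)),
    h (j + 1) _ (List.getElem?_eq_getElem (by omega)), decide_eq_true_eq, decide_eq_true_eq]
  omega

theorem _root_.List.isChain_eq_iff {βs : List Bool} :
    βs.IsChain (fun β β' => β = β') ↔ ∃ β, ∀ β' ∈ βs, β' = β := by
  induction βs with
  | nil => simp
  | cons β βs ih =>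
    cases βs with
    | nil => simp
    | cons β' βs =>
      rw [List.isChain_cons_cons, ih]
      constructor
      · rintro ⟨rfl, γ, h⟩
        exact ⟨γ, by simpa using h⟩
      · rintro ⟨γ, h⟩
        rw [List.forall_mem_cons] at h
        exact ⟨h.1.trans (h.2 β' (by simp)).symm, γ, h.2⟩

/-- The initial accumulator values supply the source and target terms, so acceptance is conservation
of the flow encoded by the slices, together with the bit patterns at switching vertices. -/
theorem flowAt_iff {s' t' v : ℕ} {o : Owner} {l : List (ℕ × ℕ)} (hl : l ≠ [])
    (g₀ : ℕ × ℕ → Bool) (gs : List (ℕ × ℕ → Bool)) :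
    AcceptAt s' t' l (l.map g₀ ++ gs.flatMap fun g => l.map g) v o ↔
      (o = .switching → BitsOK 0 0 (outBits v g₀ l) ∧ ∀ g ∈ gs, BitsOK 1 0 (outBits v g l)) ∧
      (outSum v (fun e => (g₀ e).toNat + sliceFlow gs e) l : ℤ) -
        inSum v (fun e => (g₀ e).toNat + sliceFlow gs e) l =
        (if s' = v then 1 else 0) - if t' = v then 1 else 0 := by
  obtain ⟨a, h1, h2, h3⟩ := foldl_step_certificate v o hl g₀ gs (if t' = v then 1 else 0)
    (if s' = v then 1 else 0) 0
  rw [AcceptAt, h1]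
  simp only [exists_eq_left', h2, true_and, h3, outSum_add, inSum_add, sliceValue_eq]
  refine and_congr_right fun _ => ?_
  simp only [outCount, inCount, outSum, inSum]
  push_cast
  constructor <;> intro h <;> linarith

/-- Soundness of certificates: the flow is read off from the slices. A chain of decreasing bits is a
block of ones followed by zeros, which gives `i`. Digits constant on the out-edges give the common
value `c`. -/
theorem exists_flow_of_acceptAt {s' t' : ℕ} {l : List (ℕ × ℕ)} (hl : l.Nodup) {y : List Bool}
    {os : List Owner} (hst : s' ≠ t') (hs : s' < os.length)
    (h : ∀ v o, os[v]? = some o → AcceptAt s' t' l y v o) :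
    ∃ F, ∀ v o, os[v]? = some o → FlowAt s' t' l F v o := by
  have hsrc := h s' _ (List.getElem?_eq_getElem hs)
  -- With an empty certificate the accumulators at the source would keep their initial values 0 and
  -- 1. Hence there is a first slice to split off.
  have hy : y ≠ [] := by
    rintro rfl
    simp [AcceptAt, hst.symm] at hsrc
  have hq : y.length % l.length = 0 := by
    obtain ⟨a, ha, h1, -⟩ := hsrc
    rw [← h1, ← ha, foldl_step_q _ _ _ _ _ (Nat.zero_mod _), Nat.zero_add]
  obtain ⟨J, hJ⟩ := Nat.dvd_of_mod_eq_zero hq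
  have hl0 : l ≠ [] := by
    rintro rfl
    simp at hJ
    exact hy hJ
  obtain ⟨gs, -, hgs⟩ := exists_slices hl J y (by rw [hJ, mul_comm])
  cases gs with
  | nil => exact absurd hgs hy
  | cons g₀ gs =>
    rw [List.flatMap_cons] at hgs
    subst hgs
    refine ⟨fun e => (g₀ e).toNat + sliceFlow gs e, fun v o hv => ?_⟩
    obtain ⟨h1, h2⟩ := (flowAt_iff hl0 g₀ gs).1 (h v o hv)
    refine ⟨h2, fun ho => ?_⟩
    obtain ⟨h3, h4⟩ := h1 ho
    obtain ⟨i, hi⟩ := List.exists_decide_lt_of_isChain (bitsOK_zero.1 h3)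
    have hc : ∃ c, ∀ e ∈ l.filter fun e => e.1 = v, sliceFlow gs e = c := by
      clear h hi h1 h2 h3 hy hq hJ hsrc
      induction gs with
      | nil => exact ⟨0, fun _ _ => rfl⟩
      | cons g gs ih =>
        rw [List.forall_mem_cons] at h4
        obtain ⟨c, hc⟩ := ih h4.2
        obtain ⟨β, hβ⟩ := List.isChain_eq_iff.1 (bitsOK_one.1 h4.1)
        refine ⟨β.toNat + 2 * c, fun e he => ?_⟩
        have := hc e he
        rw [sliceFlow, List.foldr_cons, hβ (g e) (List.mem_map_of_mem he), ← this]
        rfl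
    obtain ⟨c, hc⟩ := hc
    refine ⟨c, i, fun j e he => ?_⟩
    rw [hc e (List.mem_of_getElem? he), hi j (g₀ e) (by rw [outBits, List.getElem?_map, he]; rfl)]
    by_cases hj : j < i <;> simp [hj, add_comm]

/-- Slices run from the lowest digit upwards, so dropping the first one corresponds to halving `b`.
-/
theorem sliceFlow_testBit (K : ℕ) : ∀ (b : ℕ × ℕ → ℕ) (e : ℕ × ℕ), b e < 2 ^ K →
    sliceFlow ((List.range K).map fun j e => (b e).testBit j) e = b e := by
  induction K with
  | zero => intro b e h; simp at h; simp [sliceFlow, h]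
  | succ K ih =>
    intro b e h
    have h1 := ih (fun e => b e / 2) e (by rw [pow_succ] at h; omega)
    rw [List.range_succ_eq_map, List.map_cons, List.map_map, sliceFlow, List.foldr_cons]
    have h2 : ((fun (j : ℕ) (e : ℕ × ℕ) => (b e).testBit j) ∘ Nat.succ) =
        fun j e => (b e / 2).testBit j := by
      funext j e
      simp [Nat.testBit_succ]
    rw [h2]
    simp only [sliceFlow] at h1
    rw [h1]
    have h3 : ((b e).testBit 0).toNat = b e % 2 := by
      rw [Nat.testBit_zero]
      rcases Nat.mod_two_eq_zero_or_one (b e) with h | h <;> simp [h]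
    rw [h3]
    omega

theorem exists_acceptAt_of_flow {s' t' K : ℕ} {l : List (ℕ × ℕ)} {F : ℕ × ℕ → ℕ}
    {os : List Owner} (hst : s' ≠ t') (hs : s' < os.length)
    (hF : ∀ v o, os[v]? = some o → FlowAt s' t' l F v o) (hK : ∀ e ∈ l, F e < 2 ^ K) :
    ∃ y, y.length = (K + 1) * l.length ∧ ∀ v o, os[v]? = some o → AcceptAt s' t' l y v o := by
  have hl : l ≠ [] := by
    rintro rfl
    have := (hF s' _ (List.getElem?_eq_getElem hs)).balance
    simp [outSum, inSum, hst.symm] at this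
  have hc : ∀ v, ∃ c i, os[v]? = some .switching → ∀ (j : ℕ) (e : ℕ × ℕ),
      (l.filter fun e => e.1 = v)[j]? = some e → F e = if j < i then c + 1 else c := by
    intro v
    by_cases hv : os[v]? = some .switching
    · obtain ⟨c, i, h⟩ := (hF v _ hv).switching rfl
      exact ⟨c, i, fun _ => h⟩
    · exact ⟨0, 0, fun h => absurd h hv⟩
  choose c i hc using hc
  -- The base value is the common `c` on out-edges of switching vertices and the flow itself
  -- elsewhere. The bit `g₀` adds the possible excess of one.
  let b : ℕ × ℕ → ℕ := fun e => if os[e.1]? = some .switching then c e.1 else F e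
  let g₀ : ℕ × ℕ → Bool := fun e => decide (b e < F e)
  have hb : ∀ e ∈ l, b e ≤ F e ∧ F e ≤ b e + 1 := by
    intro e he
    simp only [b]
    split_ifs with h
    · obtain ⟨j, hj, hje⟩ := List.getElem_of_mem (List.mem_filter.2 ⟨he, decide_eq_true rfl⟩ :
        e ∈ l.filter fun e' => e'.1 = e.1)
      have := hc e.1 h j e (List.getElem?_eq_some_iff.2 ⟨hj, hje⟩)
      split_ifs at this <;> omega
    · omega
  let gs := (List.range K).map fun j e => (b e).testBit j
  have hF' : ∀ e ∈ l, (g₀ e).toNat + sliceFlow gs e = F e := by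
    intro e he
    have h1 := hb e he
    rw [sliceFlow_testBit K b e (h1.1.trans_lt (hK e he))]
    by_cases h2 : b e < F e <;> simp [g₀, h2] <;> omega
  refine ⟨l.map g₀ ++ gs.flatMap fun g => l.map g, ?_, fun v o hv => ?_⟩
  · simp [gs, List.length_flatMap, Function.comp_def, add_mul, add_comm]
  · rw [flowAt_iff hl]
    refine ⟨?_, ?_⟩
    · rintro rfl
      have hbv : ∀ e ∈ l.filter fun e => e.1 = v, b e = c v := by
        intro e he
        have := of_decide_eq_true (List.mem_filter.1 he).2
        simp [b, this, hv]
      constructor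
      · refine bitsOK_zero.2 (List.isChain_decide_lt (i := i v) fun j e he => ?_)
        have h1 := hc v hv j e he
        have h2 := hbv e (List.mem_of_getElem? he)
        simp only [g₀, h2, h1]
        by_cases hj : j < i v <;> simp [hj]
      · intro g hg
        obtain ⟨j, -, rfl⟩ := List.mem_map.1 hg
        refine bitsOK_one.2 (List.isChain_eq_iff.2 ⟨(c v).testBit j, fun β hβ => ?_⟩)
        obtain ⟨e, he, rfl⟩ := List.mem_map.1 hβ
        rw [hbv e he]
    · rw [← (hF v o hv).balance]
      have hout : outSum v (fun e => (g₀ e).toNat + sliceFlow gs e) l = outSum v F l :=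
        congrArg List.sum (List.map_congr_left fun e he => by dsimp only; rw [hF' e he])
      have hin : inSum v (fun e => (g₀ e).toNat + sliceFlow gs e) l = inSum v F l :=
        congrArg List.sum (List.map_congr_left fun e he => by dsimp only; rw [hF' e he])
      rw [hout, hin]

end CounterProg

/-! ### Games and their descriptions -/

theorem edgeList_map_finRange {n : ℕ} : ∀ (k : ℕ) (f : Fin n → Owner × List ℕ),
    edgeList k ((List.finRange n).map f) =
      (List.finRange n).flatMap fun v => (f v).2.map (k + v.val, ·) := by
  induction n with
  | zero => simp [edgeList]
  | succ n ih =>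
    intro k f
    have := ih (k + 1) (f ∘ Fin.succ)
    rw [List.finRange_succ, List.map_cons, List.map_map, edgeList, this, List.flatMap_cons,
      List.flatMap_map]
    simp [add_assoc, add_comm 1]

theorem edgeList_eq_flatMap (bs : List (Owner × List ℕ)) :
    edgeList 0 bs = (List.finRange bs.length).flatMap fun v => bs[v].2.map (v.val, ·) := by
  have h := edgeList_map_finRange 0 fun v : Fin bs.length => bs[v]
  have h2 : (List.finRange bs.length).map (fun v : Fin bs.length => bs[v]) = bs :=
    List.map_getElem_finRange bs
  rw [h2] at h
  simpa using h

/-- Each vertex contributes its owner letter, and each edge the separator of a name. -/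
theorem length_le_length_render (s t : ℕ) (bs : List (Owner × List ℕ)) :
    bs.length ≤ (render s t bs).length ∧ (edgeList 0 bs).length ≤ (render s t bs).length := by
  have h1 : ∀ l : List ℕ, l.length ≤ (l.flatMap indexName).length := by
    intro l
    induction l with
    | nil => simp
    | cons k l ih => simp [indexName] at ih ⊢; omega
  have h2 : ∀ (bs : List (Owner × List ℕ)) (v : ℕ), bs.length ≤ (bs.flatMap renderBlock).length ∧
      (edgeList v bs).length ≤ (bs.flatMap renderBlock).length := by
    intro bs
    induction bs with
    | nil => simp [edgeList]
    | cons d bs ih =>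
      intro v
      have h3 := ih (v + 1)
      have h4 := h1 d.2
      rw [List.flatMap_cons, List.length_append, renderBlock, List.length_cons, List.length_cons,
        edgeList, List.length_append, List.length_map]
      omega
  have := h2 bs 0
  rw [render, List.length_append]
  omega

namespace SwitchingGame

open CounterProg

variable {n : ℕ} {G : SwitchingGame (Fin n)} {adj : Fin n → List (Fin n)}

/-- The lists `adj` are the adjacency lists of the game, in switching order. -/
structure IsAdjacencyLists (G : SwitchingGame (Fin n)) (adj : Fin n → List (Fin n)) : Prop where
  nodup : ∀ v, (adj v).Nodup
  mem_iff : ∀ v u, u ∈ adj v ↔ (v, u) ∈ G.edges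
  eq_ord : ∀ v : G.Switch, adj v.1 = G.ord v

/-- The owners and the adjacency lists of the vertices of a game. -/
def blocks (G : SwitchingGame (Fin n)) (adj : Fin n → List (Fin n)) : List (Owner × List ℕ) :=
  (List.finRange n).map fun v => (G.owner v, (adj v).map Fin.val)

theorem isDescribedBy_iff {w : List GameSymbol} : G.IsDescribedBy w ↔
    ∃ adj, G.IsAdjacencyLists adj ∧ w = render G.source G.target (G.blocks adj) := by
  have h : ∀ adj : Fin n → List (Fin n), render G.source G.target (G.blocks adj) =
      vertexName G.source ++ vertexName G.target ++ (List.finRange n).flatMap fun v =>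
        GameSymbol.owner (G.owner v) :: (adj v).flatMap vertexName := by
    intro adj
    simp only [render, blocks, List.flatMap_map, renderBlock]
    rfl
  constructor
  · rintro ⟨adj, h1, h2, h3⟩
    exact ⟨adj, ⟨fun v => (h1 v).1, fun v => (h1 v).2, h2⟩, by rw [h, h3]⟩
  · rintro ⟨adj, h1, h2⟩
    exact ⟨adj, fun v => ⟨h1.nodup v, h1.mem_iff v⟩, h1.eq_ord, by rw [h2, h]⟩

theorem length_blocks : (G.blocks adj).length = n := by simp [blocks]

theorem edgeList_blocks : edgeList 0 (G.blocks adj) =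
    (List.finRange n).flatMap fun v => (adj v).map fun u => (v.val, u.val) := by
  rw [blocks, edgeList_map_finRange]
  simp [Function.comp_def]

theorem mem_edgeList_blocks (h : G.IsAdjacencyLists adj) {e : ℕ × ℕ} :
    e ∈ edgeList 0 (G.blocks adj) ↔ ∃ e' : G.edges, (e'.1.1.val, e'.1.2.val) = e := by
  simp only [edgeList_blocks, List.mem_flatMap, List.mem_finRange, true_and, List.mem_map,
    h.mem_iff, Subtype.exists, Prod.exists]
  constructor
  · rintro ⟨v, u, h1, h2⟩
    exact ⟨v, u, h1, h2⟩
  · rintro ⟨v, u, h1, h2⟩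
    exact ⟨v, u, h1, h2⟩

theorem nodup_edgeList_blocks (h : G.IsAdjacencyLists adj) : (edgeList 0 (G.blocks adj)).Nodup := by
  rw [edgeList_blocks, List.nodup_flatMap]
  refine ⟨fun v _ => (h.nodup v).map fun u u' huu => ?_, ?_⟩
  · exact Fin.ext (congrArg Prod.snd huu)
  · refine (List.nodup_finRange n).imp fun {v w} hvw => ?_
    rw [Function.onFun, List.disjoint_left]
    intro e h1 h2
    obtain ⟨u, -, rfl⟩ := List.mem_map.1 h1
    obtain ⟨u', -, h3⟩ := List.mem_map.1 h2
    exact hvw (Fin.ext (congrArg Prod.fst h3).symm)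

theorem validDescription_blocks (hG : G.OnePlayer) (h : G.IsAdjacencyLists adj) :
    ValidDescription G.source G.target (G.blocks adj) where
  owner d hd := by
    obtain ⟨v, -, rfl⟩ := List.mem_map.1 hd
    exact hG v
  source := by rw [length_blocks]; exact G.source.2
  target := by rw [length_blocks]; exact G.target.2
  name e he := by
    obtain ⟨e', rfl⟩ := (mem_edgeList_blocks h).1 he
    rw [length_blocks]
    exact e'.1.2.2
  nodup := nodup_edgeList_blocks h

/-- The bound on names turns the numbers into vertices, and distinctness of the edges makes each
adjacency list free of repetitions, so it can serve as switching order. -/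
theorem _root_.CounterProg.ValidDescription.exists_game {s t : ℕ} {bs : List (Owner × List ℕ)}
    (h : ValidDescription s t bs) :
    ∃ (n : ℕ) (G : SwitchingGame (Fin n)) (adj : Fin n → List (Fin n)), G.OnePlayer ∧
      G.IsAdjacencyLists adj ∧ G.source.val = s ∧ G.target.val = t ∧ G.blocks adj = bs := by
  have hname : ∀ (v : Fin bs.length), ∀ u ∈ bs[v].2, u < bs.length := by
    intro v u hu
    refine h.name (v.val, u) ?_
    rw [edgeList_eq_flatMap, List.mem_flatMap]
    exact ⟨v, List.mem_finRange v, List.mem_map_of_mem hu⟩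
  have hnodup : ∀ v : Fin bs.length, bs[v].2.Nodup := by
    intro v
    have h1 := h.nodup
    rw [edgeList_eq_flatMap, List.nodup_flatMap] at h1
    exact (h1.1 v (List.mem_finRange v)).of_map _
  let adj : Fin bs.length → List (Fin bs.length) := fun v => bs[v].2.pmap Fin.mk (hname v)
  have hadj : ∀ v, (adj v).Nodup := fun v => (hnodup v).pmap fun _ _ _ _ h => congrArg Fin.val h
  let G : SwitchingGame (Fin bs.length) :=
    { edges := Finset.univ.filter fun e => e.2 ∈ adj e.1
      owner := fun v => bs[v].1
      ord := fun v => adj v.1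
      ord_nodup := fun v => hadj v.1
      mem_ord := by simp
      source := ⟨s, h.source⟩
      target := ⟨t, h.target⟩ }
  refine ⟨bs.length, G, adj, fun v => h.owner _ (List.getElem_mem _),
    ⟨hadj, by simp [G], fun _ => rfl⟩, rfl, rfl, ?_⟩
  have h1 : ∀ v : Fin bs.length, (G.owner v, (adj v).map Fin.val) = bs[v] := by
    intro v
    refine Prod.ext rfl ?_
    simp only [adj, List.map_pmap]
    simp
  rw [blocks, List.map_congr_left fun v _ => h1 v]
  exact List.map_getElem_finRange bs

theorem sum_map_edgeList_blocks (h : G.IsAdjacencyLists adj) (f : ℕ × ℕ → ℕ) :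
    ((edgeList 0 (G.blocks adj)).map f).sum = ∑ e : G.edges, f (e.1.1, e.1.2) := by
  rw [← List.sum_toFinset f (nodup_edgeList_blocks h)]
  symm
  refine Finset.sum_nbij (fun e => (e.1.1.val, e.1.2.val)) ?_ ?_ ?_ fun _ _ => rfl
  · intro e _
    rw [List.mem_toFinset, mem_edgeList_blocks h]
    exact ⟨e, rfl⟩
  · intro e _ e' _ hee
    rw [Prod.mk_inj] at hee
    exact Subtype.ext (Prod.ext (Fin.ext hee.1) (Fin.ext hee.2))
  · intro e he
    rw [Finset.mem_coe, List.mem_toFinset, mem_edgeList_blocks h] at he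
    obtain ⟨e', rfl⟩ := he
    exact ⟨e', by simp, rfl⟩

theorem _root_.List.flatMap_ite_eq {α β : Type*} [DecidableEq α] {L : List α} (hL : L.Nodup) {a : α}
    (ha : a ∈ L) (g : α → List β) : (L.flatMap fun b => if b = a then g b else []) = g a := by
  induction L with
  | nil => simp at ha
  | cons b L ih =>
    rw [List.nodup_cons] at hL
    rw [List.flatMap_cons]
    by_cases hb : b = a
    · subst hb
      have : (L.flatMap fun c => if c = b then g c else []) = [] := by
        rw [List.flatMap_eq_nil_iff]
        intro c hc
        rw [if_neg]
        rintro rfl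
        exact hL.1 hc
      simp [this]
    · rw [if_neg hb, ih hL.2 (List.mem_of_ne_of_mem (Ne.symm hb) ha), List.nil_append]

/-- The edge list preserves the order within each adjacency list. Hence positions among the filtered
edges are positions in the switching order. -/
theorem filter_edgeList_blocks (v : Fin n) :
    ((edgeList 0 (G.blocks adj)).filter fun e => e.1 = v.val) =
      (adj v).map fun u => (v.val, u.val) := by
  rw [edgeList_blocks, List.filter_flatMap, ← List.flatMap_ite_eq (List.nodup_finRange n)
    (List.mem_finRange v) fun v => (adj v).map fun u => (v.val, u.val)]
  congr 1
  funext w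
  split_ifs with hw
  · subst hw
    rw [List.filter_eq_self]
    simp
  · rw [List.filter_eq_nil_iff]
    intro e he
    obtain ⟨u, -, rfl⟩ := List.mem_map.1 he
    simpa [Fin.ext_iff] using hw

theorem bal_eq (h : G.IsAdjacencyLists adj) (F : ℕ × ℕ → ℕ) (v : Fin n) :
    G.bal (fun e => F (e.1.1, e.1.2)) v =
      (outSum v F (edgeList 0 (G.blocks adj)) : ℤ) - inSum v F (edgeList 0 (G.blocks adj)) := by
  rw [outSum, inSum, sum_map_edgeList_blocks h, sum_map_edgeList_blocks h, bal, Finset.sum_filter,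
    Finset.sum_filter]
  push_cast
  simp [Fin.ext_iff]

theorem isControlledSwitchingFlow_iff (h : G.IsAdjacencyLists adj) (hst : G.source ≠ G.target)
    (F : ℕ × ℕ → ℕ) :
    G.IsControlledSwitchingFlow (fun e => F (e.1.1, e.1.2)) ↔
      ∀ v o, ((G.blocks adj).map Prod.fst)[v]? = some o →
        FlowAt G.source G.target (edgeList 0 (G.blocks adj)) F v o := by
  have howner : ∀ v : Fin n, ((G.blocks adj).map Prod.fst)[v.val]? = some (G.owner v) := by
    intro v
    simp [blocks]
  constructor
  · intro hF v o hv
    have hvn : v < n := by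
      have := (List.getElem?_eq_some_iff.1 hv).1
      rwa [List.length_map, length_blocks] at this
    obtain ⟨v, rfl⟩ : ∃ v' : Fin n, v'.val = v := ⟨⟨v, hvn⟩, rfl⟩
    rw [howner, Option.some_inj] at hv
    refine ⟨?_, fun ho => ?_⟩
    · rw [← bal_eq h]
      by_cases hs : G.source = v
      · subst hs
        rw [hF.bal_source, if_pos rfl, if_neg fun h => hst (Fin.ext h.symm)]
        rfl
      · by_cases ht : G.target = v
        · subst ht
          rw [hF.bal_target, if_pos rfl, if_neg fun h => hst (Fin.ext h)]
          rfl
        · rw [hF.bal_other v (Ne.symm hs) (Ne.symm ht), if_neg fun h => hs (Fin.ext h),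
            if_neg fun h => ht (Fin.ext h)]
          rfl
    · obtain ⟨c, i, -, hc⟩ := hF.switching ⟨v, hv.trans ho⟩
      refine ⟨c, i, fun j e he => ?_⟩
      rw [filter_edgeList_blocks, h.eq_ord ⟨v, hv.trans ho⟩, List.getElem?_map,
        Option.map_eq_some_iff] at he
      obtain ⟨u, hu, rfl⟩ := he
      exact hc j ⟨(v, u), (G.mem_ord _ _).1 (List.mem_of_getElem? hu)⟩ rfl hu
  · intro hF
    have hbal := fun v : Fin n => (bal_eq h F v).trans (hF v _ (howner v)).balance
    refine ⟨?_, ?_, ?_, fun v => ?_⟩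
    · rw [hbal, if_pos rfl, if_neg fun h => hst (Fin.ext h.symm)]
      rfl
    · rw [hbal, if_pos rfl, if_neg fun h => hst (Fin.ext h)]
      rfl
    · intro v hs ht
      rw [hbal, if_neg fun h => hs (Fin.ext h.symm), if_neg fun h => ht (Fin.ext h.symm)]
      rfl
    · obtain ⟨c, i, hc⟩ := (hF v _ (howner v)).switching v.2
      -- In `FlowAt` the step position `i` is not bounded; cutting it off at the out-degree does not
      -- affect actual positions.
      refine ⟨c, min i (G.ord v).length, min_le_right _ _, fun j e he hj => ?_⟩
      have hlt := (List.getElem?_eq_some_iff.1 hj).1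
      rw [hc j (e.1.1, e.1.2)]
      · simp [hlt]
      · rw [filter_edgeList_blocks, h.eq_ord v, List.getElem?_map, hj, he]
        rfl

end SwitchingGame

/-! ### Membership in NP -/

namespace CounterProg

open SwitchingGame

theorem mem_onePlayerReachability_iff (x : List GameSymbol) :
    x ∈ onePlayerReachability ↔ ∃ y : List Bool, y.length ≤ x.length * (x.length ^ 2 + 1) ∧
      eval (encodeInstanceCertificate (x, y)) verifier 0 Reg.bad = 0 := by
  simp only [verifier_spec]
  constructor
  · rintro ⟨n, G, hG, hx, hwin⟩
    obtain ⟨adj, hadj, rfl⟩ := isDescribedBy_iff.1 hx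
    have hvalid := validDescription_blocks hG hadj
    by_cases hst : G.source = G.target
    · exact ⟨[], Nat.zero_le _, _, _, _, rfl, hvalid, .inl (congrArg Fin.val hst)⟩
    obtain ⟨F, hF, hle⟩ := (reachWins_iff_flow hG hst).1 hwin
    -- The verifier sees edges as pairs of numbers, so the flow is extended by zero to all pairs.
    let F' : ℕ × ℕ → ℕ := Function.extend (fun e : G.edges => (e.1.1.val, e.1.2.val)) F 0
    have hinj : Function.Injective fun e : G.edges => (e.1.1.val, e.1.2.val) := by
      intro e e' hee
      rw [Prod.mk_inj] at hee
      exact Subtype.ext (Prod.ext (Fin.ext hee.1) (Fin.ext hee.2))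
    have hF' : ∀ e : G.edges, F' (e.1.1, e.1.2) = F e := fun e => hinj.extend_apply F 0 e
    have hFF' : F = fun e => F' (e.1.1, e.1.2) := funext fun e => (hF' e).symm
    have hn : n ≠ 0 := G.source.pos.ne'
    rw [hFF', isControlledSwitchingFlow_iff hadj hst] at hF
    -- From n < 2^n follows n^n < 2^(n * n), so n * n binary digits suffice. With the slice for `g₀`
    -- this makes n * n + 1 slices of one bit per edge.
    obtain ⟨y, hy, hacc⟩ := exists_acceptAt_of_flow (K := n * n) (fun h => hst (Fin.ext h))
      (by rw [List.length_map]; exact hvalid.source) hF fun e he => by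
        obtain ⟨e', rfl⟩ := (mem_edgeList_blocks hadj).1 he
        rw [hF', pow_mul]
        have := hle e'
        rw [Fintype.card_fin] at this
        exact this.trans_lt (Nat.pow_lt_pow_left Nat.lt_two_pow_self hn)
    refine ⟨y, ?_, _, _, _, rfl, hvalid, .inr hacc⟩
    obtain ⟨h1, h2⟩ := length_le_length_render G.source G.target (G.blocks adj)
    rw [length_blocks] at h1
    rw [hy, mul_comm, sq]
    gcongr
  · rintro ⟨y, -, s, t, bs, rfl, hvalid, h⟩
    obtain ⟨n, G, adj, hG, hadj, rfl, rfl, rfl⟩ := hvalid.exists_game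
    refine ⟨n, G, hG, isDescribedBy_iff.2 ⟨adj, hadj, rfl⟩, ?_⟩
    by_cases hst : G.source = G.target
    · exact reachWins_of_source_eq_target hG hst
    obtain ⟨F, hF⟩ := exists_flow_of_acceptAt hvalid.nodup (fun h => hst (Fin.ext h))
      (by rw [List.length_map]; exact hvalid.source)
      (h.resolve_left fun h => hst (Fin.ext h))
    obtain ⟨q, z, hq, hz⟩ := ((isControlledSwitchingFlow_iff hadj hst F).2 hF).exists_isPlayPrefix
    exact reachWins_of_isPlayPrefix hG hq hz

end CounterProg

theorem mainTheorem2 :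
    (∀ (V : Type*) [Fintype V] [DecidableEq V] (G : SwitchingGame V),
      G.OnePlayer → G.source ≠ G.target →
        (G.ReachWins ↔ ∃ F : G.edges → ℕ, G.IsControlledSwitchingFlow F ∧
          ∀ e, F e ≤ Fintype.card V ^ Fintype.card V)) ∧
    InNP onePlayerReachability := by
  refine ⟨fun V _ _ G hG hst => SwitchingGame.reachWins_iff_flow hG hst,
    Polynomial.X * (Polynomial.X ^ 2 + 1), _,
    CounterProg.computableInPolyTime encodeInstanceCertificate CounterProg.wf_verifier Reg.bad,
    fun x => ?_⟩
  simpa using CounterProg.mem_onePlayerReachability_iff x
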